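/- Let $1\le k<n$, let $\mathcal I_{k,n}\subset\mathbb C[p_J]$, $J=(j_1<\dots<j_k)\subset[n]$, be the Plücker ideal (the ideal of all algebraic relations among the maximal minors of a generic $n\times k$ matrix) and let $A_{k,n}=\mathbb C[p_J]/\mathcal I_{k,n}=\bigoplus_r A_r$ be the homogeneous coordinate ring of $\mathrm{Gr}(k,\mathbb C^n)$, with Plücker coordinates $\bar p_J$. Birational and iterated sequences. For a sequence $S=(\beta_1,\dots,\beta_d)$ of positive roots $\varepsilon_i-\varepsilon_j$ ($1\le i<j\le n$) let $\psi_S(y)=\prod_{t=1}^d(1+y_tf_{\beta_t})$, where $f_{i,j}$ is the elementary matrix with entry $1$ in position $(j,i)$, and let $\psi_S^*:A_{k,n}\to\mathbb C[y_1,\dots,y_d]$ send $\bar p_J$ to the minor of $\psi_S(y)$ with columns $[k]$ and rows $J$. The sequence $S$ is birational for $\mathrm{Gr}(k,\mathbb C^n)$ if $d=k(n-k)$ and $\psi_S$ induces a birational map from $\mathbb A^d$ to the open cell $U_k^-\subset\mathrm{Gr}(k,\mathbb C^n)$, i.e. $\psi_S^*$ induces an isomorphism $\mathbb C(U_k^-)\cong\mathbb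 C(y_1,\dots,y_d)$. It is iterated if it is obtained from a birational sequence for $\mathrm{Gr}(k,\mathbb C^{k+1})$ by $n-k-1$ extension steps $(\beta_1,\dots,\beta_{d'})\mapsto(\varepsilon_{i_1}-\varepsilon_{m+1},\dots,\varepsilon_{i_k}-\varepsilon_{m+1},\beta_1,\dots,\beta_{d'})$, passing from $\mathbb C^m$ to $\mathbb C^{m+1}$, with distinct $i_1,\dots,i_k\in[m]$. The valuation. Order $\mathbb Z^d$ by $a\prec_\Psi b$ iff $\Psi(a)<\Psi(b)$, or $\Psi(a)=\Psi(b)$ and $a>_{\rm lex}b$, where $\Psi(a)=\sum_t a_t\,\mathrm{ht}(\beta_t)$ and $\mathrm{ht}(\varepsilon_i-\varepsilon_j)=j-i$. For a nonzero homogeneous $f\in A_{k,n}$ let $\mathfrak v_S(f)\in\mathbb Z^d$ be the $\prec_\Psi$-minimal exponent of $\psi_S^*(f)$. Let $M_S$ be the matrix with columns $\mathfrak v_S(\bar p_J)$, let $\mathrm{in}_{M_S}(\mathcal I_{k,n})$ be the ideal generated by the $M_S$-initial forms of the elements of $\mathcal I_{k,n}$ (the sums of the terms $c_up^u$ for which $M_Su$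 is $\prec_\Psi$-minimal), and let $$\mathrm{gr}_S(A_{k,n})=\bigoplus_{r\ge0,\ a\in\mathbb Z^d}\{f\in A_r:f=0\text{ or }\mathfrak v_S(f)\succeq a\}\big/\{f\in A_r:f=0\text{ or }\mathfrak v_S(f)\succ a\}.$$ Let $Q_S=\{(r,\mathfrak v_S(f)):0\ne f\in A_r\}$ be the value semigroup. Theorem. Let $S$ be an iterated sequence for $\mathrm{Gr}(k,\mathbb C^n)$. 1. $\mathfrak v_S$ is a valuation on the nonzero homogeneous elements of $A_{k,n}$ and has full rank: its values generate a sublattice of rank $d=k(n-k)$ in $\mathbb Z^d$. 2. There is a cone $C$ of the tropical Grassmannian $\mathrm{trop}(\mathrm{Gr}(k,\mathbb C^n))$, with the fan structure induced by the Gröbner fan of $\mathcal I_{k,n}$, such that $\mathrm{in}_{M_S}(\mathcal I_{k,n})=\mathrm{in}_C(\mathcal I_{k,n})$, i.e. $\mathrm{in}_{M_S}(\mathcal I_{k,n})=\mathrm{in}_w(\mathcal I_{k,n})$ for every $w$ in the relative interior of $C$ (minimum convention). 3. Suppose $\mathrm{in}_{M_S}(\mathcal I_{k,n})$ is prime. Then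 $S$ defines a toric degeneration of $\mathrm{Gr}(k,\mathbb C^n)$: $Q_S$ is finitely generated, $\mathrm{gr}_S(A_{k,n})\cong\mathbb C[Q_S]$ as $Q_S$-graded algebras, and there is a flat graded $\mathbb C[t]$-algebra of finite type whose fibre at every $t\ne0$ is isomorphic to $A_{k,n}$ and whose fibre at $t=0$ is isomorphic to $\mathrm{gr}_S(A_{k,n})$, as graded algebras. Moreover there is an isomorphism of $\mathbb C$-algebras $\mathbb C[p_J]/\mathrm{in}_{M_S}(\mathcal I_{k,n})\cong\mathrm{gr}_S(A_{k,n})$ that sends the class of each $p_J$ to the class of $\bar p_J$ in degree $(1,\mathfrak v_S(\bar p_J))$. -/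

import Mathlib

noncomputable section

namespace FFLGr

/-! ### The Plücker algebra of the Grassmannian -/

/-- Ordered sequences `i₁ < ⋯ < i_k` in `{1, …, n}` (with indices starting at `0`). -/
abbrev Idx (k n : ℕ) : Type := Fin k ↪o Fin n

/-- The ring map `p_J ↦ (maximal minor of M on the rows J)` attached to an `n × k` matrix `M`. -/
def pluckerHom {k n : ℕ} {R : Type} [CommRing R] [Algebra ℂ R] (M : Matrix (Fin n) (Fin k) R) :
    MvPolynomial (Idx k n) ℂ →ₐ[ℂ] R :=
  MvPolynomial.aeval fun J => (M.submatrix J id).det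

/-- The `n × k` matrix of independent variables. -/
def genericMatrix (k n : ℕ) : Matrix (Fin n) (Fin k) (MvPolynomial (Fin n × Fin k) ℂ) :=
  fun i j => MvPolynomial.X (i, j)

/-- The Plücker ideal: all algebraic relations between the maximal minors, i.e. the vanishing ideal
of the Grassmannian in its Plücker embedding. -/
def pluckerIdeal (k n : ℕ) : Ideal (MvPolynomial (Idx k n) ℂ) :=
  RingHom.ker (pluckerHom (genericMatrix k n))

/-- The homogeneous coordinate ring `A_{k,n}` of the Grassmannian. -/
def PlAlg (k n : ℕ) : Type := MvPolynomial (Idx k n) ℂ ⧸ pluckerIdeal k n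

instance (k n : ℕ) : CommRing (PlAlg k n) :=
  inferInstanceAs (CommRing (MvPolynomial (Idx k n) ℂ ⧸ pluckerIdeal k n))

instance (k n : ℕ) : Algebra ℂ (PlAlg k n) :=
  inferInstanceAs (Algebra ℂ (MvPolynomial (Idx k n) ℂ ⧸ pluckerIdeal k n))

/-- The quotient map onto `A_{k,n}`. -/
def plMk (k n : ℕ) : MvPolynomial (Idx k n) ℂ →ₐ[ℂ] PlAlg k n :=
  Ideal.Quotient.mkₐ ℂ (pluckerIdeal k n)

/-- The Plücker coordinate `p̄_J`. -/
def pbar {k n : ℕ} (J : Idx k n) : PlAlg k n :=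
  plMk k n (MvPolynomial.X J)

/-- The degree `r` part of `A_{k,n}`. -/
def plDeg (k n r : ℕ) : Submodule ℂ (PlAlg k n) :=
  (MvPolynomial.homogeneousSubmodule (Idx k n) ℂ r).map
    (plMk k n).toLinearMap

theorem pluckerHom_eq_zero {k n : ℕ} {R : Type} [CommRing R] [Algebra ℂ R]
    (M : Matrix (Fin n) (Fin k) R) (f : MvPolynomial (Idx k n) ℂ) (hf : f ∈ pluckerIdeal k n) :
    pluckerHom M f = 0 := by
  have h : pluckerHom M =
      (MvPolynomial.aeval (fun p : Fin n × Fin k => M p.1 p.2)).comp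
        (pluckerHom (genericMatrix k n)) := by
    apply MvPolynomial.algHom_ext
    intro J
    simp only [pluckerHom, AlgHom.comp_apply, MvPolynomial.aeval_X]
    rw [AlgHom.map_det]
    congr 1
    ext i j
    simp [genericMatrix]
  have h0 : pluckerHom (genericMatrix k n) f = 0 := hf
  rw [h, AlgHom.comp_apply, h0, map_zero]

/-- Evaluation of the Plücker coordinates at (the column span of) a matrix `M`. -/
def plEval {k n : ℕ} {R : Type} [CommRing R] [Algebra ℂ R] (M : Matrix (Fin n) (Fin k) R) :
    PlAlg k n →ₐ[ℂ] R :=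
  Ideal.Quotient.liftₐ (pluckerIdeal k n) (pluckerHom M) (pluckerHom_eq_zero M)

/-! ### Birational and iterated sequences -/

/-- Positive roots `ε_i - ε_j`, `i < j`, of type `A_{n-1}`. -/
abbrev PosRoot (n : ℕ) : Type := {p : Fin n × Fin n // p.1 < p.2}

/-- The height `j - i` of `ε_i - ε_j`. -/
def PosRoot.height {n : ℕ} (b : PosRoot n) : ℤ := (b.1.2 : ℤ) - (b.1.1 : ℤ)

/-- The product `exp(y₁ f_{β₁}) ⋯ exp(y_d f_{β_d})` for `S = (β₁, …, β_d)`, with indeterminates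
`y₁, …, y_d`; here `exp(z f_{i,j}) = 1 + z E_{j,i}`. -/
def rootProduct {n : ℕ} (S : List (PosRoot n)) :
    Matrix (Fin n) (Fin n) (MvPolynomial (Fin S.length) ℂ) :=
  (List.ofFn fun t : Fin S.length =>
    (1 : Matrix (Fin n) (Fin n) (MvPolynomial (Fin S.length) ℂ)) +
      Matrix.single (S.get t).1.2 (S.get t).1.1 (MvPolynomial.X t)).prod

/-- The first `k` columns of the product. -/
def rootColumns {k n : ℕ} (hkn : k ≤ n) (S : List (PosRoot n)) :
    Matrix (Fin n) (Fin k) (MvPolynomial (Fin S.length) ℂ) :=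
  (rootProduct S).submatrix id (Fin.castLE hkn)

/-- The first `k` columns of the generic element of `U_k^-`: the identity matrix on top of a
block of independent variables. -/
def cellColumns (k n : ℕ) :
    Matrix (Fin n) (Fin k) (MvPolynomial {p : Fin n × Fin k // k ≤ (p.1 : ℕ)} ℂ) :=
  fun i j =>
    if h : k ≤ (i : ℕ) then MvPolynomial.X ⟨(i, j), h⟩ else if (i : ℕ) = (j : ℕ) then 1 else 0

/-- The pull back `ψ_S^*` on the homogeneous coordinate ring. The Plücker coordinate of the base
point is sent to `1`. -/
def psiStar {k n : ℕ} (hkn : k ≤ n) (S : List (PosRoot n)) :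
    PlAlg k n →ₐ[ℂ] MvPolynomial (Fin S.length) ℂ :=
  plEval (rootColumns hkn S)

/-- `S` is a birational sequence for `Gr(k, ℂⁿ)`: it consists of `k(n-k)` positive roots and the
multiplication map into `U^-`, followed by the projection to `Gr(k, ℂⁿ)` with its open cell
`U_k^-`, is birational. That is, there is an isomorphism of the function fields of `U_k^-` and of
affine space that sends the Plücker coordinates on `U_k^-` to those of the product (on both sides
the coordinate of the base point is `1`). -/
def IsBirational {k n : ℕ} (hkn : k ≤ n) (S : List (PosRoot n)) : Prop :=
  S.length = k * (n - k) ∧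
  ∃ e : FractionRing (MvPolynomial {p : Fin n × Fin k // k ≤ (p.1 : ℕ)} ℂ) ≃ₐ[ℂ]
      FractionRing (MvPolynomial (Fin S.length) ℂ),
    ∀ J : Idx k n,
      e (algebraMap _ _ (plEval (cellColumns k n) (pbar J))) =
        algebraMap _ _ (psiStar hkn S (pbar J))

/-- The positive root `ε_i - ε_j` of `A_{n-1}`, seen in `A_n`. -/
def PosRoot.lift {n : ℕ} (b : PosRoot n) : PosRoot (n + 1) :=
  ⟨(b.1.1.castSucc, b.1.2.castSucc), Fin.castSucc_lt_castSucc_iff.mpr b.2⟩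

/-- `(ε_{i₁} - ε_{n+1}, …, ε_{i_k} - ε_{n+1}, β₁, …, β_d)`. -/
def extendSeq {k n : ℕ} (i : Fin k → Fin n) (S : List (PosRoot n)) : List (PosRoot (n + 1)) :=
  (List.ofFn fun l : Fin k =>
    (⟨((i l).castSucc, Fin.last n), Fin.castSucc_lt_last (i l)⟩ : PosRoot (n + 1))) ++
  S.map PosRoot.lift

/-- Iterated sequences for `Gr(k, ℂⁿ)`. -/
inductive IsIterated (k : ℕ) : (n : ℕ) → List (PosRoot n) → Prop
  | base (S : List (PosRoot (k + 1))) (hS : IsBirational (Nat.le_succ k) S) :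
      IsIterated k (k + 1) S
  | step (n : ℕ) (S : List (PosRoot n)) (i : Fin k → Fin n) (hi : Function.Injective i)
      (hS : IsIterated k n S) : IsIterated k (n + 1) (extendSeq i S)

/-! ### The weighted order and the valuation -/

/-- The lattice `ℤ^d`, where `d` is the length of `S`. -/
abbrev Expo {n : ℕ} (S : List (PosRoot n)) : Type := Fin S.length → ℤ

/-- The height weighted function `Ψ_S`. -/
def Psi {n : ℕ} (S : List (PosRoot n)) (m : Expo S) : ℤ := ∑ t, m t * (S.get t).height

/-- The `Ψ_S`-weighted reverse lexicographic order, strict version. -/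
def PsiLT {n : ℕ} (S : List (PosRoot n)) (a b : Expo S) : Prop :=
  Psi S a < Psi S b ∨ (Psi S a = Psi S b ∧ toLex b < toLex a)

/-- The `Ψ_S`-weighted reverse lexicographic order. -/
def PsiLE {n : ℕ} (S : List (PosRoot n)) (a b : Expo S) : Prop := a = b ∨ PsiLT S a b

/-- An order embedding of `ℤ^d` with the weighted order into an ordered group of Mathlib. -/
def psiKey {n : ℕ} (S : List (PosRoot n)) (a : Expo S) :
    ℤ ×ₗ (Lex (Fin S.length → ℤ))ᵒᵈ :=
  toLex (Psi S a, OrderDual.toDual (toLex a))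

theorem psiKey_add {n : ℕ} (S : List (PosRoot n)) (a b : Expo S) :
    psiKey S (a + b) = psiKey S a + psiKey S b := by
  have h : Psi S (a + b) = Psi S a + Psi S b := by
    simp [Psi, add_mul, Finset.sum_add_distrib]
  unfold psiKey
  rw [h]
  rfl

theorem psiLT_iff {n : ℕ} (S : List (PosRoot n)) (a b : Expo S) :
    PsiLT S a b ↔ psiKey S a < psiKey S b := by
  unfold PsiLT psiKey
  rw [Prod.Lex.toLex_lt_toLex]
  simp

theorem psiLE_iff {n : ℕ} (S : List (PosRoot n)) (a b : Expo S) :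
    PsiLE S a b ↔ psiKey S a ≤ psiKey S b := by
  unfold PsiLE
  rw [psiLT_iff, le_iff_eq_or_lt]
  constructor
  · rintro (h | h)
    · exact Or.inl (by rw [h])
    · exact Or.inr h
  · rintro (h | h)
    · left
      have h2 := congrArg (fun z => OrderDual.ofDual (ofLex z).2) h
      exact toLex.injective h2
    · exact Or.inr h

theorem psiLE_add {n : ℕ} (S : List (PosRoot n)) {a b u v : Expo S} (h : PsiLE S a u)
    (h' : PsiLE S b v) : PsiLE S (a + b) (u + v) := by
  rw [psiLE_iff] at *
  rw [psiKey_add, psiKey_add]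
  exact add_le_add h h'

theorem psiLT_add {n : ℕ} (S : List (PosRoot n)) {a b u v : Expo S} (h : PsiLE S a u)
    (h' : PsiLT S b v) : PsiLT S (a + b) (u + v) := by
  rw [psiLE_iff] at h
  rw [psiLT_iff] at *
  rw [psiKey_add, psiKey_add]
  exact add_lt_add_of_le_of_lt h h'

theorem PsiLT.le {n : ℕ} {S : List (PosRoot n)} {a b : Expo S} (h : PsiLT S a b) : PsiLE S a b :=
  Or.inr h

/-- The exponent of a monomial in `y₁, …, y_d`, as an element of `ℤ^d`. -/
def expoOf {n : ℕ} (S : List (PosRoot n)) (u : Fin S.length →₀ ℕ) : Expo S := fun t => (u t : ℤ)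

theorem exists_min_expo {n : ℕ} (S : List (PosRoot n)) (f : MvPolynomial (Fin S.length) ℂ)
    (hf : f ≠ 0) : ∃ u ∈ f.support, ∀ u' ∈ f.support, PsiLE S (expoOf S u) (expoOf S u') := by
  obtain ⟨u, hu, h⟩ := Finset.exists_min_image f.support (fun u => psiKey S (expoOf S u))
    (MvPolynomial.support_nonempty.mpr hf)
  exact ⟨u, hu, fun u' hu' => (psiLE_iff S _ _).mpr (h u' hu')⟩

open Classical in
/-- The lowest term valuation on nonzero polynomials in `y₁, …, y_d` (and `0` at `0`). -/
def lowestExpo {n : ℕ} (S : List (PosRoot n)) (f : MvPolynomial (Fin S.length) ℂ) : Expo S :=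
  if hf : f ≠ 0 then expoOf S (exists_min_expo S f hf).choose else 0

/-- The valuation `𝔳_S`, used on the nonzero homogeneous elements of `A_{k,n}`. -/
def vS {k n : ℕ} (hkn : k ≤ n) (S : List (PosRoot n)) (f : PlAlg k n) : Expo S :=
  lowestExpo S (psiStar hkn S f)

theorem lowestExpo_le {n : ℕ} (S : List (PosRoot n)) (f : MvPolynomial (Fin S.length) ℂ)
    (u : Fin S.length →₀ ℕ) (hu : u ∈ f.support) : PsiLE S (lowestExpo S f) (expoOf S u) := by
  have hf : f ≠ 0 := by
    rintro rfl
    simp at hu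
  rw [lowestExpo, dif_pos hf]
  exact (exists_min_expo S f hf).choose_spec.2 u hu

/-- Valuations on the homogeneous elements of `A_{k,n}` with values in `(ℤ^d, ≺_Ψ)`. -/
structure IsGradedValuation {k n : ℕ} (S : List (PosRoot n)) (v : PlAlg k n → Expo S) : Prop where
  map_add : ∀ (r : ℕ) (f g : PlAlg k n), f ∈ plDeg k n r → g ∈ plDeg k n r →
    f ≠ 0 → g ≠ 0 → f + g ≠ 0 → PsiLE S (v f) (v (f + g)) ∨ PsiLE S (v g) (v (f + g))
  map_mul : ∀ (r s : ℕ) (f g : PlAlg k n), f ∈ plDeg k n r → g ∈ plDeg k n s →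
    f ≠ 0 → g ≠ 0 → v (f * g) = v f + v g
  map_smul : ∀ (r : ℕ) (c : ℂ) (f : PlAlg k n), f ∈ plDeg k n r → c ≠ 0 → f ≠ 0 →
    v (c • f) = v f

/-- The values of `v` on nonzero homogeneous elements. -/
def valueSet {k n : ℕ} (S : List (PosRoot n)) (v : PlAlg k n → Expo S) : Set (Expo S) :=
  {m | ∃ r, ∃ f ∈ plDeg k n r, f ≠ 0 ∧ v f = m}

/-- The rank of `v`: the rank of the sublattice of `ℤ^d` generated by the values. -/
def valRank {k n : ℕ} (S : List (PosRoot n)) (v : PlAlg k n → Expo S) : ℕ :=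
  Module.finrank ℤ (Submodule.span ℤ (valueSet S v))

/-- The value semigroup, where a value is recorded together with the degree. -/
def valueSemigroup {k n : ℕ} (hkn : k ≤ n) (S : List (PosRoot n)) : AddSubmonoid (ℕ × Expo S) :=
  AddSubmonoid.closure
    {q | ∃ f ∈ plDeg k n q.1, f ≠ 0 ∧ vS hkn S f = q.2}

/-! ### The associated graded algebra -/

/-- `{f ∈ A_r | f = 0 or 𝔳_S(f) ⪰ a}`. -/
def filGE {k n : ℕ} (hkn : k ≤ n) (S : List (PosRoot n)) (q : ℕ × Expo S) :
    Submodule ℂ (PlAlg k n) where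
  carrier := {f | f ∈ plDeg k n q.1 ∧
    ∀ u ∈ (psiStar hkn S f).support, PsiLE S q.2 (expoOf S u)}
  zero_mem' := ⟨zero_mem _, by simp⟩
  add_mem' := by
    classical
    rintro f g ⟨hf, hf'⟩ ⟨hg, hg'⟩
    refine ⟨add_mem hf hg, fun u hu => ?_⟩
    rw [map_add] at hu
    rcases Finset.mem_union.mp (MvPolynomial.support_add hu) with h | h
    · exact hf' u h
    · exact hg' u h
  smul_mem' := by
    rintro c f ⟨hf, hf'⟩
    refine ⟨Submodule.smul_mem _ c hf, fun u hu => hf' u ?_⟩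
    rw [map_smul] at hu
    exact MvPolynomial.support_smul hu

/-- `{f ∈ A_r | f = 0 or 𝔳_S(f) ≻ a}`. -/
def filGT {k n : ℕ} (hkn : k ≤ n) (S : List (PosRoot n)) (q : ℕ × Expo S) :
    Submodule ℂ (PlAlg k n) where
  carrier := {f | f ∈ plDeg k n q.1 ∧
    ∀ u ∈ (psiStar hkn S f).support, PsiLT S q.2 (expoOf S u)}
  zero_mem' := ⟨zero_mem _, by simp⟩
  add_mem' := by
    classical
    rintro f g ⟨hf, hf'⟩ ⟨hg, hg'⟩
    refine ⟨add_mem hf hg, fun u hu => ?_⟩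
    rw [map_add] at hu
    rcases Finset.mem_union.mp (MvPolynomial.support_add hu) with h | h
    · exact hf' u h
    · exact hg' u h
  smul_mem' := by
    rintro c f ⟨hf, hf'⟩
    refine ⟨Submodule.smul_mem _ c hf, fun u hu => hf' u ?_⟩
    rw [map_smul] at hu
    exact MvPolynomial.support_smul hu

theorem mem_filGE_iff {k n : ℕ} (hkn : k ≤ n) (S : List (PosRoot n)) (q : ℕ × Expo S)
    (f : PlAlg k n) (hf : psiStar hkn S f ≠ 0) :
    f ∈ filGE hkn S q ↔ f ∈ plDeg k n q.1 ∧ PsiLE S q.2 (vS hkn S f) := by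
  refine and_congr_right fun _ => ⟨fun h => ?_, fun h u hu => ?_⟩
  · rw [vS, lowestExpo, dif_pos hf]
    exact h _ (exists_min_expo S _ hf).choose_spec.1
  · have := lowestExpo_le S (psiStar hkn S f) u hu
    rw [psiLE_iff] at *
    exact h.trans this

theorem mem_filGT_iff {k n : ℕ} (hkn : k ≤ n) (S : List (PosRoot n)) (q : ℕ × Expo S)
    (f : PlAlg k n) (hf : psiStar hkn S f ≠ 0) :
    f ∈ filGT hkn S q ↔ f ∈ plDeg k n q.1 ∧ PsiLT S q.2 (vS hkn S f) := by
  refine and_congr_right fun _ => ⟨fun h => ?_, fun h u hu => ?_⟩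
  · rw [vS, lowestExpo, dif_pos hf]
    exact h _ (exists_min_expo S _ hf).choose_spec.1
  · have := lowestExpo_le S (psiStar hkn S f) u hu
    rw [psiLE_iff] at this
    rw [psiLT_iff] at *
    exact lt_of_lt_of_le h this

theorem plDeg_mul {k n r s : ℕ} {f g : PlAlg k n} (hf : f ∈ plDeg k n r) (hg : g ∈ plDeg k n s) :
    f * g ∈ plDeg k n (r + s) := by
  obtain ⟨f', hf', rfl⟩ := hf
  obtain ⟨g', hg', rfl⟩ := hg
  refine ⟨f' * g', ?_, by simp⟩
  exact MvPolynomial.IsHomogeneous.mul hf' hg'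

theorem support_mul_expo {n : ℕ} (S : List (PosRoot n)) (f g : MvPolynomial (Fin S.length) ℂ)
    (u : Fin S.length →₀ ℕ) (hu : u ∈ (f * g).support) :
    ∃ a ∈ f.support, ∃ b ∈ g.support, expoOf S u = expoOf S a + expoOf S b := by
  classical
  obtain ⟨a, ha, b, hb, rfl⟩ := Finset.mem_add.mp (MvPolynomial.support_mul f g hu)
  exact ⟨a, ha, b, hb, by ext t; simp [expoOf]⟩

theorem filGE_mul {k n : ℕ} (hkn : k ≤ n) (S : List (PosRoot n)) {q q' : ℕ × Expo S}
    {f g : PlAlg k n} (hf : f ∈ filGE hkn S q) (hg : g ∈ filGE hkn S q') :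
    f * g ∈ filGE hkn S (q + q') := by
  refine ⟨plDeg_mul hf.1 hg.1, fun u hu => ?_⟩
  rw [map_mul] at hu
  obtain ⟨a, ha, b, hb, h⟩ := support_mul_expo S _ _ u hu
  rw [h]
  exact psiLE_add S (hf.2 a ha) (hg.2 b hb)

theorem filGE_mul_filGT {k n : ℕ} (hkn : k ≤ n) (S : List (PosRoot n)) {q q' : ℕ × Expo S}
    {f g : PlAlg k n} (hf : f ∈ filGE hkn S q) (hg : g ∈ filGT hkn S q') :
    f * g ∈ filGT hkn S (q + q') := by
  refine ⟨plDeg_mul hf.1 hg.1, fun u hu => ?_⟩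
  rw [map_mul] at hu
  obtain ⟨a, ha, b, hb, h⟩ := support_mul_expo S _ _ u hu
  rw [h]
  exact psiLT_add S (hf.2 a ha) (hg.2 b hb)

theorem algebraMap_mem_filGE {k n : ℕ} (hkn : k ≤ n) (S : List (PosRoot n)) (c : ℂ) :
    algebraMap ℂ (PlAlg k n) c ∈ filGE hkn S 0 := by
  classical
  refine ⟨⟨MvPolynomial.C c, MvPolynomial.isHomogeneous_C _ c, ?_⟩, fun u hu => ?_⟩
  · exact AlgHom.commutes (plMk k n) c
  · rw [AlgHom.commutes, MvPolynomial.algebraMap_eq, MvPolynomial.mem_support_iff,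
      MvPolynomial.coeff_C] at hu
    left
    have : u = 0 := by
      by_contra h
      exact hu (if_neg (Ne.symm h))
    subst this
    ext t
    simp [expoOf]

/-- The Rees algebra `⨁_{r,a} F_{r,⪰a} T^{(r,a)}`. -/
def reesAlg {k n : ℕ} (hkn : k ≤ n) (S : List (PosRoot n)) :
    Subalgebra ℂ (AddMonoidAlgebra (PlAlg k n) (ℕ × Expo S)) where
  carrier := {x | ∀ q, x.coeff q ∈ filGE hkn S q}
  add_mem' := fun hx hy q => by
    rw [AddMonoidAlgebra.coeff_add]
    exact add_mem (hx q) (hy q)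
  mul_mem' := fun {x y} hx hy q => by
    classical
    rw [AddMonoidAlgebra.coeff_mul]
    refine Submodule.sum_mem _ fun a _ => Submodule.sum_mem _ fun b _ => ?_
    beta_reduce
    split_ifs with h
    · rw [← h]
      exact filGE_mul hkn S (hx a) (hy b)
    · exact zero_mem _
  algebraMap_mem' := fun c q => by
    classical
    rw [AddMonoidAlgebra.coe_algebraMap, Function.comp_apply, AddMonoidAlgebra.coeff_single,
      Finsupp.single_apply]
    split_ifs with h
    · rw [← h]
      exact algebraMap_mem_filGE hkn S c
    · exact zero_mem _

/-- The ideal `⨁_{r,a} F_{r,≻a} T^{(r,a)}` of the Rees algebra. -/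
def reesIdeal {k n : ℕ} (hkn : k ≤ n) (S : List (PosRoot n)) : Ideal (reesAlg hkn S) where
  carrier := {x | ∀ q, x.1.coeff q ∈ filGT hkn S q}
  zero_mem' := fun q => zero_mem _
  add_mem' := fun {x y} hx hy q => by
    change (x.1 + y.1).coeff q ∈ _
    rw [AddMonoidAlgebra.coeff_add]
    exact add_mem (hx q) (hy q)
  smul_mem' := fun x y hy q => by
    classical
    change (x.1 * y.1).coeff q ∈ _
    rw [AddMonoidAlgebra.coeff_mul]
    refine Submodule.sum_mem _ fun a _ => Submodule.sum_mem _ fun b _ => ?_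
    beta_reduce
    split_ifs with h
    · rw [← h]
      exact filGE_mul_filGT hkn S (x.2 a) (hy b)
    · exact zero_mem _

/-- The associated graded algebra `gr_S(A_{k,n}) = ⨁_{r,a} F_{r,⪰a} / F_{r,≻a}`. -/
def grS {k n : ℕ} (hkn : k ≤ n) (S : List (PosRoot n)) : Type :=
  reesAlg hkn S ⧸ reesIdeal hkn S

instance {k n : ℕ} (hkn : k ≤ n) (S : List (PosRoot n)) : CommRing (grS hkn S) :=
  inferInstanceAs (CommRing (reesAlg hkn S ⧸ reesIdeal hkn S))

instance {k n : ℕ} (hkn : k ≤ n) (S : List (PosRoot n)) : Algebra ℂ (grS hkn S) :=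
  inferInstanceAs (Algebra ℂ (reesAlg hkn S ⧸ reesIdeal hkn S))

/-- The quotient map from the Rees algebra onto `gr_S(A_{k,n})`. -/
def grMk {k n : ℕ} (hkn : k ≤ n) (S : List (PosRoot n)) : reesAlg hkn S →ₐ[ℂ] grS hkn S :=
  Ideal.Quotient.mkₐ ℂ (reesIdeal hkn S)

/-- The map `F_{r,⪰a} → gr_S(A_{k,n})`, whose kernel is `F_{r,≻a}`. -/
def toGr {k n : ℕ} (hkn : k ≤ n) (S : List (PosRoot n)) (q : ℕ × Expo S) :
    filGE hkn S q →ₗ[ℂ] grS hkn S where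
  toFun f := grMk hkn S
    ⟨AddMonoidAlgebra.single q f.1, fun q' => by
      classical
      rw [AddMonoidAlgebra.coeff_single, Finsupp.single_apply]
      split_ifs with h
      · rw [← h]
        exact f.2
      · exact zero_mem _⟩
  map_add' f g := by
    rw [← map_add]
    congr 1
    apply Subtype.ext
    simp
  map_smul' c f := by
    rw [RingHom.id_apply, ← map_smul]
    congr 1
    apply Subtype.ext
    simp

/-- The component of `gr_S(A_{k,n})` of bidegree `(r, a)`. -/
def grPiece {k n : ℕ} (hkn : k ≤ n) (S : List (PosRoot n)) (q : ℕ × Expo S) :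
    Submodule ℂ (grS hkn S) :=
  LinearMap.range (toGr hkn S q)

/-- The component of `gr_S(A_{k,n})` of degree `r`. -/
def grDeg {k n : ℕ} (hkn : k ≤ n) (S : List (PosRoot n)) (r : ℕ) : Submodule ℂ (grS hkn S) :=
  ⨆ a : Expo S, grPiece hkn S (r, a)

/-- The class in `gr_S(A_{k,n})` of a homogeneous element `f` of degree `r`, taken in
`F_{r,⪰a} / F_{r,≻a}` for `a = 𝔳_S(f)`. -/
def symbol {k n : ℕ} (hkn : k ≤ n) (S : List (PosRoot n)) (r : ℕ) (f : PlAlg k n)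
    (hf : f ∈ plDeg k n r) : grS hkn S :=
  toGr hkn S (r, vS hkn S f) ⟨f, hf, fun u hu => lowestExpo_le S _ u hu⟩

theorem pbar_mem {k n : ℕ} (J : Idx k n) : pbar J ∈ plDeg k n 1 :=
  ⟨MvPolynomial.X J, MvPolynomial.isHomogeneous_X ℂ J, rfl⟩

/-! ### Initial ideals -/

open Classical in
/-- The sum of those terms of `f` whose exponent is minimal for the preorder `le`. -/
def initForm {σ : Type} (le : (σ →₀ ℕ) → (σ →₀ ℕ) → Prop) (f : MvPolynomial σ ℂ) :
    MvPolynomial σ ℂ :=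
  ∑ u ∈ f.support.filter (fun u => ∀ u' ∈ f.support, le u u'),
    MvPolynomial.monomial u (f.coeff u)

/-- The ideal generated by the initial forms of the elements of `I`. -/
def initIdeal {σ : Type} (le : (σ →₀ ℕ) → (σ →₀ ℕ) → Prop) (I : Ideal (MvPolynomial σ ℂ)) :
    Ideal (MvPolynomial σ ℂ) :=
  Ideal.span (initForm le '' (I : Set (MvPolynomial σ ℂ)))

/-- `in_w(I)` for a weight vector `w`. -/
def initIdealVec {σ : Type} [Fintype σ] (w : σ → ℝ) (I : Ideal (MvPolynomial σ ℂ)) :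
    Ideal (MvPolynomial σ ℂ) :=
  initIdeal (fun u u' => ∑ j, w j * (u j : ℝ) ≤ ∑ j, w j * (u' j : ℝ)) I

/-- `in_M(I)` for a weight matrix `M`, where `ℤ^d` carries the order `≺_Ψ`. -/
def initIdealMat {n : ℕ} (S : List (PosRoot n)) {σ : Type} [Fintype σ]
    (M : Matrix (Fin S.length) σ ℤ) (I : Ideal (MvPolynomial σ ℂ)) : Ideal (MvPolynomial σ ℂ) :=
  initIdeal (fun u u' => PsiLE S (M.mulVec fun j => (u j : ℤ)) (M.mulVec fun j => (u' j : ℤ))) I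

/-- The weighting matrix `M_S`: its columns are the values of the Plücker coordinates. -/
def weightMatrix {k n : ℕ} (hkn : k ≤ n) (S : List (PosRoot n)) :
    Matrix (Fin S.length) (Idx k n) ℤ :=
  fun t J => vS hkn S (pbar J) t

/-! ### Tropicalization and its cones -/

/-- The extension of an ideal to the Laurent polynomial ring. -/
def laurentExt {σ : Type} (I : Ideal (MvPolynomial σ ℂ)) : Ideal (AddMonoidAlgebra ℂ (σ →₀ ℤ)) :=
  I.map (MvPolynomial.aeval fun j : σ =>
    (AddMonoidAlgebra.single (Finsupp.single j (1 : ℤ)) (1 : ℂ) :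
      AddMonoidAlgebra ℂ (σ →₀ ℤ))).toRingHom

/-- The tropical hypersurface of a Laurent polynomial: the minimum of `w · u` over the support is
attained at least twice. For `f = 0` it is the whole space. -/
def tropHypersurface {σ : Type} [Fintype σ] (f : AddMonoidAlgebra ℂ (σ →₀ ℤ)) : Set (σ → ℝ) :=
  {w | f ≠ 0 → ∃ u ∈ f.coeff.support, ∃ u' ∈ f.coeff.support, u ≠ u' ∧
    ∑ j, w j * (u j : ℝ) = ∑ j, w j * (u' j : ℝ) ∧
    ∀ v ∈ f.coeff.support, ∑ j, w j * (u j : ℝ) ≤ ∑ j, w j * (v j : ℝ)}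

/-- The tropicalization of `V(I)`. -/
def trop {σ : Type} [Fintype σ] (I : Ideal (MvPolynomial σ ℂ)) : Set (σ → ℝ) :=
  ⋂ f ∈ laurentExt I, tropHypersurface f

/-- The tropical Grassmannian. -/
def tropGr (k n : ℕ) : Set (Idx k n → ℝ) := trop (pluckerIdeal k n)

/-- The cones of the fan structure on `trop(V(I))` induced by the Gröbner fan of `I`: closures of
the classes of weight vectors in `trop(V(I))` with the same initial ideal. -/
def IsTropCone {σ : Type} [Fintype σ] (I : Ideal (MvPolynomial σ ℂ)) (C : Set (σ → ℝ)) : Prop :=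
  ∃ w ∈ trop I, C = closure {v | initIdealVec v I = initIdealVec w I}

/-- `in_C(I) = J`: the relative interior of `C` is nonempty and `in_w(I) = J` for every `w` in
it. -/
def ConeInit {σ : Type} [Fintype σ] (I : Ideal (MvPolynomial σ ℂ)) (C : Set (σ → ℝ))
    (J : Ideal (MvPolynomial σ ℂ)) : Prop :=
  (intrinsicInterior ℝ C).Nonempty ∧ ∀ w ∈ intrinsicInterior ℝ C, initIdealVec w I = J

/-! ### Toric degenerations -/

/-- `(A, 𝒜)` is the fibre at `t = c` of the graded `ℂ[t]`-algebra `(R, 𝓡)`: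
`R / (t - c) R ≅ A`, compatibly with the gradings. -/
def IsFibre {R A : Type} [CommRing R] [Algebra (Polynomial ℂ) R] [CommRing A] [Algebra ℂ A]
    (𝓡 : ℕ → Submodule (Polynomial ℂ) R) (𝒜 : ℕ → Submodule ℂ A) (c : ℂ) : Prop :=
  ∃ φ : R →+* A, Function.Surjective φ ∧
    RingHom.ker φ =
      Ideal.span {algebraMap (Polynomial ℂ) R (Polynomial.X - Polynomial.C c)} ∧
    (∀ p : Polynomial ℂ, φ (algebraMap _ R p) = algebraMap ℂ A (p.eval c)) ∧
    ∀ r, ∀ x ∈ 𝓡 r, φ x ∈ 𝒜 r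

/-- There is a flat family of graded algebras of finite type over `𝔸¹` whose fibres at all
`t ≠ 0` are `(A, 𝒜)` and whose fibre at `t = 0` is `(B, ℬ)`. -/
def IsFlatDegeneration {A B : Type} [CommRing A] [Algebra ℂ A] [CommRing B] [Algebra ℂ B]
    (𝒜 : ℕ → Submodule ℂ A) (ℬ : ℕ → Submodule ℂ B) : Prop :=
  ∃ (R : Type) (_ : CommRing R) (_ : Algebra (Polynomial ℂ) R)
    (𝓡 : ℕ → Submodule (Polynomial ℂ) R) (_ : GradedAlgebra 𝓡),
    Module.Flat (Polynomial ℂ) R ∧ Algebra.FiniteType (Polynomial ℂ) R ∧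
    (∀ c : ℂ, c ≠ 0 → IsFibre 𝓡 𝒜 c) ∧ IsFibre 𝓡 ℬ 0

/-- `S` defines a toric degeneration of `Gr(k, ℂⁿ)`: the coordinate ring of the Grassmannian
degenerates flatly to `gr_S(A_{k,n})`, which is the algebra of the value semigroup, and this
semigroup is finitely generated (so that the special fibre is a toric variety). -/
def DefinesToricDegeneration {k n : ℕ} (hkn : k ≤ n) (S : List (PosRoot n)) : Prop :=
  (valueSemigroup hkn S).FG ∧
  (∃ φ : AddMonoidAlgebra ℂ (valueSemigroup hkn S) ≃ₐ[ℂ] grS hkn S,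
    ∀ q, φ (AddMonoidAlgebra.single q 1) ∈ grPiece hkn S q.1) ∧
  IsFlatDegeneration (plDeg k n) (grDeg hkn S)

end FFLGr

end

/-!
Write `d = k (n - k)` for the length of the iterated sequence `S`, and `N` for the first `k` columns
of the matrix `ψ_S(y)`.

**Minor charts.** Each coordinate `y_t` is, up to a constant, the quotient of two maximal minors of
`N` (`IsIterated.isMinorChart`). An extension step appends to `N` a row which is a combination of
`k` of the previous rows, with the new variables as coefficients; by Cramer's rule each coefficient
is a quotient of two minors (`IsMinorChart.extend`). For a birational sequence in `ℂ^{k+1}` the last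
row of `ψ_S(y)⁻¹` consists of the minors of `N` up to sign. Since all these minors are nonzero, the
roots of `S` form a tree directed towards the vertex `k + 1`, the minors are the monomials of the
paths in this tree, and each variable is the quotient of the monomials of two such paths
(`isMinorChart_of_isBirational`).

**The valuation.** The minors of `N` are polynomials in the `d` affine coordinates of the open cell.
They generate a field of transcendence degree `d`, so these coordinates remain algebraically
independent as polynomials in `y`, and `ψ_S^*` is injective on homogeneous elements
(`IsMinorChart.mem_pluckerIdeal`). Hence lowest exponents define a valuation. The unit vectors of
`ℤ^d` are differences of values of Plücker coordinates (`exists_vS_eq_add_single`), which gives full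
rank. Values have one-dimensional leaves: taking lowest coefficients embeds `gr_S(A_{k,n})` into
Laurent polynomials (`grEmb`), with image the algebra of the value semigroup
(`exists_algEquiv_grS`).

**The tropical cone.** The classes of the Plücker coordinates in `gr_S(A_{k,n})` satisfy all initial
forms of Plücker relations (`wInit_le_ker_symbolHom`), while their monomials do not vanish, so the
initial ideal contains no monomial. An initial ideal is determined by finitely many strict
inequalities between weights, and a lexicographic order can be imitated on a finite set by a linear
functional, so the weights in `ℤ^d` can be replaced by integral weights
(`exists_nonpos_wInit_eq`). The weight vectors with a given initial ideal form a convex set that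
contains the relative interior of its closure (`wInit_eq_of_mem_intrinsicInterior`); this closure is
the cone (`exists_tropCone`). These arguments use standard monomials: an ideal and its initial ideal
have common monomial complements, hence equal Hilbert functions (`exists_division`,
`finrank_degPart_wInit`), and there are no proper inclusions between initial ideals
(`wInit_eq_of_le`).

**Prime initial ideals.** Suppose that the initial ideal is prime and misses a form `f` that
vanishes on the classes of the Plücker coordinates. Powers of `f`, multiplied by monomials with
distinct values, are linearly independent modulo the initial ideal. Since the values fill boxes in
`ℤ^d`, this yields at least `(m + 1) ^ (d + 1)` independent classes in a degree linear in `m`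
(`le_finrank_map_mk`). But the quotient has the Hilbert function of `A_{k,n}`, which is embedded in
polynomials in `d` variables whose degree is bounded linearly, so the dimension is `O(m ^ d)`. Hence
the initial ideal consists of all relations between the classes of the Plücker coordinates
(`wInit_eq_ker_symbolHom`). By subduction every value is then the value of a monomial
(`exists_plValue_eq_vS`), whence the value semigroup is finitely generated and the classes of the
Plücker coordinates generate `gr_S(A_{k,n})`. The degeneration is the quotient of `ℂ[t][p_J]` by the
kernel of `p_J ↦ p̄_J t^{m_J}` for the integral weights `m` found before
(`isFlatDegeneration_of_wInit`); as a subring of `A_{k,n}[t]` it is torsion-free, hence flat.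
-/

noncomputable section

namespace FFLGr

open MvPolynomial

/-! ### Initial ideals for weights in an ordered group -/

section InitialIdeals

variable {σ : Type} {Γ : Type} [AddCommGroup Γ] [LinearOrder Γ]

/-- The initial form of `f` for weights in an ordered group (minimum convention). -/
abbrev wForm (w : σ → Γ) (f : MvPolynomial σ ℂ) : MvPolynomial σ ℂ :=
  initForm (fun u u' => Finsupp.weight w u ≤ Finsupp.weight w u') f

/-- The initial ideal of `I` for weights in an ordered group (minimum convention). -/
abbrev wInit (w : σ → Γ) (I : Ideal (MvPolynomial σ ℂ)) : Ideal (MvPolynomial σ ℂ) :=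
  initIdeal (fun u u' => Finsupp.weight w u ≤ Finsupp.weight w u') I

/-- All exponents of `f` have weight at least `γ`. -/
def WeightGE (w : σ → Γ) (γ : Γ) (f : MvPolynomial σ ℂ) : Prop :=
  ∀ u ∈ f.support, γ ≤ Finsupp.weight w u

open Classical in
theorem coeff_initForm (le : (σ →₀ ℕ) → (σ →₀ ℕ) → Prop) (f : MvPolynomial σ ℂ) (u : σ →₀ ℕ) :
    coeff u (initForm le f) = if ∀ u' ∈ f.support, le u u' then coeff u f else 0 := by
  unfold initForm
  simp only [coeff_sum, coeff_monomial]
  rw [Finset.sum_ite_eq']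
  by_cases hu : u ∈ f.support
  · simp only [Finset.mem_filter, hu, true_and]
  · rw [notMem_support_iff.mp hu]
    simp

theorem initForm_zero (le : (σ →₀ ℕ) → (σ →₀ ℕ) → Prop) :
    initForm le (0 : MvPolynomial σ ℂ) = 0 := by
  simp [initForm]

theorem wForm_zero (w : σ → Γ) : wForm w 0 = 0 := initForm_zero _

theorem WeightGE.add {w : σ → Γ} {γ : Γ} {f g : MvPolynomial σ ℂ} (hf : WeightGE w γ f)
    (hg : WeightGE w γ g) : WeightGE w γ (f + g) := by
  classical
  intro u hu
  rcases Finset.mem_union.mp (support_add hu) with h | h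
  exacts [hf u h, hg u h]

theorem WeightGE.smul {w : σ → Γ} {γ : Γ} {f : MvPolynomial σ ℂ} (c : ℂ) (hf : WeightGE w γ f) :
    WeightGE w γ (c • f) :=
  fun u hu => hf u (support_smul hu)

theorem WeightGE.zero (w : σ → Γ) (γ : Γ) : WeightGE w γ 0 := by
  intro u hu
  simp at hu

/-- If the part of weight `γ` is nonzero and no exponent has smaller weight, that part is the
initial form. -/
theorem wForm_eq_component {w : σ → Γ} {γ : Γ} {f : MvPolynomial σ ℂ} (h : WeightGE w γ f)
    (hne : weightedHomogeneousComponent w γ f ≠ 0) :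
    wForm w f = weightedHomogeneousComponent w γ f := by
  classical
  obtain ⟨u₀, hu₀⟩ := MvPolynomial.ne_zero_iff.mp hne
  rw [coeff_weightedHomogeneousComponent] at hu₀
  split_ifs at hu₀ with hw₀
  · ext u
    rw [coeff_initForm, coeff_weightedHomogeneousComponent]
    by_cases hu : u ∈ f.support
    · congr 1
      rw [eq_iff_iff]
      constructor
      · intro hm
        exact le_antisymm ((hm u₀ (mem_support_iff.mpr hu₀)).trans hw₀.le) (h u hu)
      · intro hm u' hu'
        rw [hm]
        exact h u' hu'
    · rw [notMem_support_iff.mp hu]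
      simp
  · exact absurd rfl hu₀

theorem exists_wForm_eq_component (w : σ → Γ) {f : MvPolynomial σ ℂ} (hf : f ≠ 0) :
    ∃ γ, WeightGE w γ f ∧ weightedHomogeneousComponent w γ f ≠ 0 ∧
      wForm w f = weightedHomogeneousComponent w γ f := by
  classical
  obtain ⟨u, hu, h⟩ := Finset.exists_min_image f.support (fun u => Finsupp.weight w u)
    (support_nonempty.mpr hf)
  have hne : weightedHomogeneousComponent w (Finsupp.weight w u) f ≠ 0 := by
    rw [MvPolynomial.ne_zero_iff]
    refine ⟨u, ?_⟩
    rw [coeff_weightedHomogeneousComponent, if_pos rfl]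
    exact mem_support_iff.mp hu
  exact ⟨_, h, hne, wForm_eq_component h hne⟩

theorem wForm_ne_zero (w : σ → Γ) {f : MvPolynomial σ ℂ} (hf : f ≠ 0) : wForm w f ≠ 0 := by
  obtain ⟨γ, -, hne, h⟩ := exists_wForm_eq_component w hf
  rwa [h]

/-- The span of the initial forms of the elements of a subspace. -/
def initSpan (w : σ → Γ) (W : Submodule ℂ (MvPolynomial σ ℂ)) : Submodule ℂ (MvPolynomial σ ℂ) :=
  Submodule.span ℂ (wForm w '' (W : Set (MvPolynomial σ ℂ)))

theorem wForm_mem_initSpan (w : σ → Γ) {W : Submodule ℂ (MvPolynomial σ ℂ)} {f : MvPolynomial σ ℂ}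
    (hf : f ∈ W) : wForm w f ∈ initSpan w W :=
  Submodule.subset_span ⟨f, hf, rfl⟩

/-- Each weight component of an element of the initial space comes from an element of `W` without
terms of smaller weight. -/
theorem exists_component_eq {w : σ → Γ} {W : Submodule ℂ (MvPolynomial σ ℂ)} {x : MvPolynomial σ ℂ}
    (hx : x ∈ initSpan w W) (γ : Γ) :
    ∃ f ∈ W, WeightGE w γ f ∧
      weightedHomogeneousComponent w γ f = weightedHomogeneousComponent w γ x := by
  classical
  induction hx using Submodule.span_induction with
  | mem x hx =>
    obtain ⟨f, hf, rfl⟩ := hx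
    by_cases h0 : f = 0
    · exact ⟨0, zero_mem _, WeightGE.zero w γ, by rw [h0, wForm_zero]⟩
    obtain ⟨γ₀, hγ₀, -, h⟩ := exists_wForm_eq_component w h0
    by_cases hγ : γ = γ₀
    · subst hγ
      refine ⟨f, hf, hγ₀, ?_⟩
      rw [h, weightedHomogeneousComponent_eq_self
        (weightedHomogeneousComponent_isWeightedHomogeneous _ _)]
    · refine ⟨0, zero_mem _, WeightGE.zero w γ, ?_⟩
      rw [h, map_zero, (weightedHomogeneousComponent_isWeightedHomogeneous (w := w) γ₀
        f).weightedHomogeneousComponent_ne γ hγ]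
  | zero => exact ⟨0, zero_mem _, WeightGE.zero w γ, rfl⟩
  | add x y _ _ hx hy =>
    obtain ⟨f, hf, hf1, hf2⟩ := hx
    obtain ⟨g, hg, hg1, hg2⟩ := hy
    exact ⟨f + g, add_mem hf hg, hf1.add hg1, by rw [map_add, map_add, hf2, hg2]⟩
  | smul c x _ hx =>
    obtain ⟨f, hf, hf1, hf2⟩ := hx
    exact ⟨c • f, W.smul_mem c hf, hf1.smul c, by rw [map_smul, map_smul, hf2]⟩

theorem component_mem_initSpan_of_weightGE {w : σ → Γ} {W : Submodule ℂ (MvPolynomial σ ℂ)}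
    {f : MvPolynomial σ ℂ} (hf : f ∈ W) {γ : Γ} (h : WeightGE w γ f) :
    weightedHomogeneousComponent w γ f ∈ initSpan w W := by
  by_cases hne : weightedHomogeneousComponent w γ f = 0
  · rw [hne]; exact zero_mem _
  · rw [← wForm_eq_component h hne]
    exact wForm_mem_initSpan w hf

theorem component_mem_initSpan {w : σ → Γ} {W : Submodule ℂ (MvPolynomial σ ℂ)}
    {x : MvPolynomial σ ℂ} (hx : x ∈ initSpan w W) (γ : Γ) :
    weightedHomogeneousComponent w γ x ∈ initSpan w W := by
  obtain ⟨f, hf, h1, h2⟩ := exists_component_eq hx γ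
  rw [← h2]
  exact component_mem_initSpan_of_weightGE hf h1

theorem component_X_mul (w : σ → Γ) (γ : Γ) (i : σ) (f : MvPolynomial σ ℂ) :
    weightedHomogeneousComponent w (w i + γ) (X i * f) =
      X i * weightedHomogeneousComponent w γ f := by
  classical
  ext u
  rw [coeff_weightedHomogeneousComponent, coeff_X_mul', coeff_X_mul',
    coeff_weightedHomogeneousComponent]
  by_cases hi : i ∈ u.support
  · rw [if_pos hi, if_pos hi]
    congr 1
    have h : u = Finsupp.single i 1 + (u - Finsupp.single i 1) := by
      rw [add_tsub_cancel_of_le]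
      rw [Finsupp.single_le_iff]
      exact Nat.one_le_iff_ne_zero.mpr (Finsupp.mem_support_iff.mp hi)
    conv_lhs => rw [h]
    rw [map_add, Finsupp.weight_single, one_smul, eq_iff_iff]
    exact add_right_inj _
  · rw [if_neg hi, if_neg hi, ite_self]

theorem X_mul_wForm [IsOrderedAddMonoid Γ] (w : σ → Γ) (i : σ) (f : MvPolynomial σ ℂ) :
    X i * wForm w f = wForm w (X i * f) := by
  classical
  by_cases h0 : f = 0
  · rw [h0, wForm_zero, mul_zero, wForm_zero]
  obtain ⟨γ, hγ, hne, h⟩ := exists_wForm_eq_component w h0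
  have hX : (X i : MvPolynomial σ ℂ) ≠ 0 := X_ne_zero i
  rw [h, ← component_X_mul, wForm_eq_component]
  · intro u hu
    rw [mem_support_iff, coeff_X_mul'] at hu
    split_ifs at hu with hi
    · have h : u = Finsupp.single i 1 + (u - Finsupp.single i 1) := by
        rw [add_tsub_cancel_of_le]
        rw [Finsupp.single_le_iff]
        exact Nat.one_le_iff_ne_zero.mpr (Finsupp.mem_support_iff.mp hi)
      rw [h, map_add, Finsupp.weight_single, one_smul]
      exact add_le_add_right (hγ _ (mem_support_iff.mpr hu)) _
    · exact absurd rfl hu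
  · rw [component_X_mul]
    exact mul_ne_zero hX hne

theorem mul_mem_initSpan [IsOrderedAddMonoid Γ] (w : σ → Γ) (I : Ideal (MvPolynomial σ ℂ))
    (a x : MvPolynomial σ ℂ)
    (hx : x ∈ initSpan w (I.restrictScalars ℂ)) : a * x ∈ initSpan w (I.restrictScalars ℂ) := by
  induction a using MvPolynomial.induction_on generalizing x with
  | C c => rw [← smul_eq_C_mul]; exact Submodule.smul_mem _ c hx
  | add p q hp hq => rw [add_mul]; exact add_mem (hp x hx) (hq x hx)
  | mul_X p i hp =>
    rw [mul_assoc]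
    refine hp _ ?_
    induction hx using Submodule.span_induction with
    | mem x hx =>
      obtain ⟨f, hf, rfl⟩ := hx
      rw [X_mul_wForm]
      exact wForm_mem_initSpan w (I.mul_mem_left _ hf)
    | zero => rw [mul_zero]; exact zero_mem _
    | add x y _ _ hx hy => rw [mul_add]; exact add_mem hx hy
    | smul c x _ hx => rw [mul_smul_comm]; exact Submodule.smul_mem _ c hx

/-- The initial ideal is spanned over `ℂ` by initial forms. -/
theorem mem_wInit_iff [IsOrderedAddMonoid Γ] (w : σ → Γ) (I : Ideal (MvPolynomial σ ℂ))
    (x : MvPolynomial σ ℂ) :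
    x ∈ wInit w I ↔ x ∈ initSpan w (I.restrictScalars ℂ) := by
  constructor
  · intro hx
    refine Submodule.span_induction (fun x hx => Submodule.subset_span hx) (zero_mem _)
      (fun x y _ _ hx hy => add_mem hx hy) (fun a x _ hx => ?_) hx
    exact mul_mem_initSpan w I a x hx
  · intro hx
    exact Submodule.span_le_restrictScalars ℂ (MvPolynomial σ ℂ) _ hx

theorem wForm_mem_wInit (w : σ → Γ) {I : Ideal (MvPolynomial σ ℂ)} {f : MvPolynomial σ ℂ}
    (hf : f ∈ I) : wForm w f ∈ wInit w I :=
  Ideal.subset_span ⟨f, hf, rfl⟩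

theorem component_mem_wInit [IsOrderedAddMonoid Γ] {w : σ → Γ} {I : Ideal (MvPolynomial σ ℂ)}
    {x : MvPolynomial σ ℂ}
    (hx : x ∈ wInit w I) (γ : Γ) : weightedHomogeneousComponent w γ x ∈ wInit w I := by
  rw [mem_wInit_iff] at *
  exact component_mem_initSpan hx γ

/-- The forms of degree `r` in an ideal. -/
def degPart (I : Ideal (MvPolynomial σ ℂ)) (r : ℕ) : Submodule ℂ (MvPolynomial σ ℂ) :=
  I.restrictScalars ℂ ⊓ homogeneousSubmodule σ ℂ r

/-- Closedness of an ideal under homogeneous components. -/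
def IsGradedIdeal (I : Ideal (MvPolynomial σ ℂ)) : Prop :=
  ∀ f ∈ I, ∀ r, homogeneousComponent r f ∈ I

theorem mem_degPart {I : Ideal (MvPolynomial σ ℂ)} {r : ℕ} {f : MvPolynomial σ ℂ} :
    f ∈ degPart I r ↔ f ∈ I ∧ f.IsHomogeneous r := Iff.rfl

theorem homogeneousComponent_component (w : σ → Γ) (γ : Γ) (r : ℕ) (f : MvPolynomial σ ℂ) :
    homogeneousComponent r (weightedHomogeneousComponent w γ f) =
      weightedHomogeneousComponent w γ (homogeneousComponent r f) := by
  classical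
  ext u
  simp only [coeff_homogeneousComponent, coeff_weightedHomogeneousComponent]
  split_ifs <;> rfl

theorem WeightGE.homogeneousComponent {w : σ → Γ} {γ : Γ} {f : MvPolynomial σ ℂ}
    (hf : WeightGE w γ f) (r : ℕ) : WeightGE w γ (homogeneousComponent r f) := by
  intro u hu
  refine hf u ?_
  rw [mem_support_iff, coeff_homogeneousComponent] at hu
  rw [mem_support_iff]
  intro h
  rw [h, ite_self] at hu
  exact hu rfl

theorem homogeneousComponent_mem_initSpan [IsOrderedAddMonoid Γ] (w : σ → Γ)
    {I : Ideal (MvPolynomial σ ℂ)} (hI : IsGradedIdeal I) {x : MvPolynomial σ ℂ}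
    (hx : x ∈ wInit w I) (r : ℕ) :
    homogeneousComponent r x ∈ initSpan w (degPart I r) := by
  rw [mem_wInit_iff] at hx
  induction hx using Submodule.span_induction with
  | mem x hx =>
    obtain ⟨f, hf, rfl⟩ := hx
    by_cases h0 : f = 0
    · rw [h0, wForm_zero, map_zero]; exact zero_mem _
    obtain ⟨γ, hγ, -, h⟩ := exists_wForm_eq_component w h0
    rw [h, homogeneousComponent_component]
    exact component_mem_initSpan_of_weightGE
      (mem_degPart.mpr ⟨hI f hf r, homogeneousComponent_isHomogeneous r f⟩)
      (hγ.homogeneousComponent r)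
  | zero => rw [map_zero]; exact zero_mem _
  | add x y _ _ hx hy => rw [map_add]; exact add_mem hx hy
  | smul c x _ hx => rw [map_smul]; exact Submodule.smul_mem _ c hx

theorem initSpan_degPart_le (w : σ → Γ) (I : Ideal (MvPolynomial σ ℂ)) (r : ℕ) :
    initSpan w (degPart I r) ≤ degPart (wInit w I) r := by
  refine Submodule.span_le.mpr ?_
  rintro _ ⟨f, hf, rfl⟩
  refine ⟨wForm_mem_wInit w hf.1, ?_⟩
  intro u hu
  rw [coeff_initForm] at hu
  refine hf.2 (d := u) ?_
  rintro h
  rw [h, ite_self] at hu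
  exact hu rfl

theorem isGradedIdeal_wInit [IsOrderedAddMonoid Γ] (w : σ → Γ) {I : Ideal (MvPolynomial σ ℂ)}
    (hI : IsGradedIdeal I) :
    IsGradedIdeal (wInit w I) := fun _ hx r =>
  (initSpan_degPart_le w I r (homogeneousComponent_mem_initSpan w hI hx r)).1

/-- A form of degree `r` and weight `γ` in the initial ideal is the part of weight `γ` of a form
of degree `r` in the ideal without terms of smaller weight. -/
theorem exists_lift_of_mem_wInit [IsOrderedAddMonoid Γ] {w : σ → Γ}
    {I : Ideal (MvPolynomial σ ℂ)} (hI : IsGradedIdeal I)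
    {x : MvPolynomial σ ℂ} (hx : x ∈ wInit w I) {r : ℕ} (hr : x.IsHomogeneous r) (γ : Γ) :
    ∃ f ∈ degPart I r, WeightGE w γ f ∧
      weightedHomogeneousComponent w γ f = weightedHomogeneousComponent w γ x := by
  have := homogeneousComponent_mem_initSpan w hI hx r
  rw [homogeneousComponent_eq_self hr] at this
  exact exists_component_eq this γ

end InitialIdeals

/-! ### Standard monomials and Hilbert functions of initial ideals -/

section Complement

variable {σ : Type} {Γ : Type} [AddCommGroup Γ] [LinearOrder Γ]

/-- Every ideal has a complement spanned by monomials. -/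
theorem exists_isCompl_restrictSupport (J : Ideal (MvPolynomial σ ℂ)) :
    ∃ B : Set (σ →₀ ℕ), IsCompl (J.restrictScalars ℂ) (restrictSupport ℂ B) := by
  obtain ⟨κ, a, -, hsp, hli⟩ := exists_linearIndependent' ℂ
    (fun u : σ →₀ ℕ => (J.restrictScalars ℂ).mkQ (monomial u 1))
  refine ⟨Set.range a, ?_⟩
  have hspan : restrictSupport ℂ (Set.range a) =
      Submodule.span ℂ (Set.range fun i => (monomial (a i) (1 : ℂ) : MvPolynomial σ ℂ)) := by
    rw [restrictSupport_eq_span, ← Set.range_comp]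
    rfl
  rw [hspan]
  constructor
  · have := Submodule.range_ker_disjoint
      (f := (J.restrictScalars ℂ).mkQ) (v := fun i => (monomial (a i) (1 : ℂ))) hli
    rw [Submodule.ker_mkQ] at this
    exact this.symm
  · rw [codisjoint_iff, ← Submodule.map_mkQ_eq_top, Submodule.map_span, ← Set.range_comp]
    have h2 : Submodule.span ℂ (Set.range fun u : σ →₀ ℕ =>
        (J.restrictScalars ℂ).mkQ (monomial u (1 : ℂ))) = ⊤ := by
      have h3 := (basisMonomials σ ℂ).span_eq
      rw [coe_basisMonomials] at h3
      have := congrArg (Submodule.map (J.restrictScalars ℂ).mkQ) h3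
      rw [Submodule.map_span, ← Set.range_comp, Submodule.map_top, Submodule.range_mkQ] at this
      exact this
    rw [← h2, ← hsp]
    rfl

theorem restrictSupport_of_coeff {B : Set (σ →₀ ℕ)} {b c : MvPolynomial σ ℂ}
    (hb : b ∈ restrictSupport ℂ B) (h : ∀ u, coeff u b = 0 → coeff u c = 0) :
    c ∈ restrictSupport ℂ B := by
  rw [mem_restrictSupport_iff] at *
  intro u hu
  refine hb ?_
  simp only [Finset.mem_coe, mem_support_iff] at *
  exact fun h' => hu (h u h')

theorem component_mem_restrictSupport {B : Set (σ →₀ ℕ)} {b : MvPolynomial σ ℂ}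
    (hb : b ∈ restrictSupport ℂ B) (w : σ → Γ) (γ : Γ) :
    weightedHomogeneousComponent w γ b ∈ restrictSupport ℂ B := by
  classical
  refine restrictSupport_of_coeff hb fun u hu => ?_
  rw [coeff_weightedHomogeneousComponent, hu, ite_self]

theorem homogeneousComponent_mem_restrictSupport {B : Set (σ →₀ ℕ)} {b : MvPolynomial σ ℂ}
    (hb : b ∈ restrictSupport ℂ B) (r : ℕ) :
    homogeneousComponent r b ∈ restrictSupport ℂ B := by
  refine restrictSupport_of_coeff hb fun u hu => ?_
  rw [coeff_homogeneousComponent, hu, ite_self]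

theorem wForm_mem_restrictSupport {B : Set (σ →₀ ℕ)} {b : MvPolynomial σ ℂ}
    (hb : b ∈ restrictSupport ℂ B) (w : σ → Γ) :
    wForm w b ∈ restrictSupport ℂ B := by
  classical
  refine restrictSupport_of_coeff hb fun u hu => ?_
  rw [coeff_initForm, hu, ite_self]

/-- A monomial complement of the initial ideal meets the ideal trivially. -/
theorem disjoint_of_disjoint_wInit {w : σ → Γ} {I : Ideal (MvPolynomial σ ℂ)}
    {B : Set (σ →₀ ℕ)} (hB : Disjoint ((wInit w I).restrictScalars ℂ) (restrictSupport ℂ B)) :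
    Disjoint (I.restrictScalars ℂ) (restrictSupport ℂ B) := by
  rw [Submodule.disjoint_def] at *
  intro f hf hfB
  by_contra h0
  exact wForm_ne_zero w h0 (hB _ (wForm_mem_wInit w hf) (wForm_mem_restrictSupport hfB w))

variable [IsOrderedAddMonoid Γ] [Finite σ]

/-- Division: modulo forms of the ideal, every form is a combination of the monomials of a
complement of the initial ideal. -/
theorem exists_division {w : σ → Γ} {I : Ideal (MvPolynomial σ ℂ)} (hI : IsGradedIdeal I)
    {B : Set (σ →₀ ℕ)} (hB : Codisjoint ((wInit w I).restrictScalars ℂ) (restrictSupport ℂ B))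
    {r : ℕ} (x : MvPolynomial σ ℂ) (hx : x.IsHomogeneous r) :
    ∃ f ∈ degPart I r, ∃ b ∈ restrictSupport ℂ B, b.IsHomogeneous r ∧ x = f + b := by
  classical
  -- induction on the number of exponents of degree `r` whose weight is at least that of `x`
  induction hn : ((Finsupp.finite_of_degree_eq (σ := σ) r).toFinset.filter fun u =>
      ∃ u' ∈ x.support, Finsupp.weight w u' ≤ Finsupp.weight w u).card
      using Nat.strong_induction_on generalizing x with
  | _ n ih =>
    by_cases h0 : x = 0
    · exact ⟨0, zero_mem _, 0, zero_mem _, isHomogeneous_zero _ _ _, by rw [h0, add_zero]⟩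
    obtain ⟨γ, hγ, hne, -⟩ := exists_wForm_eq_component w h0
    obtain ⟨u₀, hu₀⟩ := MvPolynomial.ne_zero_iff.mp hne
    rw [coeff_weightedHomogeneousComponent] at hu₀
    split_ifs at hu₀ with hw₀
    swap
    · exact absurd rfl hu₀
    have htop : weightedHomogeneousComponent w γ x ∈
        (wInit w I).restrictScalars ℂ ⊔ restrictSupport ℂ B := by
      rw [codisjoint_iff.mp hB]; trivial
    obtain ⟨j, hj, b, hb, hjb⟩ := Submodule.mem_sup.mp htop
    set P : MvPolynomial σ ℂ → MvPolynomial σ ℂ := fun f =>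
      homogeneousComponent r (weightedHomogeneousComponent w γ f) with hP
    have hPx : P (weightedHomogeneousComponent w γ x) = weightedHomogeneousComponent w γ x := by
      simp only [hP]
      rw [weightedHomogeneousComponent_eq_self
        (weightedHomogeneousComponent_isWeightedHomogeneous _ _), homogeneousComponent_component,
        homogeneousComponent_eq_self hx]
    have hPj : P j ∈ wInit w I := isGradedIdeal_wInit w hI _ (component_mem_wInit hj γ) r
    have hPγ : ∀ f, weightedHomogeneousComponent w γ (P f) = P f := by
      intro f
      simp only [hP]
      rw [← homogeneousComponent_component, weightedHomogeneousComponent_eq_self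
        (weightedHomogeneousComponent_isWeightedHomogeneous _ _)]
    have hPb : P b ∈ restrictSupport ℂ B :=
      homogeneousComponent_mem_restrictSupport (component_mem_restrictSupport hb w γ) r
    obtain ⟨g, hg, hg1, hg2⟩ := exists_lift_of_mem_wInit hI hPj
      (homogeneousComponent_isHomogeneous r _) γ
    have hPsum : P j + P b = weightedHomogeneousComponent w γ x := by
      rw [← hPx, ← hjb]
      simp only [hP, map_add]
    -- subtracting `g ∈ I` and `P b ∈ span B` cancels the lowest part of `x`
    set x' := x - g - P b with hx'
    have hx'h : x'.IsHomogeneous r :=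
      (hx.sub (mem_degPart.mp hg).2).sub (homogeneousComponent_isHomogeneous r _)
    have hPbγ : WeightGE w γ (P b) := by
      intro u hu
      rw [← hPγ, mem_support_iff, coeff_weightedHomogeneousComponent] at hu
      split_ifs at hu with h
      · exact h.ge
      · exact absurd rfl hu
    have hx'γ : weightedHomogeneousComponent w γ x' = 0 := by
      rw [hx', map_sub, map_sub, hg2, hPγ, hPγ, ← hPsum]
      ring
    have hx'lt : ∀ u ∈ x'.support, γ < Finsupp.weight w u := by
      have hge : WeightGE w γ x' := by
        have : x' = x + (-1 : ℂ) • g + (-1 : ℂ) • P b := by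
          rw [hx']; simp; ring
        rw [this]
        exact (WeightGE.add hγ (hg1.smul _)).add (hPbγ.smul _)
      intro u hu
      refine lt_of_le_of_ne (hge u hu) fun h => ?_
      have := congrArg (coeff u) hx'γ
      rw [coeff_weightedHomogeneousComponent, if_pos h.symm, coeff_zero] at this
      exact mem_support_iff.mp hu this
    obtain ⟨f, hf, b', hb', hb'h, hfb⟩ := ih _ (by
      rw [← hn]
      refine Finset.card_lt_card (Finset.ssubset_iff_subset_ne.mpr ⟨?_, ?_⟩)
      · intro u hu
        rw [Finset.mem_filter] at hu ⊢
        obtain ⟨hu1, u', hu', hle⟩ := hu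
        exact ⟨hu1, u₀, mem_support_iff.mpr hu₀, hw₀.le.trans ((hx'lt u' hu').le.trans hle)⟩
      · intro heq
        have hmem : u₀ ∈ (Finsupp.finite_of_degree_eq (σ := σ) r).toFinset.filter fun u =>
            ∃ u' ∈ x.support, Finsupp.weight w u' ≤ Finsupp.weight w u := by
          rw [Finset.mem_filter]
          refine ⟨?_, u₀, mem_support_iff.mpr hu₀, le_rfl⟩
          rw [Set.Finite.mem_toFinset]
          by_contra h
          exact hu₀ (hx.coeff_eq_zero h)
        rw [← heq, Finset.mem_filter] at hmem
        obtain ⟨-, u', hu', hle⟩ := hmem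
        exact absurd (hx'lt u' hu') (not_lt.mpr (hle.trans hw₀.le))) x' hx'h rfl
    refine ⟨g + f, add_mem hg hf, P b + b', add_mem hPb hb',
      (homogeneousComponent_isHomogeneous r _).add hb'h, ?_⟩
    have : x = x' + g + P b := by rw [hx']; ring
    rw [this, hfb]
    ring

instance finiteDimensional_homogeneousSubmodule (r : ℕ) :
    FiniteDimensional ℂ (homogeneousSubmodule σ ℂ r) :=
  Module.Finite.iff_fg.mpr (homogeneousSubmodule_fg σ ℂ r)

instance finiteDimensional_degPart (I : Ideal (MvPolynomial σ ℂ)) (r : ℕ) :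
    FiniteDimensional ℂ (degPart I r) :=
  Submodule.finiteDimensional_of_le (inf_le_right : degPart I r ≤ homogeneousSubmodule σ ℂ r)

omit [IsOrderedAddMonoid Γ] in
theorem finrank_degPart_add {I : Ideal (MvPolynomial σ ℂ)} {B : Set (σ →₀ ℕ)} {r : ℕ}
    (hd : Disjoint (I.restrictScalars ℂ) (restrictSupport ℂ B))
    (hs : ∀ x : MvPolynomial σ ℂ, x.IsHomogeneous r →
      ∃ f ∈ degPart I r, ∃ b ∈ restrictSupport ℂ B, b.IsHomogeneous r ∧ x = f + b) :
    Module.finrank ℂ (degPart I r) +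
      Module.finrank ℂ ↥(restrictSupport ℂ B ⊓ homogeneousSubmodule σ ℂ r) =
      Module.finrank ℂ (homogeneousSubmodule σ ℂ r) := by
  have : FiniteDimensional ℂ ↥(restrictSupport ℂ B ⊓ homogeneousSubmodule σ ℂ r) :=
    Submodule.finiteDimensional_of_le inf_le_right
  have h := Submodule.finrank_sup_add_finrank_inf_eq (degPart I r)
    (restrictSupport ℂ B ⊓ homogeneousSubmodule σ ℂ r)
  have h1 : degPart I r ⊔ (restrictSupport ℂ B ⊓ homogeneousSubmodule σ ℂ r) =
      homogeneousSubmodule σ ℂ r := by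
    refine le_antisymm (sup_le inf_le_right inf_le_right) fun x hx => ?_
    obtain ⟨f, hf, b, hb, hbh, rfl⟩ := hs x hx
    exact Submodule.add_mem_sup hf ⟨hb, hbh⟩
  have h2 : degPart I r ⊓ (restrictSupport ℂ B ⊓ homogeneousSubmodule σ ℂ r) = ⊥ :=
    (hd.mono inf_le_left inf_le_left).eq_bot
  rw [h1, h2, finrank_bot, add_zero] at h
  exact h.symm

omit [Finite σ] in
theorem exists_graded_decomposition {J : Ideal (MvPolynomial σ ℂ)} (hJ : IsGradedIdeal J)
    {B : Set (σ →₀ ℕ)} (hB : Codisjoint (J.restrictScalars ℂ) (restrictSupport ℂ B))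
    {r : ℕ} (x : MvPolynomial σ ℂ) (hx : x.IsHomogeneous r) :
    ∃ f ∈ degPart J r, ∃ b ∈ restrictSupport ℂ B, b.IsHomogeneous r ∧ x = f + b := by
  have htop : x ∈ J.restrictScalars ℂ ⊔ restrictSupport ℂ B := by
    rw [codisjoint_iff.mp hB]; trivial
  obtain ⟨j, hj, b, hb, hjb⟩ := Submodule.mem_sup.mp htop
  refine ⟨homogeneousComponent r j, mem_degPart.mpr ⟨hJ j hj r,
    homogeneousComponent_isHomogeneous r j⟩, homogeneousComponent r b,
    homogeneousComponent_mem_restrictSupport hb r, homogeneousComponent_isHomogeneous r b, ?_⟩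
  rw [← map_add, hjb, homogeneousComponent_eq_self hx]

/-- A graded ideal and its initial ideal have the same Hilbert function. -/
theorem finrank_degPart_wInit (w : σ → Γ) {I : Ideal (MvPolynomial σ ℂ)} (hI : IsGradedIdeal I)
    (r : ℕ) : Module.finrank ℂ (degPart (wInit w I) r) = Module.finrank ℂ (degPart I r) := by
  obtain ⟨B, hB⟩ := exists_isCompl_restrictSupport (wInit w I)
  have h1 := finrank_degPart_add (r := r) hB.disjoint
    fun x hx => exists_graded_decomposition (isGradedIdeal_wInit w hI) hB.codisjoint x hx
  have h2 := finrank_degPart_add (r := r) (disjoint_of_disjoint_wInit hB.disjoint)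
    fun x hx => exists_division hI hB.codisjoint x hx
  omega

/-- Initial ideals of a graded ideal do not contain each other properly. -/
theorem wInit_eq_of_le {Γ' : Type} [AddCommGroup Γ'] [LinearOrder Γ'] [IsOrderedAddMonoid Γ']
    {w : σ → Γ} {w' : σ → Γ'} {I : Ideal (MvPolynomial σ ℂ)} (hI : IsGradedIdeal I)
    (h : wInit w I ≤ wInit w' I) : wInit w I = wInit w' I := by
  refine le_antisymm h fun x hx => ?_
  rw [← sum_homogeneousComponent x]
  refine sum_mem fun r _ => ?_
  have hle : degPart (wInit w I) r ≤ degPart (wInit w' I) r := fun y hy => ⟨h hy.1, hy.2⟩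
  have heq := Submodule.eq_of_le_of_finrank_eq hle
    ((finrank_degPart_wInit w hI r).trans (finrank_degPart_wInit w' hI r).symm)
  have hmem : homogeneousComponent r x ∈ degPart (wInit w' I) r :=
    ⟨isGradedIdeal_wInit w' hI x hx r, homogeneousComponent_isHomogeneous r x⟩
  rw [← heq] at hmem
  exact hmem.1

end Complement

/-! ### Gröbner cones -/

section Cones

variable {σ : Type}

theorem wForm_congr_iff {Γ Γ' : Type} [AddCommGroup Γ] [LinearOrder Γ] [AddCommGroup Γ']
    [LinearOrder Γ'] {v : σ → Γ} {w : σ → Γ'} {f : MvPolynomial σ ℂ} :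
    wForm v f = wForm w f ↔ ∀ u ∈ f.support,
      ((∀ u' ∈ f.support, Finsupp.weight v u ≤ Finsupp.weight v u') ↔
        ∀ u' ∈ f.support, Finsupp.weight w u ≤ Finsupp.weight w u') := by
  classical
  rw [MvPolynomial.ext_iff]
  refine forall_congr' fun u => ?_
  rw [coeff_initForm, coeff_initForm]
  by_cases hu : u ∈ f.support
  · have hu' := mem_support_iff.mp hu
    simp only [hu, true_imp_iff]
    split_ifs with h1 h2 h2
    · exact iff_of_true rfl (iff_of_true h1 h2)
    · exact iff_of_false hu' fun h => h2 (h.mp h1)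
    · exact iff_of_false hu'.symm fun h => h1 (h.mpr h2)
    · exact iff_of_true rfl (iff_of_false h1 h2)
  · have hu' := notMem_support_iff.mp hu
    simp only [hu, hu', ite_self, false_imp_iff]

/-- An ideal that is homogeneous for each weight vector of a family is generated by elements that
are homogeneous for all of them at once. -/
theorem span_multihomogeneous (N : Set (σ → ℝ)) (J : Ideal (MvPolynomial σ ℂ))
    (hJ : ∀ v ∈ N, ∀ x ∈ J, ∀ γ, weightedHomogeneousComponent v γ x ∈ J) :
    Ideal.span {h | h ∈ J ∧ ∀ v ∈ N, ∃ γ, IsWeightedHomogeneous v h γ} = J := by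
  classical
  refine le_antisymm (Ideal.span_le.mpr fun h hh => hh.1) fun x hx => ?_
  induction hn : x.support.card using Nat.strong_induction_on generalizing x with
  | _ n ih =>
    by_cases hall : ∀ v ∈ N, ∃ γ, IsWeightedHomogeneous v x γ
    · exact Ideal.subset_span ⟨hx, hall⟩
    push Not at hall
    obtain ⟨v, hv, hnot⟩ := hall
    rw [← sum_weightedHomogeneousComponent v x]
    refine finsum_induction (fun y => y ∈ Ideal.span _) (zero_mem _)
      (fun _ _ h1 h2 => add_mem h1 h2) fun γ => ?_
    refine ih _ ?_ _ (hJ v hv x hx γ) rfl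
    rw [← hn, support_weightedHomogeneousComponent]
    refine Finset.card_lt_card (Finset.filter_ssubset.mpr ?_)
    by_contra hcon
    push Not at hcon
    exact hnot γ fun u hu => hcon u (mem_support_iff.mpr hu)

theorem weight_one_real (u : σ →₀ ℕ) : Finsupp.weight (1 : σ → ℝ) u = (u.degree : ℝ) := by
  rw [Finsupp.weight_apply, Finsupp.degree_apply, Finsupp.sum]
  simp

theorem component_one_mem {J : Ideal (MvPolynomial σ ℂ)} (hJ : IsGradedIdeal J)
    {x : MvPolynomial σ ℂ} (hx : x ∈ J) (γ : ℝ) :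
    weightedHomogeneousComponent (1 : σ → ℝ) γ x ∈ J := by
  classical
  by_cases h : ∃ r : ℕ, γ = r
  · obtain ⟨r, rfl⟩ := h
    convert hJ x hx r using 1
    ext u
    rw [coeff_weightedHomogeneousComponent, coeff_homogeneousComponent, weight_one_real]
    simp only [Nat.cast_inj]
  · rw [weightedHomogeneousComponent_eq_zero']
    · exact zero_mem _
    · intro u _ hu
      rw [weight_one_real] at hu
      exact h ⟨_, hu.symm⟩

variable [Finite σ]

/-- A form `h` of the initial ideal that is homogeneous for all weight vectors with this initial
ideal is the initial form of one element of the ideal for all these weight vectors: reduce `h`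
modulo the ideal to a combination of monomials outside the initial ideal. -/
theorem exists_common_lift {w : σ → ℝ} {I : Ideal (MvPolynomial σ ℂ)} (hI : IsGradedIdeal I)
    {h : MvPolynomial σ ℂ} (hh : h ∈ wInit w I) {r : ℕ} (hr : h.IsHomogeneous r)
    (hv : ∀ v : σ → ℝ, wInit v I = wInit w I → ∃ γ, IsWeightedHomogeneous v h γ) :
    ∃ f ∈ I, ∀ v : σ → ℝ, wInit v I = wInit w I → wForm v f = h := by
  by_cases h0 : h = 0
  · exact ⟨0, zero_mem _, fun v _ => by rw [h0, wForm_zero]⟩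
  obtain ⟨B, hB⟩ := exists_isCompl_restrictSupport (wInit w I)
  obtain ⟨f, hf, b, hb, -, hfb⟩ := exists_division hI hB.codisjoint h hr
  have hdis := Submodule.disjoint_def.mp hB.disjoint
  refine ⟨f, hf.1, fun v hvw => ?_⟩
  obtain ⟨γ, hγ⟩ := hv v hvw
  have hfJ : wForm v f ∈ wInit w I := hvw ▸ wForm_mem_wInit v hf.1
  have hf' : f = h + (-1 : ℂ) • b := by rw [hfb]; simp
  have hhγ : WeightGE v γ h := fun u hu => (hγ (mem_support_iff.mp hu)).ge
  by_cases hb0 : b = 0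
  · have hfh : f = h := by rw [hfb, hb0, add_zero]
    have h1 : weightedHomogeneousComponent v γ f = f := by
      rw [hfh]; exact hγ.weightedHomogeneousComponent_same
    rw [wForm_eq_component (γ := γ) (hfh ▸ hhγ) (by rw [h1, hfh]; exact h0), h1, hfh]
  obtain ⟨γ', hγ', hne, -⟩ := exists_wForm_eq_component v hb0
  have hbB : ∀ δ, weightedHomogeneousComponent v δ b ∈ restrictSupport ℂ B :=
    component_mem_restrictSupport hb v
  -- Here `γ` and `γ'` are the weights of `h` and of the lowest part of `b`. The initial form of
  -- `f = h - b` lies in the initial ideal, while parts of `b` lie in the complement of that ideal,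
  -- so no part of `b` can occur in this initial form.
  rcases lt_trichotomy γ' γ with hlt | heq | hgt
  · exfalso
    have h1 : WeightGE v γ' f := by
      rw [hf']
      exact WeightGE.add (fun u hu => hlt.le.trans (hhγ u hu)) (hγ'.smul _)
    have h2 : weightedHomogeneousComponent v γ' f =
        (-1 : ℂ) • weightedHomogeneousComponent v γ' b := by
      rw [hf', map_add, hγ.weightedHomogeneousComponent_ne γ' hlt.ne, zero_add, map_smul]
    have h3 : weightedHomogeneousComponent v γ' f ≠ 0 := by
      rw [h2]; exact smul_ne_zero (by norm_num) hne
    rw [wForm_eq_component h1 h3] at hfJ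
    exact h3 (hdis _ hfJ (h2 ▸ Submodule.smul_mem _ _ (hbB γ')))
  · exfalso
    subst heq
    have h1 : WeightGE v γ' f := by
      rw [hf']
      exact WeightGE.add hhγ (hγ'.smul _)
    have h2 : weightedHomogeneousComponent v γ' f =
        h + (-1 : ℂ) • weightedHomogeneousComponent v γ' b := by
      rw [hf', map_add, hγ.weightedHomogeneousComponent_same, map_smul]
    refine hne (hdis _ ?_ (hbB γ'))
    by_cases h3 : weightedHomogeneousComponent v γ' f = 0
    · rw [h3] at h2
      have : weightedHomogeneousComponent v γ' b = h := by
        rw [eq_comm, neg_one_smul, add_neg_eq_zero] at h2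
        exact h2.symm
      rw [this]
      exact hh
    · rw [wForm_eq_component h1 h3, h2] at hfJ
      have := (wInit w I).sub_mem hh hfJ
      simpa using this
  · have h1 : WeightGE v γ f := by
      rw [hf']
      exact WeightGE.add hhγ (WeightGE.smul _ fun u hu => hgt.le.trans (hγ' u hu))
    have h2 : weightedHomogeneousComponent v γ f = h := by
      rw [hf', map_add, hγ.weightedHomogeneousComponent_same, map_smul,
        weightedHomogeneousComponent_eq_zero' γ b fun u hu => (hgt.trans_le (hγ' u hu)).ne',
        smul_zero, add_zero]
    rw [wForm_eq_component h1 (by rw [h2]; exact h0), h2]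

/-- The weight vectors with a given initial ideal are cut out by the condition that finitely many
elements of the ideal have given initial forms. -/
theorem exists_finset_wForm (w : σ → ℝ) {I : Ideal (MvPolynomial σ ℂ)} (hI : IsGradedIdeal I) :
    ∃ G : Finset (MvPolynomial σ ℂ), ∀ v : σ → ℝ,
      wInit v I = wInit w I ↔ ∀ g ∈ G, wForm v g = wForm w g := by
  classical
  -- the vector `1` is included in order that the generators are forms in the usual sense
  set N : Set (σ → ℝ) := insert 1 {v | wInit v I = wInit w I}
  have hgr := isGradedIdeal_wInit w hI
  have hspan := span_multihomogeneous N (wInit w I) (by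
    rintro v (rfl | hv) x hx γ
    · exact component_one_mem hgr hx γ
    · rw [← show wInit v I = wInit w I from hv] at hx ⊢
      exact component_mem_wInit hx γ)
  have hfg := IsNoetherian.noetherian (wInit w I)
  rw [← hspan] at hfg
  obtain ⟨T, hT, hT2⟩ := Submodule.fg_span_iff_fg_span_finset_subset _ |>.mp hfg
  have key : ∀ h ∈ T, ∃ f ∈ I, ∀ v : σ → ℝ, wInit v I = wInit w I → wForm v f = h := by
    intro h hh
    obtain ⟨hJ, hN⟩ := hT hh
    obtain ⟨ρ, hρ⟩ := hN 1 (Set.mem_insert _ _)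
    have hr : ∃ r : ℕ, h.IsHomogeneous r := by
      by_cases h0 : h = 0
      · exact ⟨0, h0 ▸ isHomogeneous_zero _ _ _⟩
      obtain ⟨u₀, hu₀⟩ := MvPolynomial.ne_zero_iff.mp h0
      refine ⟨u₀.degree, fun u hu => ?_⟩
      have h1 := (hρ hu).trans (hρ hu₀).symm
      rw [weight_one_real, weight_one_real, Nat.cast_inj] at h1
      rw [← h1, Finsupp.degree_eq_weight_one]
      rfl
    obtain ⟨r, hr⟩ := hr
    exact exists_common_lift hI hJ hr fun v hv => hN v (Set.mem_insert_of_mem _ hv)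
  choose! F hF hF2 using key
  refine ⟨T.image F, fun v => ⟨fun hv g hg => ?_, fun hv => ?_⟩⟩
  · obtain ⟨h, hh, rfl⟩ := Finset.mem_image.mp hg
    rw [hF2 h hh v hv, hF2 h hh w rfl]
  · refine (wInit_eq_of_le hI ?_).symm
    rw [← hspan]
    change Submodule.span _ _ ≤ _
    rw [hT2, Submodule.span_le]
    intro h hh
    rw [← hF2 h hh w rfl, ← hv _ (Finset.mem_image_of_mem F hh)]
    exact wForm_mem_wInit v (hF h hh)

omit [Finite σ] in
theorem weight_combination (a b : ℝ) (v z : σ → ℝ) (u : σ →₀ ℕ) :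
    Finsupp.weight (a • v + b • z) u = a * Finsupp.weight v u + b * Finsupp.weight z u := by
  simp only [Finsupp.weight_apply, Finsupp.sum, Finset.mul_sum, ← Finset.sum_add_distrib]
  refine Finset.sum_congr rfl fun i _ => ?_
  simp only [Pi.add_apply, Pi.smul_apply, smul_eq_mul, nsmul_eq_mul]
  ring

omit [Finite σ] in
/-- Moving a weight vector `v` with the same initial form as `w` towards a vector `z` for which the
`w`-minimal exponents are still minimal, possibly along with others, keeps the initial form. -/
theorem wForm_combination {w v z : σ → ℝ} {g : MvPolynomial σ ℂ} (hv : wForm v g = wForm w g)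
    (hz : ∀ u ∈ g.support, (∀ u' ∈ g.support, Finsupp.weight w u ≤ Finsupp.weight w u') →
      ∀ u' ∈ g.support, Finsupp.weight z u ≤ Finsupp.weight z u')
    {a b : ℝ} (ha : 0 < a) (hb : 0 ≤ b) : wForm (a • v + b • z) g = wForm w g := by
  rw [wForm_congr_iff] at *
  intro u hu
  constructor
  · intro hmin
    by_contra hcon
    rw [← hv u hu] at hcon
    push Not at hcon
    obtain ⟨u₁, hu₁, hlt⟩ := hcon
    obtain ⟨u₀, hu₀, h₀⟩ := Finset.exists_min_image g.support (fun u => Finsupp.weight w u) ⟨u, hu⟩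
    have h1 := (hv u₀ hu₀).mpr h₀ u₁ hu₁
    have h2 := hz u₀ hu₀ h₀ u hu
    have h3 := hmin u₀ hu₀
    rw [weight_combination, weight_combination] at h3
    have h4 := mul_lt_mul_of_pos_left (h1.trans_lt hlt) ha
    have h5 := mul_le_mul_of_nonneg_left h2 hb
    linarith
  · intro hmin u' hu'
    rw [weight_combination, weight_combination]
    exact add_le_add (mul_le_mul_of_nonneg_left ((hv u hu).mpr hmin u' hu') ha.le)
      (mul_le_mul_of_nonneg_left (hz u hu hmin u' hu') hb)

/-- The weight vectors with a given initial ideal form a convex set. -/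
theorem convex_wInit_eq (w : σ → ℝ) {I : Ideal (MvPolynomial σ ℂ)} (hI : IsGradedIdeal I) :
    Convex ℝ {v : σ → ℝ | wInit v I = wInit w I} := by
  obtain ⟨G, hG⟩ := exists_finset_wForm w hI
  rw [convex_iff_forall_pos]
  intro v hv z hz a b ha hb _
  rw [Set.mem_ofPred_eq, hG] at *
  intro g hg
  refine wForm_combination (hv g hg) (fun u hu hmin => ?_) ha hb.le
  exact (wForm_congr_iff.mp (hz g hg) u hu).mpr hmin

omit [Finite σ] in
theorem continuous_weight (u : σ →₀ ℕ) : Continuous fun z : σ → ℝ => Finsupp.weight z u := by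
  simp only [Finsupp.weight_apply, Finsupp.sum]
  fun_prop

omit [Finite σ] in
/-- The relative interior of the closure of a Gröbner class is contained in the class. -/
theorem wInit_eq_of_mem_intrinsicInterior [Fintype σ] {w v : σ → ℝ} {I : Ideal (MvPolynomial σ ℂ)}
    (hI : IsGradedIdeal I)
    (hv : v ∈ intrinsicInterior ℝ (closure {v : σ → ℝ | wInit v I = wInit w I})) :
    wInit v I = wInit w I := by
  obtain ⟨G, hG⟩ := exists_finset_wForm w hI
  set D := {v : σ → ℝ | wInit v I = wInit w I} with hD
  have hwD : w ∈ closure D := subset_closure rfl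
  have hcl : closure D ⊆ {z | ∀ g ∈ G, ∀ u ∈ g.support,
      (∀ u' ∈ g.support, Finsupp.weight w u ≤ Finsupp.weight w u') →
      ∀ u' ∈ g.support, Finsupp.weight z u ≤ Finsupp.weight z u'} := by
    refine closure_minimal ?_ ?_
    · intro z hz g hg u hu hmin
      exact (wForm_congr_iff.mp ((hG z).mp hz g hg) u hu).mpr hmin
    · simp only [Set.ofPred_forall]
      refine isClosed_iInter fun g => isClosed_iInter fun _ => isClosed_iInter fun u =>
        isClosed_iInter fun _ => isClosed_iInter fun _ => isClosed_iInter fun u' =>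
        isClosed_iInter fun _ => ?_
      exact isClosed_le (continuous_weight u) (continuous_weight u')
  -- extend the segment from `w` to `v` slightly beyond `v` inside the closure
  obtain ⟨y, hy, rfl⟩ := mem_intrinsicInterior.mp hv
  set γ : ℝ → affineSpan ℝ (closure D) := fun t =>
    ⟨AffineMap.lineMap w (y : σ → ℝ) t,
      AffineMap.lineMap_mem t (subset_affineSpan ℝ _ hwD) y.2⟩ with hγ
  have hcont : Continuous γ := by
    refine Continuous.subtype_mk ?_ _
    exact AffineMap.lineMap_continuous
  have hγ1 : γ 1 = y := Subtype.ext (AffineMap.lineMap_apply_one _ _)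
  have hnhds : γ ⁻¹' ((↑) ⁻¹' closure D) ∈ nhds (1 : ℝ) := by
    refine hcont.continuousAt.preimage_mem_nhds ?_
    rw [hγ1]
    exact mem_interior_iff_mem_nhds.mp hy
  obtain ⟨ε, hε, hball⟩ := Metric.mem_nhds_iff.mp hnhds
  have hz : γ (1 + ε / 2) ∈ ((↑) ⁻¹' closure D : Set (affineSpan ℝ (closure D))) := by
    refine hball ?_
    rw [Metric.mem_ball, Real.dist_eq, add_sub_cancel_left, abs_of_pos (by positivity)]
    linarith
  set t := 1 + ε / 2 with ht
  have ht1 : 1 < t := by rw [ht]; linarith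
  have ht0 : t ≠ 0 := by linarith
  rw [hG]
  intro g hg
  have := wForm_combination (w := w) (v := w) (z := (γ t : σ → ℝ)) (g := g) rfl
    (fun u hu hmin => hcl hz g hg u hu hmin) (a := 1 - 1 / t) (b := 1 / t)
    (by rw [sub_pos, div_lt_one (by linarith)]; exact ht1) (by positivity)
  rw [← this]
  congr 2
  ext i
  simp only [hγ, AffineMap.lineMap_apply, Pi.add_apply, Pi.smul_apply, smul_eq_mul, vsub_eq_sub,
    vadd_eq_add, Pi.sub_apply]
  field_simp
  ring

end Cones

/-! ### Tropical varieties -/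

section Trop

variable {σ : Type}

/-- The inclusion of the exponents of polynomials into those of Laurent polynomials. -/
def castExp : (σ →₀ ℕ) →+ (σ →₀ ℤ) := Finsupp.mapRange.addMonoidHom (Nat.castAddMonoidHom ℤ)

theorem castExp_apply (u : σ →₀ ℕ) (j : σ) : castExp u j = (u j : ℤ) := rfl

theorem castExp_injective : Function.Injective (castExp (σ := σ)) := by
  intro u u' h
  ext j
  have := DFunLike.congr_fun h j
  rw [castExp_apply, castExp_apply] at this
  exact_mod_cast this

/-- The inclusion of polynomials into Laurent polynomials. -/
def toLaurent : MvPolynomial σ ℂ →ₐ[ℂ] AddMonoidAlgebra ℂ (σ →₀ ℤ) :=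
  aeval fun j : σ => AddMonoidAlgebra.single (Finsupp.single j (1 : ℤ)) (1 : ℂ)

theorem toLaurent_monomial (u : σ →₀ ℕ) (c : ℂ) :
    toLaurent (monomial u c) = AddMonoidAlgebra.single (castExp u) c := by
  induction u using Finsupp.induction generalizing c with
  | zero =>
    rw [map_zero, ← C_apply, ← algebraMap_eq, AlgHom.commutes]
    rfl
  | single_add a b f _ _ ih =>
    have h : (monomial (Finsupp.single a b + f) c : MvPolynomial σ ℂ) =
        X a ^ b * monomial f c := by
      rw [X_pow_eq_monomial, monomial_mul, one_mul]
    rw [h, map_mul, ih, map_pow, toLaurent, aeval_X, AddMonoidAlgebra.single_pow,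
      AddMonoidAlgebra.single_mul_single, one_pow, one_mul, map_add]
    congr 2
    ext j
    classical
    rw [castExp_apply, Finsupp.smul_apply, Finsupp.single_apply, Finsupp.single_apply]
    split_ifs <;> simp

theorem coeff_toLaurent (F : MvPolynomial σ ℂ) (u : σ →₀ ℕ) :
    (toLaurent F).coeff (castExp u) = coeff u F := by
  classical
  induction F using MvPolynomial.induction_on' with
  | monomial u' c =>
    rw [toLaurent_monomial, coeff_monomial, AddMonoidAlgebra.coeff_single, Finsupp.single_apply]
    simp only [castExp_injective.eq_iff]
  | add p q hp hq => rw [map_add, AddMonoidAlgebra.coeff_add, Finsupp.add_apply, hp, hq, coeff_add]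

theorem exists_of_coeff_toLaurent_ne_zero {F : MvPolynomial σ ℂ} {m : σ →₀ ℤ}
    (h : (toLaurent F).coeff m ≠ 0) : ∃ u ∈ F.support, castExp u = m := by
  classical
  by_contra hcon
  push Not at hcon
  apply h
  rw [F.as_sum, map_sum, AddMonoidAlgebra.coeff_sum, Finsupp.finsetSum_apply]
  refine Finset.sum_eq_zero fun u hu => ?_
  rw [toLaurent_monomial, AddMonoidAlgebra.coeff_single, Finsupp.single_apply, if_neg (hcon u hu)]

/-- Every Laurent polynomial is a polynomial up to a monomial factor. -/
theorem exists_toLaurent_eq (r : AddMonoidAlgebra ℂ (σ →₀ ℤ)) :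
    ∃ (a : σ →₀ ℕ) (R : MvPolynomial σ ℂ), toLaurent R = toLaurent (monomial a 1) * r := by
  induction r using AddMonoidAlgebra.induction_linear with
  | zero => exact ⟨0, 0, by rw [map_zero, mul_zero]⟩
  | add f g hf hg =>
    obtain ⟨a, R, hR⟩ := hf
    obtain ⟨b, T, hT⟩ := hg
    refine ⟨a + b, monomial b 1 * R + monomial a 1 * T, ?_⟩
    have : (monomial (a + b) 1 : MvPolynomial σ ℂ) = monomial a 1 * monomial b 1 := by
      rw [monomial_mul, one_mul]
    rw [this, map_add, map_mul, map_mul, map_mul, hR, hT]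
    ring
  | single m c =>
    refine ⟨m.mapRange (fun z => (-z).toNat) (by simp),
      monomial (m.mapRange Int.toNat (by simp)) c, ?_⟩
    rw [toLaurent_monomial, toLaurent_monomial, AddMonoidAlgebra.single_mul_single, one_mul]
    congr 1
    ext j
    rw [castExp_apply, Finsupp.add_apply, castExp_apply, Finsupp.mapRange_apply,
      Finsupp.mapRange_apply]
    have := Int.toNat_sub_toNat_neg (m j)
    omega

/-- Clearing denominators: every element of the extended ideal is, up to a monomial factor, an
element of the ideal. -/
theorem exists_mem_of_mem_laurentExt {I : Ideal (MvPolynomial σ ℂ)}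
    {f : AddMonoidAlgebra ℂ (σ →₀ ℤ)} (hf : f ∈ laurentExt I) :
    ∃ (a : σ →₀ ℕ), ∃ F ∈ I, toLaurent F = toLaurent (monomial a 1) * f := by
  have hf' : f ∈ Ideal.span (toLaurent '' (I : Set (MvPolynomial σ ℂ))) := hf
  clear hf
  induction hf' using Submodule.span_induction with
  | mem x hx =>
    obtain ⟨F, hF, rfl⟩ := hx
    exact ⟨0, F, hF, by rw [← C_apply, C_1, map_one, one_mul]⟩
  | zero => exact ⟨0, 0, zero_mem _, by rw [map_zero, mul_zero]⟩
  | add f g _ _ ihf ihg =>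
    obtain ⟨a, R, hRI, hR⟩ := ihf
    obtain ⟨b, T, hTI, hT⟩ := ihg
    refine ⟨a + b, monomial b 1 * R + monomial a 1 * T,
      add_mem (I.mul_mem_left _ hRI) (I.mul_mem_left _ hTI), ?_⟩
    have : (monomial (a + b) 1 : MvPolynomial σ ℂ) = monomial a 1 * monomial b 1 := by
      rw [monomial_mul, one_mul]
    rw [this, map_add, map_mul, map_mul, map_mul, hR, hT]
    ring
  | smul r f _ ihf =>
    obtain ⟨a, F, hFI, hF⟩ := ihf
    obtain ⟨b, R, hR⟩ := exists_toLaurent_eq r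
    refine ⟨b + a, R * F, I.mul_mem_left _ hFI, ?_⟩
    have : (monomial (b + a) 1 : MvPolynomial σ ℂ) = monomial b 1 * monomial a 1 := by
      rw [monomial_mul, one_mul]
    rw [this, map_mul, map_mul, hR, hF, smul_eq_mul]
    ring

theorem coeff_monomial_mul_laurent (a : σ →₀ ℕ) (f : AddMonoidAlgebra ℂ (σ →₀ ℤ)) (m : σ →₀ ℤ) :
    (toLaurent (monomial a 1) * f).coeff (castExp a + m) = f.coeff m := by
  rw [toLaurent_monomial, AddMonoidAlgebra.coeff_single_mul_eq_mul_coeff m, one_mul]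
  intro b _
  exact add_right_inj _

variable [Fintype σ]

theorem sum_eq_weight (w : σ → ℝ) (u : σ →₀ ℕ) :
    ∑ j, w j * (u j : ℝ) = Finsupp.weight w u := by
  rw [Finsupp.weight_apply, Finsupp.sum_fintype]
  · simp [mul_comm]
  · simp

theorem initIdealVec_eq_wInit (w : σ → ℝ) (I : Ideal (MvPolynomial σ ℂ)) :
    initIdealVec w I = wInit w I := by
  unfold initIdealVec
  simp only [sum_eq_weight]

/-- If the initial ideal contains no monomial, then the weight vector lies in the tropical
variety. -/
theorem mem_trop_of_monomial_notMem {w : σ → ℝ} {I : Ideal (MvPolynomial σ ℂ)}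
    (h : ∀ u, monomial u (1 : ℂ) ∉ wInit w I) : w ∈ trop I := by
  classical
  refine Set.mem_iInter₂.mpr fun f hf hf0 => ?_
  obtain ⟨a, F, hFI, hF⟩ := exists_mem_of_mem_laurentExt hf
  have hF0 : F ≠ 0 := by
    rintro rfl
    obtain ⟨m, hm⟩ : ∃ m, f.coeff m ≠ 0 := by
      by_contra hcon
      push Not at hcon
      exact hf0 (AddMonoidAlgebra.ext (Finsupp.ext hcon))
    rw [← coeff_monomial_mul_laurent a f m, ← hF, map_zero] at hm
    exact hm rfl
  have hin := wForm_mem_wInit w hFI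
  obtain ⟨u, hu⟩ := MvPolynomial.ne_zero_iff.mp (wForm_ne_zero w hF0)
  obtain ⟨u', hu', hne⟩ : ∃ u', coeff u' (wForm w F) ≠ 0 ∧ u ≠ u' := by
    by_contra hcon
    push Not at hcon
    have hmon : wForm w F = monomial u (coeff u (wForm w F)) := by
      ext v
      rw [coeff_monomial]
      split_ifs with hv
      · rw [hv]
      · by_contra h0
        exact hv (hcon v h0)
    apply h u
    have := (wInit w I).mul_mem_left (C (coeff u (wForm w F))⁻¹) hin
    rw [hmon, C_mul_monomial] at this
    rw [coeff_monomial, if_pos rfl, inv_mul_cancel₀ hu] at this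
    exact this
  rw [coeff_initForm] at hu hu'
  split_ifs at hu hu' with h1 h2
  · have key : ∀ v : σ →₀ ℕ, v ∈ F.support → castExp v - castExp a ∈ f.coeff.support := by
      intro v hv
      rw [Finsupp.mem_support_iff, ← coeff_monomial_mul_laurent a f, ← hF, add_sub_cancel,
        coeff_toLaurent]
      exact mem_support_iff.mp hv
    have hsum : ∀ v : σ →₀ ℕ, ∑ j, w j * ((castExp v - castExp a : σ →₀ ℤ) j : ℝ) =
        Finsupp.weight w v - Finsupp.weight w a := by
      intro v
      rw [← sum_eq_weight, ← sum_eq_weight, ← Finset.sum_sub_distrib]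
      refine Finset.sum_congr rfl fun j _ => ?_
      rw [Finsupp.sub_apply, castExp_apply, castExp_apply]
      push_cast
      ring
    have hus := mem_support_iff.mpr hu
    have hus' := mem_support_iff.mpr hu'
    refine ⟨_, key u hus, _, key u' hus', ?_, ?_, ?_⟩
    · intro heq
      exact hne (castExp_injective (sub_left_injective heq))
    · rw [hsum, hsum, le_antisymm (h1 u' hus') (h2 u hus)]
    · intro m hm
      have hm' : (toLaurent F).coeff (castExp a + m) ≠ 0 := by
        rw [hF, coeff_monomial_mul_laurent]
        exact Finsupp.mem_support_iff.mp hm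
      obtain ⟨v, hv, hvm⟩ := exists_of_coeff_toLaurent_ne_zero hm'
      have : m = castExp v - castExp a := by rw [hvm, add_sub_cancel_left]
      rw [this, hsum, hsum]
      exact sub_le_sub_right (h1 v hv) _
  all_goals exact absurd rfl ‹_›

theorem isClosed_tropHypersurface (f : AddMonoidAlgebra ℂ (σ →₀ ℤ)) :
    IsClosed (tropHypersurface f) := by
  by_cases hf : f = 0
  · have : tropHypersurface f = Set.univ := Set.eq_univ_of_forall fun w h => absurd hf h
    rw [this]
    exact isClosed_univ
  have : tropHypersurface f = ⋃ u ∈ f.coeff.support, ⋃ u' ∈ f.coeff.support,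
      {w : σ → ℝ | u ≠ u' ∧ ∑ j, w j * (u j : ℝ) = ∑ j, w j * (u' j : ℝ) ∧
        ∀ v ∈ f.coeff.support, ∑ j, w j * (u j : ℝ) ≤ ∑ j, w j * (v j : ℝ)} := by
    ext w
    simp only [tropHypersurface, Set.mem_ofPred_eq, Set.mem_iUnion, exists_prop]
    exact ⟨fun h => h hf, fun h _ => h⟩
  rw [this]
  refine (Finset.finite_toSet _).isClosed_biUnion fun u _ =>
    (Finset.finite_toSet _).isClosed_biUnion fun u' _ => ?_
  refine isClosed_const.inter (IsClosed.inter ?_ ?_)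
  · exact isClosed_eq (by fun_prop) (by fun_prop)
  · have : {w : σ → ℝ | ∀ v ∈ f.coeff.support,
        ∑ j, w j * (u j : ℝ) ≤ ∑ j, w j * (v j : ℝ)} = ⋂ v ∈ f.coeff.support,
        {w : σ → ℝ | ∑ j, w j * (u j : ℝ) ≤ ∑ j, w j * (v j : ℝ)} := by
      ext w
      simp only [Set.mem_ofPred_eq, Set.mem_iInter]
    change IsClosed {w : σ → ℝ | ∀ v ∈ f.coeff.support,
      ∑ j, w j * (u j : ℝ) ≤ ∑ j, w j * (v j : ℝ)}
    rw [this]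
    exact isClosed_biInter fun v _ => isClosed_le (by fun_prop) (by fun_prop)

/-- The Gröbner class of a weight vector whose initial ideal contains no monomial gives a cone of
the tropical variety. -/
theorem exists_tropCone {w : σ → ℝ} {I : Ideal (MvPolynomial σ ℂ)} (hI : IsGradedIdeal I)
    (h : ∀ u, monomial u (1 : ℂ) ∉ wInit w I) :
    ∃ C : Set (σ → ℝ), IsTropCone I C ∧ C ⊆ trop I ∧ ConeInit I C (wInit w I) := by
  refine ⟨closure {v | initIdealVec v I = initIdealVec w I},
    ⟨w, mem_trop_of_monomial_notMem h, rfl⟩, ?_, ?_⟩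
  · refine closure_minimal (fun v hv => ?_) (isClosed_biInter fun f _ =>
      isClosed_tropHypersurface f)
    refine mem_trop_of_monomial_notMem fun u => ?_
    rw [← initIdealVec_eq_wInit, show initIdealVec v I = initIdealVec w I from hv,
      initIdealVec_eq_wInit]
    exact h u
  · have hset : {v : σ → ℝ | initIdealVec v I = initIdealVec w I} =
        {v | wInit v I = wInit w I} := by
      ext v
      rw [Set.mem_ofPred_eq, Set.mem_ofPred_eq, initIdealVec_eq_wInit, initIdealVec_eq_wInit]
    rw [hset]
    refine ⟨Set.Nonempty.intrinsicInterior (convex_wInit_eq w hI).closure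
      ⟨w, subset_closure (Set.mem_ofPred_eq ▸ rfl)⟩, fun v hv => ?_⟩
    rw [initIdealVec_eq_wInit]
    exact wInit_eq_of_mem_intrinsicInterior hI hv

end Trop

/-! ### Approximation of weights in `ℤ^d` by integral weights -/

section Approximation

/-- Finitely many lexicographically positive vectors are positive for one linear functional. -/
theorem exists_functional_of_lex_pos (d : ℕ) (E : Finset (Fin d → ℤ))
    (hE : ∀ a ∈ E, ∃ i, (∀ j < i, a j = 0) ∧ 0 < a i) :
    ∃ c : Fin d → ℤ, ∀ a ∈ E, 0 < ∑ t, c t * a t := by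
  classical
  induction d with
  | zero =>
    refine ⟨0, fun a ha => ?_⟩
    obtain ⟨i, -⟩ := hE a ha
    exact i.elim0
  | succ d ih =>
    obtain ⟨c, hc⟩ := ih ((E.filter fun a => a 0 = 0).image Fin.tail) (by
      intro b hb
      obtain ⟨a, ha, rfl⟩ := Finset.mem_image.mp hb
      obtain ⟨ha1, ha2⟩ := Finset.mem_filter.mp ha
      obtain ⟨i, hi1, hi2⟩ := hE a ha1
      have hi0 : i ≠ 0 := by
        rintro rfl
        omega
      refine ⟨i.pred hi0, fun j hj => hi1 _ ?_, ?_⟩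
      · rwa [← Fin.lt_pred_iff]
      · simp only [Fin.tail, Fin.succ_pred]
        exact hi2)
    -- the first entry gets a weight that beats the other entries of all vectors in `E`
    set K : ℤ := 1 + ∑ a ∈ E, |∑ t, c t * Fin.tail a t|
    refine ⟨Fin.cons K c, fun a ha => ?_⟩
    rw [Fin.sum_univ_succ]
    simp only [Fin.cons_zero, Fin.cons_succ]
    have hK : |∑ t, c t * Fin.tail a t| < K := by
      have := Finset.single_le_sum (f := fun a => |∑ t, c t * Fin.tail a t|)
        (fun a _ => abs_nonneg _) ha
      omega
    change 0 < K * a 0 + ∑ t, c t * Fin.tail a t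
    by_cases h0 : a 0 = 0
    · rw [h0, mul_zero, zero_add]
      exact hc _ (Finset.mem_image_of_mem _ (Finset.mem_filter.mpr ⟨ha, h0⟩))
    · obtain ⟨i, hi1, hi2⟩ := hE a ha
      have hi0 : i = 0 := by
        by_contra h
        exact h0 (hi1 0 (Fin.pos_iff_ne_zero.mpr h))
      subst hi0
      have h1 := abs_lt.mp hK
      nlinarith [h1.1, h1.2]

/-- Finitely many positive elements of the value group are positive for one homomorphism to
`ℤ`. -/
theorem exists_hom_pos {d : ℕ} (E : Finset (ℤ ×ₗ (Lex (Fin d → ℤ))ᵒᵈ)) (hE : ∀ γ ∈ E, 0 < γ) :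
    ∃ l : ℤ ×ₗ (Lex (Fin d → ℤ))ᵒᵈ →+ ℤ, ∀ γ ∈ E, 0 < l γ := by
  classical
  let f : ℤ ×ₗ (Lex (Fin d → ℤ))ᵒᵈ → Fin (d + 1) → ℤ := fun γ =>
    Fin.cons (ofLex γ).1 fun t => -(ofLex (OrderDual.ofDual (ofLex γ).2)) t
  have hadd : ∀ γ γ' t, f (γ + γ') t = f γ t + f γ' t := by
    intro γ γ' t
    refine Fin.cases ?_ (fun t => ?_) t
    · rfl
    · exact neg_add _ _
  obtain ⟨c, hc⟩ := exists_functional_of_lex_pos (d + 1) (E.image f) (by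
    intro a ha
    obtain ⟨γ, hγ, rfl⟩ := Finset.mem_image.mp ha
    rcases Prod.Lex.lt_iff.mp (hE γ hγ) with h | ⟨h1, h2⟩
    · exact ⟨0, fun j hj => absurd hj (Fin.not_lt_zero j), h⟩
    · obtain ⟨i, hi1, hi2⟩ : ∃ i, (∀ j < i, ofLex (OrderDual.ofDual (ofLex γ).2) j = 0) ∧
          ofLex (OrderDual.ofDual (ofLex γ).2) i < 0 := h2
      refine ⟨i.succ, fun j => ?_, neg_pos.mpr hi2⟩
      refine Fin.cases (fun _ => h1.symm) (fun j hj => ?_) j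
      · change -(ofLex (OrderDual.ofDual (ofLex γ).2)) j = 0
        rw [hi1 j (Fin.succ_lt_succ_iff.mp hj), neg_zero])
  refine ⟨AddMonoidHom.mk' (fun γ => ∑ t, c t * f γ t) fun γ γ' => ?_, fun γ hγ =>
    hc _ (Finset.mem_image_of_mem f hγ)⟩
  simp only [hadd, mul_add, Finset.sum_add_distrib]

variable {σ : Type}

theorem weight_comp {Γ Γ' : Type} [AddCommGroup Γ] [AddCommGroup Γ'] (l : Γ →+ Γ') (w : σ → Γ)
    (u : σ →₀ ℕ) : Finsupp.weight (fun i => l (w i)) u = l (Finsupp.weight w u) := by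
  rw [Finsupp.weight_apply, Finsupp.weight_apply, Finsupp.sum, Finsupp.sum, map_sum]
  simp only [map_nsmul]

/-- A homomorphism that is positive on the positive differences of the weights of the exponents of
`f` preserves the initial form of `f`. -/
theorem wForm_comp {Γ Γ' : Type} [AddCommGroup Γ] [LinearOrder Γ] [AddCommGroup Γ'] [LinearOrder Γ']
    [IsOrderedAddMonoid Γ] [IsOrderedAddMonoid Γ'] (l : Γ →+ Γ') (w : σ → Γ) (f : MvPolynomial σ ℂ)
    (hl : ∀ u ∈ f.support, ∀ u' ∈ f.support, Finsupp.weight w u < Finsupp.weight w u' →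
      0 < l (Finsupp.weight w u' - Finsupp.weight w u)) :
    wForm (fun i => l (w i)) f = wForm w f := by
  have h : ∀ u ∈ f.support, ∀ u' ∈ f.support, l (Finsupp.weight w u) ≤ l (Finsupp.weight w u') ↔
      Finsupp.weight w u ≤ Finsupp.weight w u' := by
    intro u hu u' hu'
    constructor
    · intro h
      by_contra hcon
      have := hl u' hu' u hu (not_le.mp hcon)
      rw [map_sub, sub_pos] at this
      exact absurd h (not_le.mpr this)
    · intro h
      rcases h.eq_or_lt with h | h
      · rw [h]
      · have := hl u hu u' hu' h
        rw [map_sub, sub_pos] at this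
        exact this.le
  rw [wForm_congr_iff]
  intro u hu
  simp only [weight_comp]
  exact forall₂_congr fun u' hu' => h u hu u' hu'

variable [Finite σ]

/-- The initial ideal is generated by finitely many initial forms, and these only depend on the
signs of finitely many elements of the value group. An integral weight with the same signs therefore
has at least this initial ideal, and hence exactly this one. -/
theorem exists_hom_wInit_eq {d : ℕ} (w : σ → ℤ ×ₗ (Lex (Fin d → ℤ))ᵒᵈ)
    {I : Ideal (MvPolynomial σ ℂ)} (hI : IsGradedIdeal I) :
    ∃ w' : σ → ℤ, wInit w' I = wInit w I := by
  classical
  have hfg : (wInit w I).FG := IsNoetherian.noetherian _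
  obtain ⟨T, hT, hT2⟩ := Submodule.fg_span_iff_fg_span_finset_subset _ |>.mp hfg
  have hT' : ∀ h ∈ T, ∃ f ∈ I, wForm w f = h := fun h hh => hT hh
  choose! F hF hF2 using hT'
  let E : Finset (ℤ ×ₗ (Lex (Fin d → ℤ))ᵒᵈ) :=
    (T.biUnion fun h => ((F h).support ×ˢ (F h).support).image fun p =>
      Finsupp.weight w p.2 - Finsupp.weight w p.1).filter fun γ => 0 < γ
  obtain ⟨l, hl⟩ := exists_hom_pos E fun γ hγ => (Finset.mem_filter.mp hγ).2
  refine ⟨fun i => l (w i), (wInit_eq_of_le hI ?_).symm⟩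
  change Submodule.span _ _ ≤ _
  rw [hT2, Submodule.span_le]
  intro h hh
  rw [← hF2 h hh, ← wForm_comp l w (F h)]
  · exact wForm_mem_wInit _ (hF h hh)
  · intro u hu u' hu' hlt
    refine hl _ (Finset.mem_filter.mpr ⟨Finset.mem_biUnion.mpr ⟨h, hh, ?_⟩, sub_pos.mpr hlt⟩)
    exact Finset.mem_image.mpr ⟨(u, u'), Finset.mem_product.mpr ⟨hu, hu'⟩, rfl⟩

/-- Adding a constant `c` to all weights adds `r c` to the weights of all terms of a form of degree
`r`. -/
theorem wInit_add_const (w : σ → ℤ) (c : ℤ) {I : Ideal (MvPolynomial σ ℂ)} (hI : IsGradedIdeal I) :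
    wInit (fun i => w i + c) I = wInit w I := by
  refine (wInit_eq_of_le hI fun x hx => ?_).symm
  rw [← sum_homogeneousComponent x]
  refine sum_mem fun r _ => ?_
  refine (Submodule.span_le (p := (wInit (fun i => w i + c) I).restrictScalars ℂ)).mpr ?_
    (homogeneousComponent_mem_initSpan w hI hx r)
  rintro _ ⟨f, hf, rfl⟩
  have : wForm w f = wForm (fun i => w i + c) f := by
    rw [wForm_congr_iff]
    intro u hu
    have h : ∀ u ∈ f.support, Finsupp.weight (fun i => w i + c) u = Finsupp.weight w u + r * c := by
      intro u hu
      have hdeg : u.degree = r := by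
        by_contra h
        exact mem_support_iff.mp hu ((mem_degPart.mp hf).2.coeff_eq_zero h)
      rw [Finsupp.weight_apply, Finsupp.weight_apply, Finsupp.sum, Finsupp.sum, ← hdeg,
        Finsupp.degree_apply, Nat.cast_sum, Finset.sum_mul, ← Finset.sum_add_distrib]
      simp [mul_add]
    refine forall₂_congr fun u' hu' => ?_
    rw [h u hu, h u' hu', add_le_add_iff_right]
  rw [this]
  exact wForm_mem_wInit _ hf.1

/-- The initial ideal for weights in the value group is the initial ideal for nonpositive integral
weights. -/
theorem exists_nonpos_wInit_eq {d : ℕ} (w : σ → ℤ ×ₗ (Lex (Fin d → ℤ))ᵒᵈ)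
    {I : Ideal (MvPolynomial σ ℂ)} (hI : IsGradedIdeal I) :
    ∃ m : σ → ℕ, wInit (fun i => -(m i : ℤ)) I = wInit w I := by
  obtain ⟨w', hw'⟩ := exists_hom_wInit_eq w hI
  obtain ⟨c, hc⟩ : ∃ c : ℤ, ∀ i, w' i ≤ c := by
    have := Fintype.ofFinite σ
    refine ⟨∑ i, |w' i|, fun i => (le_abs_self _).trans ?_⟩
    exact Finset.single_le_sum (f := fun i => |w' i|) (fun a _ => abs_nonneg _) (Finset.mem_univ i)
  refine ⟨fun i => (c - w' i).toNat, ?_⟩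
  rw [← hw', ← wInit_add_const w' (-c) hI]
  congr 2
  ext u
  have : ∀ i, -(((c - w' i).toNat : ℕ) : ℤ) = w' i + -c := by
    intro i
    rw [Int.toNat_of_nonneg (sub_nonneg.mpr (hc i))]
    ring
  simp only [this]

omit [Finite σ] in
theorem wInit_intCast (w : σ → ℤ) {I : Ideal (MvPolynomial σ ℂ)} :
    wInit (fun i => (w i : ℝ)) I = wInit w I := by
  unfold wInit
  congr 1
  ext u u'
  have := weight_comp (Int.castAddHom ℝ) w
  simp only [Int.coe_castAddHom] at this
  rw [this, this, Int.cast_le]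

end Approximation

/-! ### The Plücker algebra on the open cell -/

section Cell

variable {k n : ℕ}

/-- The row minor for an injective, not necessarily increasing, choice of rows is a Plücker
coordinate up to sign. -/
theorem exists_idx_of_injective (ι : Fin k → Fin n) (hι : Function.Injective ι) :
    ∃ (J : Idx k n) (ε : ℂ), ε ≠ 0 ∧ ∀ {R : Type} [CommRing R] [Algebra ℂ R]
      (M : Matrix (Fin n) (Fin k) R),
      (M.submatrix ι id).det = algebraMap ℂ R ε * (M.submatrix J id).det := by
  have hmono : StrictMono (ι ∘ Tuple.sort ι) :=
    (Tuple.monotone_sort ι).strictMono_of_injective (hι.comp (Equiv.injective _))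
  refine ⟨OrderEmbedding.ofStrictMono _ hmono,
    ((Equiv.Perm.sign (Tuple.sort ι)⁻¹ : ℤ) : ℂ), ?_, ?_⟩
  · exact_mod_cast (Equiv.Perm.sign (Tuple.sort ι)⁻¹).ne_zero
  · intro R _ _ M
    have h : M.submatrix ι id = (M.submatrix (ι ∘ Tuple.sort ι) id).submatrix
        ((Tuple.sort ι)⁻¹ : Equiv.Perm (Fin k)) id := by
      ext a b
      simp [Matrix.submatrix_apply]
    rw [h, Matrix.det_permute, map_intCast]
    rfl

theorem pluckerHom_X {R : Type} [CommRing R] [Algebra ℂ R] (M : Matrix (Fin n) (Fin k) R)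
    (J : Idx k n) : pluckerHom M (X J) = (M.submatrix J id).det := by
  rw [pluckerHom, aeval_X]

theorem plEval_plMk {R : Type} [CommRing R] [Algebra ℂ R] (M : Matrix (Fin n) (Fin k) R)
    (f : MvPolynomial (Idx k n) ℂ) : plEval M (plMk k n f) = pluckerHom M f := rfl

theorem plEval_pbar {R : Type} [CommRing R] [Algebra ℂ R] (M : Matrix (Fin n) (Fin k) R)
    (J : Idx k n) : plEval M (pbar J) = (M.submatrix J id).det := by
  rw [pbar, plEval_plMk, pluckerHom_X]

theorem plMk_eq_zero_iff (f : MvPolynomial (Idx k n) ℂ) :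
    plMk k n f = 0 ↔ f ∈ pluckerIdeal k n := Ideal.Quotient.eq_zero_iff_mem

theorem plMk_surjective : Function.Surjective (plMk k n) := Ideal.Quotient.mk_surjective

instance isPrime_pluckerIdeal : (pluckerIdeal k n).IsPrime := RingHom.ker_isPrime _

instance : IsDomain (PlAlg k n) :=
  inferInstanceAs (IsDomain (MvPolynomial (Idx k n) ℂ ⧸ pluckerIdeal k n))

/-- The minors are forms of the same positive degree `k`, so relations between them can be separated
by degree; for `k = 0` the only minor is `1`. -/
theorem isGradedIdeal_pluckerIdeal (hk : 1 ≤ k) : IsGradedIdeal (pluckerIdeal k n) := by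
  intro f hf r
  have hdet : ∀ J : Idx k n, ((genericMatrix k n).submatrix J id).det.IsHomogeneous k := by
    intro J
    rw [Matrix.det_apply]
    refine IsHomogeneous.sum _ _ _ fun π _ => ?_
    have h : (∏ i, (genericMatrix k n).submatrix J id (π i) i).IsHomogeneous k := by
      have := IsHomogeneous.prod Finset.univ
        (fun i => (genericMatrix k n).submatrix J id (π i) i) (fun _ => 1)
        (fun i _ => isHomogeneous_X ℂ _)
      simpa using this
    rw [Units.smul_def, zsmul_eq_mul]
    rw [← map_intCast (C : ℂ →+* _)]
    exact h.C_mul _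
  have hcomp : ∀ s, (pluckerHom (genericMatrix k n) (homogeneousComponent s f)).IsHomogeneous
      (k * s) := fun s => (homogeneousComponent_isHomogeneous s f).aeval _ hdet
  have hsum : ∑ s ∈ Finset.range (f.totalDegree + 1),
      pluckerHom (genericMatrix k n) (homogeneousComponent s f) = 0 := by
    rw [← map_sum, sum_homogeneousComponent]
    exact hf
  by_cases hr : r ∈ Finset.range (f.totalDegree + 1)
  · have h := congrArg (homogeneousComponent (k * r)) hsum
    rw [map_zero, map_sum, Finset.sum_eq_single r] at h
    · rw [homogeneousComponent_eq_self (hcomp r)] at h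
      exact h
    · intro s _ hs
      rw [homogeneousComponent_of_mem (hcomp s), if_neg]
      intro h
      exact hs (Nat.eq_of_mul_eq_mul_left hk h).symm
    · exact fun h => absurd hr h
  · rw [homogeneousComponent_eq_zero]
    · exact zero_mem _
    · rw [Finset.mem_range] at hr
      omega

theorem aeval_const_mul {σ R : Type} [CommRing R] [Algebra ℂ R] (c : R) (g : σ → R)
    {f : MvPolynomial σ ℂ} {r : ℕ} (hf : f.IsHomogeneous r) :
    aeval (fun J => c * g J) f = c ^ r * aeval g f := by
  conv_lhs => rw [f.as_sum]
  conv_rhs => rw [f.as_sum]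
  rw [map_sum, map_sum, Finset.mul_sum]
  refine Finset.sum_congr rfl fun u hu => ?_
  have hdeg : u.degree = r := by
    by_contra h
    exact mem_support_iff.mp hu (hf.coeff_eq_zero h)
  rw [aeval_monomial, aeval_monomial]
  simp only [Finsupp.prod, mul_pow, Finset.prod_mul_distrib]
  rw [Finset.prod_pow_eq_pow_sum, ← hdeg, Finsupp.degree_apply]
  ring

/-- Right multiplication by a square matrix rescales forms in the minors. -/
theorem pluckerHom_mul {R : Type} [CommRing R] [Algebra ℂ R] (M : Matrix (Fin n) (Fin k) R)
    (B : Matrix (Fin k) (Fin k) R) {f : MvPolynomial (Idx k n) ℂ} {r : ℕ}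
    (hf : f.IsHomogeneous r) : pluckerHom (M * B) f = B.det ^ r * pluckerHom M f := by
  rw [pluckerHom, pluckerHom, ← aeval_const_mul _ _ hf]
  congr 2
  funext J
  rw [mul_comm, ← Matrix.det_mul]
  rfl

/-- A matrix with identity top block is a specialization of the generic element of the cell. -/
theorem pluckerHom_eq_comp_cell (hkn : k ≤ n) {R : Type} [CommRing R] [Algebra ℂ R]
    (M : Matrix (Fin n) (Fin k) R) (hM : M.submatrix (Fin.castLE hkn) id = 1) :
    pluckerHom M = (aeval fun p : {p : Fin n × Fin k // k ≤ (p.1 : ℕ)} => M p.1.1 p.1.2).comp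
      (pluckerHom (cellColumns k n)) := by
  apply MvPolynomial.algHom_ext
  intro J
  rw [AlgHom.comp_apply, pluckerHom_X, pluckerHom_X, AlgHom.map_det]
  congr 1
  ext i j
  simp only [Matrix.submatrix_apply, id_eq, AlgHom.mapMatrix_apply, Matrix.map_apply, cellColumns]
  by_cases h : k ≤ (J i : ℕ)
  · rw [dif_pos h, aeval_X]
  · rw [dif_neg h]
    have h1 := congrFun (congrFun hM ⟨(J i : ℕ), not_le.mp h⟩) j
    rw [Matrix.submatrix_apply, Matrix.one_apply] at h1
    have h2 : Fin.castLE hkn ⟨(J i : ℕ), not_le.mp h⟩ = J i := rfl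
    rw [h2, id_eq] at h1
    rw [h1]
    simp only [Fin.ext_iff]
    split_ifs <;> simp

/-- A generic minor does not vanish. -/
theorem X_notMem_pluckerIdeal (J : Idx k n) : X J ∉ pluckerIdeal k n := by
  intro h
  have := pluckerHom_eq_zero
    (Matrix.of fun (i : Fin n) (j : Fin k) => if i = J j then (1 : ℂ) else 0) _ h
  rw [pluckerHom_X] at this
  have h1 : (Matrix.of fun (i : Fin n) (j : Fin k) => if i = J j then (1 : ℂ) else 0).submatrix
      J id = 1 := by
    ext i j
    simp [Matrix.one_apply]
  rw [h1, Matrix.det_one] at this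
  exact one_ne_zero this

/-- A form that vanishes on the open cell vanishes on the Grassmannian. -/
theorem mem_pluckerIdeal_of_cell (hkn : k ≤ n) {f : MvPolynomial (Idx k n) ℂ} {r : ℕ}
    (hf : f.IsHomogeneous r) (h : pluckerHom (cellColumns k n) f = 0) : f ∈ pluckerIdeal k n := by
  let P := MvPolynomial (Fin n × Fin k) ℂ
  let K := FractionRing P
  let G : Matrix (Fin n) (Fin k) K := (genericMatrix k n).map (algebraMap P K)
  let T : Matrix (Fin k) (Fin k) K := G.submatrix (Fin.castLE hkn) id
  have hcomp : ∀ g, pluckerHom G g = algebraMap P K (pluckerHom (genericMatrix k n) g) := by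
    intro g
    have : pluckerHom G = (IsScalarTower.toAlgHom ℂ P K).comp (pluckerHom (genericMatrix k n)) := by
      apply MvPolynomial.algHom_ext
      intro J
      rw [AlgHom.comp_apply, pluckerHom_X, pluckerHom_X, AlgHom.map_det]
      rfl
    rw [this]
    rfl
  have hT : T.det ≠ 0 := by
    have h1 : T.det = pluckerHom G (X (Fin.castLEOrderEmb hkn)) := by
      rw [pluckerHom_X]
      rfl
    rw [h1, hcomp]
    intro h0
    have := (IsFractionRing.injective P K) (h0.trans (map_zero _).symm)
    exact X_notMem_pluckerIdeal _ this
  have hunit : IsUnit T.det := isUnit_iff_ne_zero.mpr hT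
  have htop : (G * T⁻¹).submatrix (Fin.castLE hkn) id = 1 := by
    have : (G * T⁻¹).submatrix (Fin.castLE hkn) id = T * T⁻¹ := rfl
    rw [this, Matrix.mul_nonsing_inv _ hunit]
  have h0 : pluckerHom (G * T⁻¹) f = 0 := by
    rw [pluckerHom_eq_comp_cell hkn _ htop, AlgHom.comp_apply, h, map_zero]
  have h1 : pluckerHom G f = 0 := by
    have : G = (G * T⁻¹) * T := by
      rw [Matrix.mul_assoc, Matrix.nonsing_inv_mul _ hunit, Matrix.mul_one]
    rw [this, pluckerHom_mul _ _ hf, h0, mul_zero]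
  rw [hcomp] at h1
  exact (IsFractionRing.injective P K) (h1.trans (map_zero _).symm)

theorem card_cell (hkn : k ≤ n) :
    Fintype.card {p : Fin n × Fin k // k ≤ (p.1 : ℕ)} = k * (n - k) := by
  have e : {p : Fin n × Fin k // k ≤ (p.1 : ℕ)} ≃ Fin (n - k) × Fin k :=
    { toFun := fun p => (⟨p.1.1 - k, by have := p.2; have := p.1.1.2; omega⟩, p.1.2)
      invFun := fun q => ⟨(⟨q.1 + k, by have := q.1.2; omega⟩, q.2), Nat.le_add_left _ _⟩
      left_inv := fun p => by
        apply Subtype.ext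
        refine Prod.ext (Fin.ext ?_) rfl
        have := p.2
        simp only
        omega
      right_inv := fun q => by
        refine Prod.ext (Fin.ext ?_) rfl
        simp }
  rw [Fintype.card_congr e, Fintype.card_prod, Fintype.card_fin, Fintype.card_fin, mul_comm]

/-- If the field of rational functions in `card ι` variables is generated by fractions in the
polynomials `x`, a family of at most `card ι` polynomials, then `x` is algebraically
independent. -/
theorem injective_aeval_of_ratio {ι τ : Type} [Fintype ι] [Fintype τ]
    (hcard : Fintype.card ι ≤ Fintype.card τ) (x : ι → MvPolynomial τ ℂ)
    (hx : ∀ t : τ, ∃ f g : MvPolynomial ι ℂ, aeval x g ≠ 0 ∧ X t * aeval x g = aeval x f) :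
    Function.Injective (aeval x : MvPolynomial ι ℂ →ₐ[ℂ] MvPolynomial τ ℂ) := by
  let P := MvPolynomial τ ℂ
  let K := FractionRing P
  let φ : P →ₐ[ℂ] K := IsScalarTower.toAlgHom ℂ P K
  have hφ : Function.Injective φ := IsFractionRing.injective P K
  let y : ι → K := fun i => φ (x i)
  have hy : ∀ f : MvPolynomial ι ℂ, aeval y f = φ (aeval x f) := by
    intro f
    have : aeval y = φ.comp (aeval x) := by
      apply MvPolynomial.algHom_ext
      intro i
      rw [AlgHom.comp_apply, aeval_X, aeval_X]
    rw [this]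
    rfl
  have hmem : ∀ f : MvPolynomial ι ℂ, φ (aeval x f) ∈ Algebra.adjoin ℂ (Set.range y) := by
    intro f
    rw [Algebra.adjoin_range_eq_range_aeval, ← hy]
    exact ⟨f, rfl⟩
  let A := Algebra.adjoin ℂ (Set.range y)
  have hX : ∀ t : τ, IsAlgebraic A (φ (X t)) := by
    intro t
    obtain ⟨f, g, hg, hfg⟩ := hx t
    have hg' : φ (aeval x g) ≠ 0 := fun h => hg (hφ (h.trans (map_zero _).symm))
    have h1 : φ (X t) = algebraMap A K ⟨_, hmem f⟩ * (algebraMap A K ⟨_, hmem g⟩)⁻¹ := by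
      refine (eq_mul_inv_iff_mul_eq₀ hg').mpr ?_
      change φ (X t) * φ (aeval x g) = φ (aeval x f)
      rw [← map_mul, hfg]
    rw [h1]
    exact (isAlgebraic_algebraMap _).mul (isAlgebraic_algebraMap _).inv
  have hP : ∀ p : P, IsAlgebraic A (φ p) := by
    intro p
    induction p using MvPolynomial.induction_on with
    | C c =>
      have : φ (C c) = algebraMap A K (algebraMap ℂ A c) := by
        rw [← algebraMap_eq, AlgHom.commutes]
        rfl
      rw [this]
      exact isAlgebraic_algebraMap _
    | add p q hp hq => rw [map_add]; exact hp.add hq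
    | mul_X p t hp => rw [map_mul]; exact hp.mul (hX t)
  have : Algebra.IsAlgebraic A K := ⟨fun z => by
    obtain ⟨a, b, hb, rfl⟩ := IsFractionRing.div_surjective (A := P) z
    rw [div_eq_mul_inv]
    exact (hP a).mul (hP b).inv⟩
  have hind : AlgebraicIndependent ℂ fun t : τ => φ (X t) :=
    (MvPolynomial.algebraicIndependent_X τ ℂ).map' hφ
  have htr := hind.cardinalMk_le_trdeg
  have hbasis : IsTranscendenceBasis ℂ y := by
    refine Algebra.IsAlgebraic.isTranscendenceBasis_of_le_trdeg_of_finite ℂ y ?_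
    refine le_trans ?_ htr
    rw [Cardinal.mk_fintype, Cardinal.mk_fintype]
    exact_mod_cast hcard
  intro f g hfg
  apply hbasis.1
  rw [hy, hy, hfg]

end Cell

/-! ### Charts given by ratios of minors -/

section Iterated

variable {k n : ℕ}

/-- A parametrization `N` of an open part of the Grassmannian by `n × k` matrices in which each
coordinate function is, up to a constant, the quotient of two minors. -/
structure IsMinorChart {τ : Type} (hkn : k ≤ n) (N : Matrix (Fin n) (Fin k) (MvPolynomial τ ℂ)) :
    Prop where
  base : (N.submatrix (Fin.castLE hkn) id).det = 1
  ratio : ∀ t : τ, ∃ (J J' : Idx k n) (c : ℂ), c ≠ 0 ∧ (N.submatrix J' id).det ≠ 0 ∧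
    X t * (N.submatrix J' id).det = C c * (N.submatrix J id).det

/-- Forms that vanish on the image of a minor chart of the right dimension vanish on the
Grassmannian. -/
theorem IsMinorChart.mem_pluckerIdeal {τ : Type} [Fintype τ] {hkn : k ≤ n}
    {N : Matrix (Fin n) (Fin k) (MvPolynomial τ ℂ)} (hN : IsMinorChart hkn N)
    (hcard : Fintype.card τ = k * (n - k)) {f : MvPolynomial (Idx k n) ℂ} {r : ℕ}
    (hf : f.IsHomogeneous r) (h : pluckerHom N f = 0) : f ∈ pluckerIdeal k n := by
  -- Normalizing the top block to the identity does not change the minors, so they are polynomials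
  -- in the `k (n - k)` remaining entries, and these are algebraically independent.
  set T := N.submatrix (Fin.castLE hkn) id with hT
  have htop : (N * T.adjugate).submatrix (Fin.castLE hkn) id = 1 := by
    have : (N * T.adjugate).submatrix (Fin.castLE hkn) id = T * T.adjugate := rfl
    rw [this, Matrix.mul_adjugate, hN.base, one_smul]
  have hminor : pluckerHom (N * T.adjugate) = pluckerHom N := by
    apply MvPolynomial.algHom_ext
    intro J
    rw [pluckerHom_X, pluckerHom_X]
    have : (N * T.adjugate).submatrix J id = N.submatrix J id * T.adjugate := rfl
    rw [this, Matrix.det_mul, Matrix.det_adjugate, hN.base, one_pow, mul_one]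
  have hcell := pluckerHom_eq_comp_cell hkn _ htop
  rw [hminor] at hcell
  have hinj := injective_aeval_of_ratio (ι := {p : Fin n × Fin k // k ≤ (p.1 : ℕ)}) (τ := τ)
    (by rw [card_cell hkn, hcard]) (fun p => (N * T.adjugate) p.1.1 p.1.2) (by
      intro t
      obtain ⟨J, J', c, -, hJ', hJ⟩ := hN.ratio t
      rw [← pluckerHom_X, ← pluckerHom_X, ← smul_eq_C_mul, ← map_smul] at hJ
      rw [← pluckerHom_X] at hJ'
      rw [hcell] at hJ hJ'
      exact ⟨_, _, hJ', hJ⟩)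
  refine mem_pluckerIdeal_of_cell hkn hf (hinj ?_)
  rw [map_zero, ← h, hcell]
  rfl

theorem IsMinorChart.det_ne_zero {τ : Type} [Fintype τ] {hkn : k ≤ n}
    {N : Matrix (Fin n) (Fin k) (MvPolynomial τ ℂ)} (hN : IsMinorChart hkn N)
    (hcard : Fintype.card τ = k * (n - k)) (J : Idx k n) : (N.submatrix J id).det ≠ 0 := by
  intro h
  rw [← pluckerHom_X] at h
  exact X_notMem_pluckerIdeal J (hN.mem_pluckerIdeal hcard (isHomogeneous_X ℂ J) h)

/-- The product of the matrices `1 + y E_{j,i}` over a list of pairs `(ε_i - ε_j, y)`. -/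
def elemProd {R : Type} [CommRing R] (L : List (PosRoot n × R)) : Matrix (Fin n) (Fin n) R :=
  (L.map fun p => 1 + Matrix.single p.1.1.2 p.1.1.1 p.2).prod

theorem elemProd_nil {R : Type} [CommRing R] : elemProd ([] : List (PosRoot n × R)) = 1 := rfl

theorem elemProd_cons {R : Type} [CommRing R] (p : PosRoot n × R) (L : List (PosRoot n × R)) :
    elemProd (p :: L) = (1 + Matrix.single p.1.1.2 p.1.1.1 p.2) * elemProd L := by
  simp [elemProd]

theorem elemProd_append {R : Type} [CommRing R] (L L' : List (PosRoot n × R)) :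
    elemProd (L ++ L') = elemProd L * elemProd L' := by
  simp [elemProd]

theorem elemProd_map {R R' : Type} [CommRing R] [CommRing R'] (φ : R →+* R')
    (L : List (PosRoot n × R)) :
    elemProd (L.map fun p => (p.1, φ p.2)) = (elemProd L).map φ := by
  induction L with
  | nil => simp [elemProd_nil]
  | cons p L ih =>
    rw [List.map_cons, elemProd_cons, elemProd_cons, ih, Matrix.map_mul]
    congr 1
    rw [Matrix.map_add _ (map_add φ), Matrix.map_one _ (map_zero φ) (map_one φ)]
    congr 1
    ext i j
    simp [Matrix.single_apply, apply_ite φ]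

theorem rootProduct_eq (S : List (PosRoot n)) :
    rootProduct S = elemProd (List.ofFn fun t : Fin S.length =>
      (S.get t, (X t : MvPolynomial (Fin S.length) ℂ))) := by
  rw [rootProduct, elemProd, List.map_ofFn]
  rfl

/-- Left multiplication by `1 + y E_{p,q}` adds `y` times the row `q` to the row `p`. -/
theorem elemFactor_mul_apply {R : Type} [CommRing R] (p q : Fin n) (y : R)
    {m : Type} (Q : Matrix (Fin n) m R) (i : Fin n) (j : m) :
    ((1 + Matrix.single p q y : Matrix (Fin n) (Fin n) R) * Q : Matrix (Fin n) m R) i j =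
      Q i j + if i = p then y * Q q j else 0 := by
  rw [Matrix.add_mul, Matrix.one_mul, Matrix.add_apply]
  congr 1
  split_ifs with h
  · rw [h, Matrix.single_mul_apply_same]
  · rw [Matrix.single_mul_apply_of_ne _ _ _ _ _ h]

/-- Roots of the smaller Grassmannian act on the first `n` rows and columns only. -/
theorem elemProd_lift {R : Type} [CommRing R] (L : List (PosRoot n × R)) (b : Fin n) :
    (∀ a : Fin n, elemProd (L.map fun p => (p.1.lift, p.2)) a.castSucc b.castSucc =
      elemProd L a b) ∧
    elemProd (L.map fun p => (p.1.lift, p.2)) (Fin.last n) b.castSucc = 0 := by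
  induction L with
  | nil =>
    refine ⟨fun a => ?_, ?_⟩
    · simp [elemProd_nil, Matrix.one_apply]
    · rw [List.map_nil, elemProd_nil, Matrix.one_apply, if_neg (Fin.castSucc_lt_last b).ne']
  | cons p L ih =>
    rw [List.map_cons, elemProd_cons]
    refine ⟨fun a => ?_, ?_⟩
    · rw [elemProd_cons, elemFactor_mul_apply, elemFactor_mul_apply, ih.1]
      change elemProd L a b + (if a.castSucc = p.1.1.2.castSucc then
        p.2 * elemProd (L.map fun p => (p.1.lift, p.2)) p.1.1.1.castSucc b.castSucc else 0) = _
      rw [ih.1]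
      simp only [Fin.castSucc_inj]
    · rw [elemFactor_mul_apply, ih.2, zero_add, if_neg]
      exact (Fin.castSucc_lt_last _).ne'

/-- The roots `ε_p - ε_{n+1}` add a combination of the first `n` rows to the last row, with their
variables as coefficients. -/
theorem elemProd_last {R : Type} [CommRing R] (L : List (Fin n × R))
    {m : Type} (Q : Matrix (Fin (n + 1)) m R) (j : m) :
    (∀ a : Fin n, (elemProd (L.map fun p =>
      ((⟨(p.1.castSucc, Fin.last n), Fin.castSucc_lt_last p.1⟩ : PosRoot (n + 1)), p.2)) * Q)
        a.castSucc j = Q a.castSucc j) ∧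
    (elemProd (L.map fun p =>
      ((⟨(p.1.castSucc, Fin.last n), Fin.castSucc_lt_last p.1⟩ : PosRoot (n + 1)), p.2)) * Q)
        (Fin.last n) j = Q (Fin.last n) j + (L.map fun p => p.2 * Q p.1.castSucc j).sum := by
  induction L with
  | nil => simp [elemProd_nil]
  | cons p L ih =>
    rw [List.map_cons, elemProd_cons, Matrix.mul_assoc]
    refine ⟨fun a => ?_, ?_⟩
    · rw [elemFactor_mul_apply, if_neg (Fin.castSucc_lt_last _).ne, add_zero]
      exact ih.1 a
    · rw [elemFactor_mul_apply, if_pos rfl, ih.2, List.map_cons, List.sum_cons, ih.1]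
      ring

/-- Replacing a row by a linear combination of the rows multiplies a minor by the coefficient. -/
theorem det_submatrix_update {R : Type} [CommRing R] (N : Matrix (Fin n) (Fin k) R)
    (ι : Fin k → Fin n) (a : Fin n) (c : Fin k → R)
    (h : ∀ j, N a j = ∑ l, c l * N (ι l) j) (l : Fin k) :
    (N.submatrix (Function.update ι l a) id).det = c l * (N.submatrix ι id).det := by
  have h1 := Matrix.det_updateRow_sum (N.submatrix ι id) l c
  rw [smul_eq_mul] at h1
  rw [← h1]
  congr 1
  ext i j
  rw [Matrix.updateRow_apply, Matrix.submatrix_apply, id_eq, Function.update_apply]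
  split_ifs with hi
  · rw [h]
    simp [Finset.sum_apply]
  · rfl

theorem injective_update_of_notMem {ι : Fin k → Fin n} (hι : Function.Injective ι) (l : Fin k)
    {a : Fin n} (ha : ∀ i, ι i ≠ a) : Function.Injective (Function.update ι l a) := by
  intro i j hij
  rw [Function.update_apply, Function.update_apply] at hij
  split_ifs at hij with h1 h2 h2
  · rw [h1, h2]
  · exact absurd hij.symm (ha j)
  · exact absurd hij (ha i)
  · exact hι hij

/-- Adding to a minor chart a row which is a combination, with new variables as coefficients, of
`k` different rows gives a minor chart. -/
theorem IsMinorChart.extend {τ τ' : Type} [Fintype τ] {hkn : k ≤ n}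
    {N : Matrix (Fin n) (Fin k) (MvPolynomial τ ℂ)} (hN : IsMinorChart hkn N)
    (hcard : Fintype.card τ = k * (n - k)) (e₁ : Fin k → τ') (e₂ : τ → τ')
    (he₂ : Function.Injective e₂) (he : ∀ t', (∃ l, e₁ l = t') ∨ ∃ t, e₂ t = t')
    (i : Fin k → Fin n) (hi : Function.Injective i)
    {N' : Matrix (Fin (n + 1)) (Fin k) (MvPolynomial τ' ℂ)}
    (h1 : ∀ a j, N' (Fin.castSucc a) j = rename e₂ (N a j))
    (h2 : ∀ j, N' (Fin.last n) j = ∑ l, X (e₁ l) * N' (i l).castSucc j) :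
    IsMinorChart (hkn.trans (Nat.le_succ n)) N' := by
  have hdet : ∀ ι : Fin k → Fin n, (N'.submatrix (Fin.castSucc ∘ ι) id).det =
      rename e₂ (N.submatrix ι id).det := by
    intro ι
    rw [AlgHom.map_det]
    congr 1
    exact Matrix.ext fun a j => h1 (ι a) j
  have hne : ∀ ι : Fin k → Fin n, (N.submatrix ι id).det ≠ 0 →
      (N'.submatrix (Fin.castSucc ∘ ι) id).det ≠ 0 := by
    intro ι h
    rw [hdet]
    exact fun h0 => h (rename_injective e₂ he₂ (h0.trans (map_zero _).symm))
  refine ⟨?_, fun t' => ?_⟩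
  · have := hdet (Fin.castLE hkn)
    rw [hN.base, map_one] at this
    exact this
  rcases he t' with ⟨l, rfl⟩ | ⟨t, rfl⟩
  · obtain ⟨J₀, ε₀, hε₀, hJ₀⟩ := exists_idx_of_injective i hi
    obtain ⟨J₁, ε₁, hε₁, hJ₁⟩ := exists_idx_of_injective _
      (injective_update_of_notMem ((Fin.castSucc_injective n).comp hi) l
        (a := Fin.last n) fun i => (Fin.castSucc_lt_last _).ne)
    have hJ₀' : (N'.submatrix (Fin.castSucc ∘ i) id).det =
        C ε₀ * (N'.submatrix (Fin.castSucc ∘ J₀) id).det := by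
      rw [hdet, hdet, hJ₀, map_mul, algebraMap_eq, rename_C]
    have hup := det_submatrix_update N' (Fin.castSucc ∘ i) (Fin.last n) (fun l => X (e₁ l)) h2 l
    rw [hJ₁, hJ₀', algebraMap_eq] at hup
    refine ⟨J₁, J₀.trans Fin.castSuccOrderEmb, ε₀⁻¹ * ε₁, mul_ne_zero (inv_ne_zero hε₀) hε₁,
      hne _ (hN.det_ne_zero hcard J₀), ?_⟩
    change X (e₁ l) * (N'.submatrix (Fin.castSucc ∘ J₀) id).det = _
    rw [C_mul, mul_assoc, hup]
    have : (C ε₀⁻¹ * C ε₀ : MvPolynomial τ' ℂ) = 1 := by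
      rw [← C_mul, inv_mul_cancel₀ hε₀, C_1]
    linear_combination -(X (e₁ l) * (N'.submatrix (Fin.castSucc ∘ J₀) id).det) * this
  · obtain ⟨J, J', c, hc, hJ', hJ⟩ := hN.ratio t
    refine ⟨J.trans Fin.castSuccOrderEmb, J'.trans Fin.castSuccOrderEmb, c, hc, hne _ hJ', ?_⟩
    change X (e₂ t) * (N'.submatrix (Fin.castSucc ∘ J') id).det =
      C c * (N'.submatrix (Fin.castSucc ∘ J) id).det
    rw [hdet, hdet, ← rename_X, ← map_mul, hJ, map_mul, rename_C]

end Iterated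

/-! ### Minor charts of birational and iterated sequences -/

section Iterated

variable {k n : ℕ}

/-- The last row of the inverse of `elemProd L`, by recursion: multiplication of `elemProd L` by
`1 + y E_{j,i}` from the left is multiplication of its inverse by `1 - y E_{j,i}` from the right. -/
def lastRow {R : Type} [CommRing R] : List (PosRoot (n + 1) × R) → Fin (n + 1) → R
  | [] => fun i => if i = Fin.last n then 1 else 0
  | p :: L => fun i => lastRow L i - if i = p.1.1.1 then p.2 * lastRow L p.1.1.2 else 0

theorem lastRow_cons {R : Type} [CommRing R] (p : PosRoot (n + 1) × R)
    (L : List (PosRoot (n + 1) × R)) (i : Fin (n + 1)) :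
    lastRow (p :: L) i = lastRow L i - if i = p.1.1.1 then p.2 * lastRow L p.1.1.2 else 0 := rfl

/-- The defining property of `lastRow L`: its product with `elemProd L` is the last row of the
identity. -/
theorem sum_lastRow_mul {R : Type} [CommRing R] (L : List (PosRoot (n + 1) × R))
    (j : Fin (n + 1)) :
    ∑ i, lastRow L i * elemProd L i j = if j = Fin.last n then 1 else 0 := by
  induction L with
  | nil => simp [lastRow, elemProd_nil, Matrix.one_apply, eq_comm]
  | cons p L ih =>
    rw [← ih, elemProd_cons]
    simp only [lastRow, elemFactor_mul_apply]
    have hne : p.1.1.1 ≠ p.1.1.2 := p.1.2.ne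
    have h : ∀ i, (lastRow L i - if i = p.1.1.1 then p.2 * lastRow L p.1.1.2 else 0) *
        (elemProd L i j + if i = p.1.1.2 then p.2 * elemProd L p.1.1.1 j else 0) =
        lastRow L i * elemProd L i j +
          ((if i = p.1.1.2 then lastRow L i * (p.2 * elemProd L p.1.1.1 j) else 0) -
          if i = p.1.1.1 then p.2 * lastRow L p.1.1.2 * elemProd L i j else 0) := by
      intro i
      by_cases h1 : i = p.1.1.1
      · rw [if_pos h1, if_neg (h1 ▸ hne), if_neg (h1 ▸ hne), if_pos h1]
        ring
      · rw [if_neg h1, if_neg h1]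
        split_ifs <;> ring
    simp only [h, Finset.sum_add_distrib, Finset.sum_sub_distrib, Finset.sum_ite_eq',
      Finset.mem_univ, if_true]
    ring

theorem lastRow_last {R : Type} [CommRing R] (L : List (PosRoot (n + 1) × R)) :
    lastRow L (Fin.last n) = 1 := by
  induction L with
  | nil => simp [lastRow]
  | cons p L ih =>
    rw [lastRow_cons, ih, if_neg, sub_zero]
    exact (p.1.2.trans_le (Fin.le_last _)).ne'

theorem lastRow_of_notMem {R : Type} [CommRing R] (L : List (PosRoot (n + 1) × R))
    {i : Fin (n + 1)} (hi : i ≠ Fin.last n) (h : i ∉ L.map fun p => p.1.1.1) :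
    lastRow L i = 0 := by
  induction L with
  | nil => simp [lastRow, hi]
  | cons p L ih =>
    rw [List.map_cons, List.mem_cons, not_or] at h
    rw [lastRow_cons, ih h.2, if_neg h.1, sub_zero]

/-- When the initial vertices of the roots are distinct, the roots form a tree directed towards the
last vertex, and the entries of `lastRow` are the monomials of the paths in it. -/
theorem lastRow_eq_mul {R : Type} [CommRing R] (L : List (PosRoot (n + 1) × R))
    (hL : (L.map fun p => p.1.1.1).Nodup) (hne : ∀ p ∈ L, lastRow L p.1.1.1 ≠ 0) :
    ∀ p ∈ L, lastRow L p.1.1.1 = -(p.2 * lastRow L p.1.1.2) := by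
  induction L with
  | nil => simp
  | cons q L ih =>
    rw [List.map_cons, List.nodup_cons] at hL
    have hq : lastRow L q.1.1.1 = 0 :=
      lastRow_of_notMem L (q.1.2.trans_le (Fin.le_last _)).ne hL.1
    intro p hp
    rcases List.mem_cons.mp hp with rfl | hp
    · rw [lastRow_cons, hq, if_pos rfl, lastRow_cons, if_neg p.1.2.ne', sub_zero, zero_sub]
    · have hsame : ∀ p' ∈ L, lastRow (q :: L) p'.1.1.1 = lastRow L p'.1.1.1 := by
        intro p' hp'
        have : p'.1.1.1 ≠ q.1.1.1 := by
          intro h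
          exact hL.1 (List.mem_map.mpr ⟨p', hp', h⟩)
        rw [lastRow_cons, if_neg this, sub_zero]
      have hne' : ∀ p' ∈ L, lastRow L p'.1.1.1 ≠ 0 := by
        intro p' hp'
        rw [← hsame p' hp']
        exact hne p' (List.mem_cons_of_mem _ hp')
      have h1 := ih hL.2 hne' p hp
      rw [hsame p hp, h1, lastRow_cons, if_neg, sub_zero]
      intro h2
      apply hne' p hp
      rw [h1, h2, hq, mul_zero, neg_zero]

/-- A birational sequence for `Gr(k, ℂ^{k+1})` gives a minor chart. Since all `k + 1` Plücker
coordinates are nonzero, each of the `k` vertices other than the last is the initial vertex of one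
of the `k` roots, so of exactly one. -/
theorem isMinorChart_of_isBirational (S : List (PosRoot (k + 1)))
    (hS : IsBirational (Nat.le_succ k) S) :
    IsMinorChart (Nat.le_succ k) (rootColumns (Nat.le_succ k) S) := by
  obtain ⟨hlen, e, he⟩ := hS
  have hlen' : S.length = k := by
    have h1 : k.succ - k = 1 := by omega
    rw [hlen, h1, mul_one]
  set N := rootColumns (Nat.le_succ k) S with hNdef
  have hpsi : ∀ J : Idx k (k + 1), psiStar (Nat.le_succ k) S (pbar J) = (N.submatrix J id).det :=
    fun J => plEval_pbar N J
  have hbase : (N.submatrix Fin.castSucc id).det = 1 := by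
    have h1 := he (Fin.castLEOrderEmb (Nat.le_succ k))
    have h2 : (cellColumns k (k + 1)).submatrix (Fin.castLEOrderEmb (Nat.le_succ k)) id = 1 := by
      ext i j
      simp [cellColumns, Matrix.one_apply, Fin.ext_iff, i.2.not_ge]
    rw [hpsi, plEval_pbar, h2, Matrix.det_one, map_one, map_one] at h1
    have h3 := IsFractionRing.injective (MvPolynomial (Fin S.length) ℂ)
      (FractionRing (MvPolynomial (Fin S.length) ℂ)) ((map_one _).trans h1)
    exact h3.symm
  have hne : ∀ J : Idx k (k + 1), (N.submatrix J id).det ≠ 0 := by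
    intro J h0
    have h1 := he J
    rw [hpsi, h0, map_zero, EmbeddingLike.map_eq_zero_iff] at h1
    have h2 := IsFractionRing.injective _ _ (h1.trans (map_zero _).symm)
    rw [plEval_pbar, ← pluckerHom_X] at h2
    exact X_notMem_pluckerIdeal J
      (mem_pluckerIdeal_of_cell (Nat.le_succ k) (isHomogeneous_X ℂ J) h2)
  set L := List.ofFn fun t : Fin S.length =>
    (S.get t, (X t : MvPolynomial (Fin S.length) ℂ)) with hL
  have hNL : ∀ i (j : Fin k), N i j = elemProd L i j.castSucc := by
    intro i j
    rw [hNdef, rootColumns, rootProduct_eq]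
    rfl
  set r := lastRow L with hr
  -- the last row of `N` is a combination of the others with coefficients from `lastRow`
  have hrow : ∀ j, N (Fin.last k) j = ∑ l : Fin k, -r l.castSucc * N l.castSucc j := by
    intro j
    have h1 := sum_lastRow_mul L j.castSucc
    rw [if_neg (Fin.castSucc_lt_last j).ne, Fin.sum_univ_castSucc, lastRow_last, one_mul] at h1
    simp only [hNL, neg_mul, Finset.sum_neg_distrib]
    linear_combination h1
  -- by Cramer's rule, the entries of `lastRow` are the minors of `N` up to sign
  have hminor : ∀ v : Fin (k + 1), ∃ (J : Idx k (k + 1)) (c : ℂ), c ≠ 0 ∧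
      r v = C c * (N.submatrix J id).det := by
    intro v
    refine Fin.lastCases ?_ (fun l => ?_) v
    · refine ⟨Fin.castLEOrderEmb (Nat.le_succ k), 1, one_ne_zero, ?_⟩
      rw [hr, lastRow_last, C_1, one_mul]
      exact hbase.symm
    · obtain ⟨J, ε, hε, hJ⟩ := exists_idx_of_injective _
        (injective_update_of_notMem (Fin.castSucc_injective k) l
          (a := Fin.last k) fun i => (Fin.castSucc_lt_last _).ne)
      refine ⟨J, -ε, neg_ne_zero.mpr hε, ?_⟩
      have h1 := det_submatrix_update N Fin.castSucc (Fin.last k) (fun l => -r l.castSucc) hrow l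
      rw [hJ, hbase, mul_one, algebraMap_eq] at h1
      rw [C_neg, neg_mul, h1, neg_neg]
  have hr0 : ∀ v, r v ≠ 0 := by
    intro v
    obtain ⟨J, c, hc, h⟩ := hminor v
    rw [h]
    exact mul_ne_zero ((map_ne_zero_iff C (C_injective _ _)).mpr hc) (hne J)
  have hfirst : (L.map fun p => p.1.1.1) = List.ofFn fun t : Fin S.length => (S.get t).1.1 := by
    rw [hL, List.map_ofFn]
    rfl
  have hnodup : (L.map fun p => p.1.1.1).Nodup := by
    rw [hfirst, List.nodup_ofFn]
    let f : Fin S.length → {v : Fin (k + 1) // v ≠ Fin.last k} := fun t =>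
      ⟨(S.get t).1.1, ((S.get t).2.trans_le (Fin.le_last _)).ne⟩
    have hsurj : Function.Surjective f := by
      rintro ⟨v, hv⟩
      have hmem : v ∈ L.map fun p => p.1.1.1 := by
        by_contra h
        exact hr0 v (lastRow_of_notMem L hv h)
      rw [hfirst, List.mem_ofFn] at hmem
      obtain ⟨t, ht⟩ := hmem
      exact ⟨t, Subtype.ext ht⟩
    have hbij := (Fintype.bijective_iff_surjective_and_card f).mpr ⟨hsurj, by
      rw [Fintype.card_fin, hlen', Fintype.card_subtype_compl, Fintype.card_fin]
      simp⟩
    intro t t' h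
    exact hbij.1 (Subtype.ext h)
  have hmul := lastRow_eq_mul L hnodup fun p _ => hr0 _
  refine ⟨hbase, fun t => ?_⟩
  have ht := hmul (S.get t, X t) (by rw [hL, List.mem_ofFn]; exact ⟨t, rfl⟩)
  obtain ⟨J, c, hc, hJ⟩ := hminor (S.get t).1.1
  obtain ⟨J', c', hc', hJ'⟩ := hminor (S.get t).1.2
  refine ⟨J, J', -(c'⁻¹ * c), neg_ne_zero.mpr (mul_ne_zero (inv_ne_zero hc') hc), hne J', ?_⟩
  change r (S.get t).1.1 = -(X t * r (S.get t).1.2) at ht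
  rw [hJ, hJ'] at ht
  have h1 : (C c'⁻¹ * C c' : MvPolynomial (Fin S.length) ℂ) = 1 := by
    rw [← C_mul, inv_mul_cancel₀ hc', C_1]
  rw [C_neg, C_mul, neg_mul, mul_assoc, ht]
  linear_combination -(X t * (N.submatrix J' id).det) * h1

/-- An extension step keeps the first `n` rows of the parametrization and appends a combination of
the rows `i_1, …, i_k` whose coefficients are the new variables. -/
theorem isMinorChart_extendSeq (hkn : k ≤ n) (S : List (PosRoot n)) (i : Fin k → Fin n)
    (hi : Function.Injective i) (hlen : S.length = k * (n - k))
    (hS : IsMinorChart hkn (rootColumns hkn S)) (hkn' : k ≤ n + 1) :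
    IsMinorChart hkn' (rootColumns hkn' (extendSeq i S)) := by
  have hlen' : (extendSeq i S).length = k + S.length := by
    simp [extendSeq]
  let e₁ : Fin k → Fin (extendSeq i S).length := fun l => ⟨l, by rw [hlen']; omega⟩
  let e₂ : Fin S.length → Fin (extendSeq i S).length := fun t => ⟨k + t, by rw [hlen']; omega⟩
  have hlist : (List.ofFn fun t : Fin (extendSeq i S).length =>
      ((extendSeq i S).get t, (X t : MvPolynomial (Fin (extendSeq i S).length) ℂ))) =
      ((List.ofFn fun l : Fin k => (i l, (X (e₁ l) :
        MvPolynomial (Fin (extendSeq i S).length) ℂ))).map fun p =>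
        ((⟨(p.1.castSucc, Fin.last n), Fin.castSucc_lt_last p.1⟩ : PosRoot (n + 1)), p.2)) ++
      (((List.ofFn fun t : Fin S.length =>
        (S.get t, (X t : MvPolynomial (Fin S.length) ℂ))).map fun p =>
          (p.1, rename e₂ p.2)).map fun p => (p.1.lift, p.2)) := by
    refine List.ext_getElem (by simp [hlen']) fun m hm hm' => ?_
    rw [List.getElem_append]
    split_ifs with h
    · have hmk : m < k := by simpa using h
      simp [extendSeq, List.getElem_append, hmk, e₁]
    · have hmk : ¬ m < k := by simpa using h
      have hm2 : m < k + S.length := by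
        rw [List.length_ofFn, hlen'] at hm
        exact hm
      have h3 : k + (m - k) = m := by omega
      simp [extendSeq, List.getElem_append, hmk, e₂]
      refine Eq.trans (congrArg X (Fin.ext h3.symm)) (rename_X _ _).symm
  refine hS.extend (by rw [Fintype.card_fin, hlen]) e₁ e₂ ?_ ?_ i hi ?_ ?_
  · intro t t' h
    have := congrArg Fin.val h
    simp only [e₂] at this
    exact Fin.ext (by omega)
  · intro t
    by_cases h : (t : ℕ) < k
    · exact Or.inl ⟨⟨t, h⟩, rfl⟩
    · refine Or.inr ⟨⟨t - k, ?_⟩, Fin.ext ?_⟩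
      · have := t.2
        omega
      · simp only [e₂]
        omega
  all_goals
    have hcols : ∀ (a : Fin (n + 1)) (j : Fin k), rootColumns hkn' (extendSeq i S) a j =
        (elemProd ((List.ofFn fun l : Fin k => (i l, (X (e₁ l) :
          MvPolynomial (Fin (extendSeq i S).length) ℂ))).map fun p =>
          ((⟨(p.1.castSucc, Fin.last n), Fin.castSucc_lt_last p.1⟩ : PosRoot (n + 1)), p.2)) *
        elemProd (((List.ofFn fun t : Fin S.length =>
          (S.get t, (X t : MvPolynomial (Fin S.length) ℂ))).map fun p =>
            (p.1, rename e₂ p.2)).map fun p => (p.1.lift, p.2))) a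
          (Fin.castLE hkn j).castSucc := by
      intro a j
      rw [← elemProd_append, ← hlist, ← rootProduct_eq]
      rfl
  · intro a j
    rw [hcols, (elemProd_last _ _ _).1, (elemProd_lift _ _).1]
    have := elemProd_map (rename e₂ : MvPolynomial (Fin S.length) ℂ →ₐ[ℂ] _).toRingHom
      (List.ofFn fun t : Fin S.length => (S.get t, (X t : MvPolynomial (Fin S.length) ℂ)))
    rw [rootColumns, rootProduct_eq]
    exact congrFun (congrFun this a) _
  · intro j
    rw [hcols, (elemProd_last _ _ _).2, (elemProd_lift _ _).2, zero_add, List.map_ofFn,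
      List.sum_ofFn]
    refine Finset.sum_congr rfl fun l _ => ?_
    rw [hcols, (elemProd_last _ _ _).1]
    rfl

theorem IsIterated.isMinorChart {S : List (PosRoot n)} (hS : IsIterated k n S) :
    k < n ∧ S.length = k * (n - k) ∧ ∀ hkn : k ≤ n, IsMinorChart hkn (rootColumns hkn S) := by
  induction hS with
  | base S hS => exact ⟨Nat.lt_succ_self k, hS.1, fun _ => isMinorChart_of_isBirational S hS⟩
  | step n S i hi _ ih =>
    obtain ⟨hkn, hlen, hchart⟩ := ih
    refine ⟨hkn.trans (Nat.lt_succ_self n), ?_, fun hkn' =>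
      isMinorChart_extendSeq hkn.le S i hi hlen (hchart hkn.le) hkn'⟩
    have h1 : n + 1 - k = (n - k) + 1 := by omega
    rw [h1, mul_add, mul_one, ← hlen]
    simp [extendSeq, add_comm]

end Iterated

/-! ### Lowest terms -/

section LowestTerm

variable {n : ℕ} (S : List (PosRoot n))

theorem psiKey_injective : Function.Injective (psiKey S) := by
  intro a b h
  have h2 := congrArg (fun z => OrderDual.ofDual (ofLex z).2) h
  exact toLex.injective h2

theorem expoOf_injective : Function.Injective (expoOf S) := by
  intro u v h
  ext t
  exact Int.ofNat_inj.mp (congrFun h t)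

/-- Polynomials as Laurent polynomials with exponents in `ℤ^d`. -/
def toExpo : MvPolynomial (Fin S.length) ℂ →ₐ[ℂ] AddMonoidAlgebra ℂ (Expo S) :=
  aeval fun t => AddMonoidAlgebra.single (Pi.single t (1 : ℤ) : Expo S) (1 : ℂ)

theorem toExpo_monomial (u : Fin S.length →₀ ℕ) (c : ℂ) :
    toExpo S (monomial u c) = AddMonoidAlgebra.single (expoOf S u) c := by
  rw [toExpo, aeval_monomial, Finsupp.prod_fintype _ _ (fun _ => pow_zero _)]
  simp only [AddMonoidAlgebra.single_pow, one_pow, AddMonoidAlgebra.prod_single,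
    Finset.prod_const_one]
  rw [AddMonoidAlgebra.coe_algebraMap, Function.comp_apply, AddMonoidAlgebra.single_mul_single,
    zero_add, Algebra.algebraMap_self, RingHom.id_apply, mul_one]
  congr 1
  funext t
  rw [Finset.sum_apply, Finset.sum_eq_single t]
  · simp [expoOf]
  · intro b _ hb
    simp [Pi.single_eq_of_ne' hb]
  · exact fun h => absurd (Finset.mem_univ t) h

/-- The coefficient of a polynomial at an exponent in `ℤ^d`. -/
def coefAt (a : Expo S) : MvPolynomial (Fin S.length) ℂ →ₗ[ℂ] ℂ where
  toFun g := (toExpo S g).coeff a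
  map_add' f g := by rw [map_add]; rfl
  map_smul' c f := by rw [map_smul]; rfl

theorem coefAt_expoOf (u : Fin S.length →₀ ℕ) (g : MvPolynomial (Fin S.length) ℂ) :
    coefAt S (expoOf S u) g = coeff u g := by
  induction g using MvPolynomial.monomial_add_induction_on with
  | C c =>
    classical
    change (toExpo S (monomial 0 c)).coeff (expoOf S u) = coeff u (monomial 0 c)
    rw [toExpo_monomial, AddMonoidAlgebra.coeff_single, Finsupp.single_apply, coeff_monomial]
    simp only [(expoOf_injective S).eq_iff]
  | monomial_add v c g _ _ ih =>
    classical
    rw [map_add, coeff_add, ih]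
    change (toExpo S (monomial v c)).coeff (expoOf S u) + _ = _
    rw [toExpo_monomial, AddMonoidAlgebra.coeff_single, Finsupp.single_apply, coeff_monomial]
    simp only [(expoOf_injective S).eq_iff]

variable {S}

theorem exists_of_coefAt_ne_zero {a : Expo S} {g : MvPolynomial (Fin S.length) ℂ}
    (h : coefAt S a g ≠ 0) : ∃ u ∈ g.support, expoOf S u = a := by
  by_contra hne
  push Not at hne
  apply h
  rw [g.as_sum, map_sum]
  refine Finset.sum_eq_zero fun u hu => ?_
  change (toExpo S (monomial u _)).coeff a = 0
  rw [toExpo_monomial, AddMonoidAlgebra.coeff_single, Finsupp.single_eq_of_ne]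
  exact (hne u hu).symm

/-- All exponents of `g` are at least `a`. -/
def LowGE (a : Expo S) (g : MvPolynomial (Fin S.length) ℂ) : Prop :=
  ∀ u ∈ g.support, PsiLE S a (expoOf S u)

/-- Coefficients at the lowest exponents are multiplicative. -/
theorem coefAt_mul {a b : Expo S} {f g : MvPolynomial (Fin S.length) ℂ} (hf : LowGE a f)
    (hg : LowGE b g) : coefAt S (a + b) (f * g) = coefAt S a f * coefAt S b g := by
  change (toExpo S (f * g)).coeff (a + b) = (toExpo S f).coeff a * (toExpo S g).coeff b
  rw [map_mul]
  apply AddMonoidAlgebra.coeff_mul_add_of_uniqueAdd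
  intro a' b' ha' hb' hab
  obtain ⟨u, hu, rfl⟩ := exists_of_coefAt_ne_zero (Finsupp.mem_support_iff.mp ha')
  obtain ⟨v, hv, rfl⟩ := exists_of_coefAt_ne_zero (Finsupp.mem_support_iff.mp hb')
  have h1 := (psiLE_iff S _ _).mp (hf u hu)
  have h2 := (psiLE_iff S _ _).mp (hg v hv)
  have h3 := congrArg (psiKey S) hab
  rw [psiKey_add, psiKey_add] at h3
  have h4 := (add_eq_add_iff_eq_and_eq h1 h2).mp h3.symm
  exact ⟨(psiKey_injective S h4.1).symm, (psiKey_injective S h4.2).symm⟩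

theorem coefAt_lowestExpo_ne_zero {f : MvPolynomial (Fin S.length) ℂ} (hf : f ≠ 0) :
    coefAt S (lowestExpo S f) f ≠ 0 := by
  rw [lowestExpo, dif_pos hf, coefAt_expoOf]
  exact mem_support_iff.mp (exists_min_expo S f hf).choose_spec.1

theorem lowGE_lowestExpo (f : MvPolynomial (Fin S.length) ℂ) : LowGE (lowestExpo S f) f :=
  fun u hu => lowestExpo_le S f u hu

theorem lowestExpo_eq {a : Expo S} {f : MvPolynomial (Fin S.length) ℂ} (h : LowGE a f)
    (hne : coefAt S a f ≠ 0) : lowestExpo S f = a := by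
  obtain ⟨u, hu, hua⟩ := exists_of_coefAt_ne_zero hne
  have h1 := (psiLE_iff S _ _).mp (lowestExpo_le S f u hu)
  have hf : f ≠ 0 := by
    rintro rfl
    simp at hu
  obtain ⟨v, hv, hva⟩ := exists_of_coefAt_ne_zero (coefAt_lowestExpo_ne_zero hf)
  have h2 := (psiLE_iff S _ _).mp (h v hv)
  rw [hva] at h2
  rw [hua] at h1
  exact psiKey_injective S (le_antisymm h1 h2)

theorem LowGE.mono {a b : Expo S} {f : MvPolynomial (Fin S.length) ℂ} (h : LowGE b f)
    (hab : psiKey S a ≤ psiKey S b) : LowGE a f := fun u hu =>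
  (psiLE_iff S _ _).mpr (hab.trans ((psiLE_iff S _ _).mp (h u hu)))

theorem LowGE.add {a : Expo S} {f g : MvPolynomial (Fin S.length) ℂ} (hf : LowGE a f)
    (hg : LowGE a g) : LowGE a (f + g) := by
  classical
  intro u hu
  rcases Finset.mem_union.mp (support_add hu) with h | h
  · exact hf u h
  · exact hg u h

theorem LowGE.smul {a : Expo S} {f : MvPolynomial (Fin S.length) ℂ} (c : ℂ) (hf : LowGE a f) :
    LowGE a (c • f) := fun u hu => hf u (support_smul hu)

theorem LowGE.zero (a : Expo S) : LowGE a (0 : MvPolynomial (Fin S.length) ℂ) := by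
  intro u hu
  simp at hu

theorem LowGE.sum {ι : Type} (s : Finset ι) {a : Expo S} {f : ι → MvPolynomial (Fin S.length) ℂ}
    (h : ∀ i ∈ s, LowGE a (f i)) : LowGE a (∑ i ∈ s, f i) :=
  Finset.sum_induction _ (LowGE a) (fun _ _ => LowGE.add) (LowGE.zero a) h

theorem LowGE.mul {a b : Expo S} {f g : MvPolynomial (Fin S.length) ℂ} (hf : LowGE a f)
    (hg : LowGE b g) : LowGE (a + b) (f * g) := by
  intro u hu
  obtain ⟨v, hv, w, hw, h⟩ := support_mul_expo S f g u hu
  rw [h]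
  exact psiLE_add S (hf v hv) (hg w hw)

theorem coefAt_eq_zero_of_lt {a b : Expo S} {f : MvPolynomial (Fin S.length) ℂ} (h : LowGE b f)
    (hab : psiKey S a < psiKey S b) : coefAt S a f = 0 := by
  by_contra hne
  obtain ⟨u, hu, rfl⟩ := exists_of_coefAt_ne_zero hne
  exact absurd ((psiLE_iff S _ _).mp (h u hu)) hab.not_ge

theorem coefAt_zero_one : coefAt S 0 1 = 1 := by
  have : (0 : Expo S) = expoOf S 0 := rfl
  rw [this, coefAt_expoOf, coeff_zero_one]

theorem lowGE_zero_one : LowGE (0 : Expo S) 1 := by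
  intro u hu
  have h0 : u = 0 := by
    by_contra h
    exact mem_support_iff.mp hu (by rw [coeff_one, if_neg (Ne.symm h)])
  rw [h0]
  exact Or.inl rfl

theorem lowestExpo_mul {f g : MvPolynomial (Fin S.length) ℂ} (hf : f ≠ 0) (hg : g ≠ 0) :
    lowestExpo S (f * g) = lowestExpo S f + lowestExpo S g := by
  refine lowestExpo_eq ((lowGE_lowestExpo f).mul (lowGE_lowestExpo g)) ?_
  rw [coefAt_mul (lowGE_lowestExpo f) (lowGE_lowestExpo g)]
  exact mul_ne_zero (coefAt_lowestExpo_ne_zero hf) (coefAt_lowestExpo_ne_zero hg)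

theorem lowestExpo_smul {f : MvPolynomial (Fin S.length) ℂ} {c : ℂ} (hc : c ≠ 0) (hf : f ≠ 0) :
    lowestExpo S (c • f) = lowestExpo S f := by
  refine lowestExpo_eq ((lowGE_lowestExpo f).smul c) ?_
  rw [map_smul]
  exact smul_ne_zero hc (coefAt_lowestExpo_ne_zero hf)

theorem lowestExpo_add {f g : MvPolynomial (Fin S.length) ℂ} (hfg : f + g ≠ 0) :
    PsiLE S (lowestExpo S f) (lowestExpo S (f + g)) ∨
      PsiLE S (lowestExpo S g) (lowestExpo S (f + g)) := by
  classical
  obtain ⟨u, hu, h⟩ := exists_of_coefAt_ne_zero (coefAt_lowestExpo_ne_zero hfg)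
  rw [← h]
  rcases Finset.mem_union.mp (support_add hu) with h | h
  · exact Or.inl (lowestExpo_le S f u h)
  · exact Or.inr (lowestExpo_le S g u h)

theorem lowestExpo_X (t : Fin S.length) : lowestExpo S (X t) = Pi.single t 1 := by
  have h : expoOf S (Finsupp.single t 1) = Pi.single t 1 := by
    funext s
    simp only [expoOf]
    rcases eq_or_ne s t with rfl | hs
    · simp
    · simp [Pi.single_eq_of_ne hs, Finsupp.single_eq_of_ne hs]
  refine lowestExpo_eq (fun u hu => ?_) ?_
  · rw [support_X, Finset.mem_singleton] at hu
    rw [hu, h]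
    exact Or.inl rfl
  · rw [← h, coefAt_expoOf, coeff_X, if_pos rfl]
    exact one_ne_zero

end LowestTerm

/-! ### The valuation -/

section Valuation

variable {k n : ℕ} {hkn : k ≤ n} {S : List (PosRoot n)}

theorem psiStar_eq_zero_iff (hlen : S.length = k * (n - k))
    (hN : IsMinorChart hkn (rootColumns hkn S)) {r : ℕ} {f : PlAlg k n} (hf : f ∈ plDeg k n r) :
    psiStar hkn S f = 0 ↔ f = 0 := by
  refine ⟨fun h => ?_, fun h => by rw [h, map_zero]⟩
  obtain ⟨F, hF, rfl⟩ := hf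
  exact (plMk_eq_zero_iff F).mpr
    (hN.mem_pluckerIdeal (by rw [Fintype.card_fin, hlen]) hF h)

theorem isGradedValuation_vS (hlen : S.length = k * (n - k))
    (hN : IsMinorChart hkn (rootColumns hkn S)) :
    IsGradedValuation S (vS (k := k) hkn S) where
  map_add r f g hf hg _ _ hfg := by
    have h := (psiStar_eq_zero_iff hlen hN (add_mem hf hg)).not.mpr hfg
    rw [map_add] at h
    have := lowestExpo_add h
    rwa [← map_add] at this
  map_mul r s f g hf hg hf0 hg0 := by
    have h1 := (psiStar_eq_zero_iff hlen hN hf).not.mpr hf0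
    have h2 := (psiStar_eq_zero_iff hlen hN hg).not.mpr hg0
    rw [vS, map_mul, lowestExpo_mul h1 h2]
    rfl
  map_smul r c f hf hc hf0 := by
    have h1 := (psiStar_eq_zero_iff hlen hN hf).not.mpr hf0
    rw [vS, map_smul, lowestExpo_smul hc h1]
    rfl

theorem psiStar_pbar_ne_zero (hlen : S.length = k * (n - k))
    (hN : IsMinorChart hkn (rootColumns hkn S)) (J : Idx k n) :
    psiStar hkn S (pbar J) ≠ 0 := by
  rw [psiStar, plEval_pbar]
  exact hN.det_ne_zero (by rw [Fintype.card_fin, hlen]) J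

theorem pbar_ne_zero (J : Idx k n) : pbar J ≠ 0 := fun h =>
  X_notMem_pluckerIdeal J ((plMk_eq_zero_iff _).mp h)

/-- Each unit vector of `ℤ^d` is the difference of the values of two Plücker coordinates. -/
theorem exists_vS_eq_add_single (hlen : S.length = k * (n - k))
    (hN : IsMinorChart hkn (rootColumns hkn S)) (t : Fin S.length) :
    ∃ J J' : Idx k n, vS hkn S (pbar J) = Pi.single t 1 + vS hkn S (pbar J') := by
  obtain ⟨J, J', c, hc, _, h⟩ := hN.ratio t
  refine ⟨J, J', ?_⟩
  have h1 := psiStar_pbar_ne_zero hlen hN J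
  have h2 := psiStar_pbar_ne_zero hlen hN J'
  have h3 : X t * psiStar hkn S (pbar J') = c • psiStar hkn S (pbar J) := by
    rw [psiStar, plEval_pbar, plEval_pbar, smul_eq_C_mul]
    exact h
  rw [vS, ← lowestExpo_smul hc h1, ← h3, lowestExpo_mul (X_ne_zero t) h2, lowestExpo_X]
  rfl

theorem valRank_vS (hlen : S.length = k * (n - k))
    (hN : IsMinorChart hkn (rootColumns hkn S)) :
    valRank S (vS (k := k) hkn S) = k * (n - k) := by
  have hmem : ∀ J : Idx k n, vS hkn S (pbar J) ∈
      Submodule.span ℤ (valueSet S (vS (k := k) hkn S)) := fun J =>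
    Submodule.subset_span ⟨1, pbar J, pbar_mem J, pbar_ne_zero J, rfl⟩
  have htop : Submodule.span ℤ (valueSet S (vS (k := k) hkn S)) = ⊤ := by
    rw [eq_top_iff, ← (Pi.basisFun ℤ (Fin S.length)).span_eq, Submodule.span_le]
    rintro _ ⟨t, rfl⟩
    obtain ⟨J, J', h⟩ := exists_vS_eq_add_single hlen hN t
    rw [Pi.basisFun_apply, SetLike.mem_coe, eq_sub_of_add_eq h.symm]
    exact sub_mem (hmem J) (hmem J')
  rw [valRank, htop, finrank_top, Module.finrank_fin_fun, hlen]

end Valuation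

/-! ### The associated graded algebra as a semigroup algebra -/

section Graded

variable {k n : ℕ} {hkn : k ≤ n} {S : List (PosRoot n)}

theorem mem_filGT_iff_coefAt {q : ℕ × Expo S} {f : PlAlg k n} (hf : f ∈ filGE hkn S q) :
    f ∈ filGT hkn S q ↔ coefAt S q.2 (psiStar hkn S f) = 0 := by
  constructor
  · intro h
    by_contra hne
    obtain ⟨u, hu, hua⟩ := exists_of_coefAt_ne_zero hne
    have := h.2 u hu
    rw [hua, psiLT_iff] at this
    exact lt_irrefl _ this
  · intro h
    refine ⟨hf.1, fun u hu => ?_⟩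
    rcases hf.2 u hu with h1 | h1
    · rw [h1, coefAt_expoOf] at h
      exact absurd h (mem_support_iff.mp hu)
    · exact h1

variable (hkn S) in
/-- The linear map taking `f T^{(r,a)}` to its coefficient at `a`, times `T^{(r,a)}`. -/
def symbolMap : AddMonoidAlgebra (PlAlg k n) (ℕ × Expo S) →ₗ[ℂ]
    AddMonoidAlgebra ℂ (ℕ × Expo S) where
  toFun x := AddMonoidAlgebra.ofCoeff (Finsupp.onFinset x.coeff.support
    (fun q => coefAt S q.2 (psiStar hkn S (x.coeff q))) fun q hq => by
      rw [Finsupp.mem_support_iff]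
      intro h
      rw [h, map_zero, map_zero] at hq
      exact hq rfl)
  map_add' x y := by
    ext q
    change coefAt S q.2 (psiStar hkn S (x.coeff q + y.coeff q)) = _
    rw [map_add, map_add]
    rfl
  map_smul' c x := by
    ext q
    change coefAt S q.2 (psiStar hkn S (c • x.coeff q)) = _
    rw [map_smul, map_smul]
    rfl

theorem coeff_symbolMap (x : AddMonoidAlgebra (PlAlg k n) (ℕ × Expo S)) (q : ℕ × Expo S) :
    (symbolMap hkn S x).coeff q = coefAt S q.2 (psiStar hkn S (x.coeff q)) := rfl

theorem symbolMap_single (q : ℕ × Expo S) (f : PlAlg k n) :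
    symbolMap hkn S (AddMonoidAlgebra.single q f) =
      AddMonoidAlgebra.single q (coefAt S q.2 (psiStar hkn S f)) := by
  classical
  ext q'
  rw [coeff_symbolMap, AddMonoidAlgebra.coeff_single, AddMonoidAlgebra.coeff_single,
    Finsupp.single_apply, Finsupp.single_apply]
  split_ifs with h
  · rw [h]
  · rw [map_zero, map_zero]

theorem symbolMap_mul {x y : AddMonoidAlgebra (PlAlg k n) (ℕ × Expo S)}
    (hx : x ∈ reesAlg hkn S) (hy : y ∈ reesAlg hkn S) :
    symbolMap hkn S (x * y) = symbolMap hkn S x * symbolMap hkn S y := by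
  have hsum : ∀ z : AddMonoidAlgebra (PlAlg k n) (ℕ × Expo S),
      z = ∑ q ∈ z.coeff.support, AddMonoidAlgebra.single q (z.coeff q) := fun z =>
    (AddMonoidAlgebra.sum_coeff_single z).symm
  rw [hsum x, hsum y, Finset.sum_mul_sum, map_sum, map_sum, map_sum, Finset.sum_mul_sum]
  refine Finset.sum_congr rfl fun q _ => ?_
  rw [map_sum]
  refine Finset.sum_congr rfl fun q' _ => ?_
  rw [AddMonoidAlgebra.single_mul_single, symbolMap_single, symbolMap_single, symbolMap_single,
    AddMonoidAlgebra.single_mul_single, map_mul]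
  exact congrArg _ (coefAt_mul (hx q).2 (hy q').2)

variable (hkn S) in
/-- `symbolMap` as a homomorphism on the Rees algebra. -/
def reesHom : reesAlg (k := k) hkn S →ₐ[ℂ] AddMonoidAlgebra ℂ (ℕ × Expo S) :=
  AlgHom.ofLinearMap ((symbolMap hkn S).comp (reesAlg hkn S).val.toLinearMap)
    (by
      change symbolMap hkn S (AddMonoidAlgebra.single 0 1) = _
      rw [symbolMap_single, map_one]
      exact congrArg _ coefAt_zero_one)
    fun x y => symbolMap_mul x.2 y.2

theorem reesHom_eq_zero_iff (x : reesAlg (k := k) hkn S) :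
    reesHom hkn S x = 0 ↔ x ∈ reesIdeal hkn S := by
  change symbolMap hkn S x.1 = 0 ↔ ∀ q, x.1.coeff q ∈ filGT hkn S q
  rw [← AddMonoidAlgebra.coeff_eq_zero, Finsupp.ext_iff]
  exact forall_congr' fun q => (mem_filGT_iff_coefAt (x.2 q)).symm

variable (hkn S) in
/-- The embedding of `gr_S(A_{k,n})` into Laurent polynomials that takes the class of `f` in
bidegree `q` to the coefficient of `ψ_S^*(f)` in that bidegree. -/
def grEmb : grS (k := k) hkn S →ₐ[ℂ] AddMonoidAlgebra ℂ (ℕ × Expo S) :=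
  Ideal.Quotient.liftₐ (reesIdeal hkn S) (reesHom hkn S) fun x hx =>
    (reesHom_eq_zero_iff x).mpr hx

theorem grEmb_injective : Function.Injective (grEmb (k := k) hkn S) := by
  rw [injective_iff_map_eq_zero]
  intro z hz
  obtain ⟨x, rfl⟩ := Ideal.Quotient.mk_surjective z
  exact Ideal.Quotient.eq_zero_iff_mem.mpr ((reesHom_eq_zero_iff x).mp hz)

theorem grEmb_toGr (q : ℕ × Expo S) (f : filGE (k := k) hkn S q) :
    grEmb hkn S (toGr hkn S q f) =
      AddMonoidAlgebra.single q (coefAt S q.2 (psiStar hkn S f.1)) :=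
  symbolMap_single q f.1

theorem mem_valueSemigroup_iff (hlen : S.length = k * (n - k))
    (hN : IsMinorChart hkn (rootColumns hkn S)) (q : ℕ × Expo S) :
    q ∈ valueSemigroup (k := k) hkn S ↔ ∃ f ∈ plDeg k n q.1, f ≠ 0 ∧ vS hkn S f = q.2 := by
  refine ⟨fun h => ?_, fun h => AddSubmonoid.subset_closure h⟩
  induction h using AddSubmonoid.closure_induction with
  | mem q hq => exact hq
  | zero =>
    refine ⟨1, ⟨1, isHomogeneous_one _ _, map_one (plMk k n)⟩, one_ne_zero, ?_⟩
    rw [vS, map_one]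
    refine lowestExpo_eq lowGE_zero_one ?_
    change coefAt S 0 1 ≠ 0
    rw [coefAt_zero_one]
    exact one_ne_zero
  | add q q' _ _ ih ih' =>
    obtain ⟨f, hf, hf0, hfq⟩ := ih
    obtain ⟨g, hg, hg0, hgq⟩ := ih'
    refine ⟨f * g, plDeg_mul hf hg, mul_ne_zero hf0 hg0, ?_⟩
    rw [(isGradedValuation_vS hlen hN).map_mul _ _ f g hf hg hf0 hg0, hfq, hgq]
    rfl

/-- The multiple of the symbol of an element of value `q` that `grEmb` sends to the basis
element. -/
theorem exists_grPiece_grEmb_eq (hlen : S.length = k * (n - k))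
    (hN : IsMinorChart hkn (rootColumns hkn S)) {q : ℕ × Expo S}
    (hq : q ∈ valueSemigroup (k := k) hkn S) :
    ∃ z ∈ grPiece (k := k) hkn S q, grEmb hkn S z = AddMonoidAlgebra.single q 1 := by
  obtain ⟨f, hf, hf0, hfq⟩ := (mem_valueSemigroup_iff hlen hN q).mp hq
  have hpsi := (psiStar_eq_zero_iff hlen hN hf).not.mpr hf0
  have hne := coefAt_lowestExpo_ne_zero hpsi
  have hmem : f ∈ filGE hkn S q := ⟨hf, by rw [← hfq]; exact lowGE_lowestExpo _⟩
  refine ⟨(coefAt S q.2 (psiStar hkn S f))⁻¹ • toGr hkn S q ⟨f, hmem⟩,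
    Submodule.smul_mem _ _ ⟨_, rfl⟩, ?_⟩
  rw [map_smul, grEmb_toGr, AddMonoidAlgebra.smul_single, smul_eq_mul, inv_mul_cancel₀]
  rw [← hfq]
  exact hne

theorem range_grEmb (hlen : S.length = k * (n - k))
    (hN : IsMinorChart hkn (rootColumns hkn S)) :
    (grEmb (k := k) hkn S).range =
      (AddMonoidAlgebra.mapDomainAlgHom ℂ ℂ (valueSemigroup (k := k) hkn S).subtype).range := by
  apply le_antisymm
  · rintro _ ⟨z, rfl⟩
    obtain ⟨x, rfl⟩ := Ideal.Quotient.mk_surjective z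
    change symbolMap hkn S x.1 ∈ _
    rw [← AddMonoidAlgebra.sum_coeff_single (symbolMap hkn S x.1)]
    refine sum_mem fun q hq => ?_
    have hne := Finsupp.mem_support_iff.mp hq
    rw [coeff_symbolMap] at hne
    have hqS : q ∈ valueSemigroup (k := k) hkn S := by
      refine AddSubmonoid.subset_closure ⟨x.1.coeff q, (x.2 q).1, ?_, ?_⟩
      · intro h
        rw [h, map_zero, map_zero] at hne
        exact hne rfl
      · exact lowestExpo_eq (x.2 q).2 hne
    exact ⟨AddMonoidAlgebra.single ⟨q, hqS⟩ _, AddMonoidAlgebra.mapDomain_single⟩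
  · rintro _ ⟨z, rfl⟩
    induction z using AddMonoidAlgebra.induction_linear with
    | zero => exact zero_mem _
    | add x y hx hy =>
      rw [RingHom.map_add]
      exact add_mem hx hy
    | single q c =>
      obtain ⟨z, _, hz⟩ := exists_grPiece_grEmb_eq hlen hN q.2
      refine ⟨c • z, ?_⟩
      change grEmb hkn S (c • z) = AddMonoidAlgebra.mapDomain _ _
      rw [map_smul, hz, AddMonoidAlgebra.mapDomain_single, AddMonoidAlgebra.smul_single,
        smul_eq_mul, mul_one]
      rfl

/-- `gr_S(A_{k,n})` is the algebra of the value semigroup. -/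
theorem exists_algEquiv_grS (hlen : S.length = k * (n - k))
    (hN : IsMinorChart hkn (rootColumns hkn S)) :
    ∃ φ : AddMonoidAlgebra ℂ (valueSemigroup (k := k) hkn S) ≃ₐ[ℂ] grS (k := k) hkn S,
      ∀ q, φ (AddMonoidAlgebra.single q 1) ∈ grPiece hkn S q.1 := by
  have hinj : Function.Injective
      (AddMonoidAlgebra.mapDomainAlgHom ℂ ℂ (valueSemigroup (k := k) hkn S).subtype) :=
    AddMonoidAlgebra.mapDomain_injective Subtype.val_injective
  let φ := ((AlgEquiv.ofInjective _ hinj).trans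
    (Subalgebra.equivOfEq _ _ (range_grEmb hlen hN).symm)).trans
      (AlgEquiv.ofInjective _ (grEmb_injective (k := k) (hkn := hkn) (S := S))).symm
  have hφ : ∀ x, grEmb hkn S (φ x) =
      AddMonoidAlgebra.mapDomainAlgHom ℂ ℂ (valueSemigroup (k := k) hkn S).subtype x := by
    intro x
    have h := AlgEquiv.apply_symm_apply
      (AlgEquiv.ofInjective _ (grEmb_injective (k := k) (hkn := hkn) (S := S)))
      (((AlgEquiv.ofInjective _ hinj).trans
        (Subalgebra.equivOfEq _ _ (range_grEmb hlen hN).symm)) x)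
    exact congrArg Subtype.val h
  refine ⟨φ, fun q => ?_⟩
  obtain ⟨z, hz, hzq⟩ := exists_grPiece_grEmb_eq hlen hN q.2
  have : φ (AddMonoidAlgebra.single q 1) = z := by
    apply grEmb_injective
    rw [hφ, hzq]
    exact AddMonoidAlgebra.mapDomain_single
  rw [this]
  exact hz

end Graded

/-! ### The initial ideal of the Plücker ideal -/

section PluckerInit

variable {k n : ℕ}

/-- `psiKey` as a homomorphism. -/
def psiKeyHom {n : ℕ} (S : List (PosRoot n)) : Expo S →+ ℤ ×ₗ (Lex (Fin S.length → ℤ))ᵒᵈ where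
  toFun := psiKey S
  map_zero' := by
    have h := psiKey_add S 0 0
    rw [add_zero] at h
    exact add_eq_left.mp h.symm
  map_add' := psiKey_add S

/-- The value `M_S u` of the monomial `p^u` in the Plücker coordinates. -/
def plValue (hkn : k ≤ n) (S : List (PosRoot n)) (u : Idx k n →₀ ℕ) : Expo S :=
  Finsupp.weight (fun J => vS hkn S (pbar J)) u

/-- The values of the Plücker coordinates in the ordered group containing `(ℤ^d, ≺_Ψ)`. -/
def keyWeight (hkn : k ≤ n) (S : List (PosRoot n)) (J : Idx k n) :
    ℤ ×ₗ (Lex (Fin S.length → ℤ))ᵒᵈ :=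
  psiKey S (vS hkn S (pbar J))

variable {hkn : k ≤ n} {S : List (PosRoot n)}

theorem weight_keyWeight (u : Idx k n →₀ ℕ) :
    Finsupp.weight (keyWeight hkn S) u = psiKey S (plValue hkn S u) :=
  weight_comp (psiKeyHom S) (fun J => vS hkn S (pbar J)) u

theorem plValue_add (u v : Idx k n →₀ ℕ) :
    plValue hkn S (u + v) = plValue hkn S u + plValue hkn S v := map_add _ u v

theorem plValue_single (J : Idx k n) (m : ℕ) :
    plValue hkn S (Finsupp.single J m) = m • vS hkn S (pbar J) := by
  rw [plValue, Finsupp.weight_single]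

variable (hkn S) in
theorem initIdealMat_weightMatrix (I : Ideal (MvPolynomial (Idx k n) ℂ)) :
    initIdealMat S (weightMatrix hkn S) I = wInit (keyWeight hkn S) I := by
  have h : ∀ u : Idx k n →₀ ℕ, (weightMatrix hkn S).mulVec (fun J => (u J : ℤ)) =
      plValue hkn S u := by
    intro u
    funext t
    rw [plValue, Finsupp.weight_apply, Finsupp.sum_fintype]
    swap
    · exact fun _ => zero_smul _ _
    rw [Finset.sum_apply]
    refine Finset.sum_congr rfl fun J _ => ?_
    rw [Pi.smul_apply, nsmul_eq_mul, mul_comm]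
    rfl
  unfold initIdealMat wInit
  simp only [h, psiLE_iff, weight_keyWeight]

variable (hkn S) in
/-- The homomorphism from polynomials in the Plücker coordinates to `gr_S(A_{k,n})` that takes
each coordinate to its class. -/
def symbolHom : MvPolynomial (Idx k n) ℂ →ₐ[ℂ] grS (k := k) hkn S :=
  aeval fun J => symbol hkn S 1 (pbar J) (pbar_mem J)

theorem grEmb_symbolHom_X (J : Idx k n) :
    grEmb hkn S (symbolHom hkn S (X J)) = AddMonoidAlgebra.single (1, vS hkn S (pbar J))
      (coefAt S (vS hkn S (pbar J)) (psiStar hkn S (pbar J))) := by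
  rw [symbolHom, aeval_X]
  exact grEmb_toGr _ _

/-- The polynomial `F` in the Plücker coordinates represents an element of value `q.2` whose class
in bidegree `q` is the image of `F` in `gr_S(A_{k,n})`. -/
structure HasSymbol (hkn : k ≤ n) (S : List (PosRoot n)) (F : MvPolynomial (Idx k n) ℂ)
    (q : ℕ × Expo S) : Prop where
  lowGE : LowGE q.2 (psiStar hkn S (plMk k n F))
  coefAt_ne_zero : coefAt S q.2 (psiStar hkn S (plMk k n F)) ≠ 0
  grEmb_eq : grEmb hkn S (symbolHom hkn S F) =
    AddMonoidAlgebra.single q (coefAt S q.2 (psiStar hkn S (plMk k n F)))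

theorem HasSymbol.one : HasSymbol hkn S 1 0 := by
  have h : psiStar hkn S (plMk k n 1) = 1 := by rw [map_one, map_one]
  have h1 : coefAt S (0 : ℕ × Expo S).2 1 = 1 := coefAt_zero_one
  refine ⟨?_, ?_, ?_⟩
  · rw [h]
    exact lowGE_zero_one
  · rw [h, h1]
    exact one_ne_zero
  · rw [h, h1, map_one, map_one]
    rfl

theorem HasSymbol.mul {F G : MvPolynomial (Idx k n) ℂ} {q q' : ℕ × Expo S}
    (hF : HasSymbol hkn S F q) (hG : HasSymbol hkn S G q') :
    HasSymbol hkn S (F * G) (q + q') := by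
  have h : psiStar hkn S (plMk k n (F * G)) =
      psiStar hkn S (plMk k n F) * psiStar hkn S (plMk k n G) := by rw [map_mul, map_mul]
  have h1 : coefAt S (q + q').2 (psiStar hkn S (plMk k n (F * G))) =
      coefAt S q.2 (psiStar hkn S (plMk k n F)) * coefAt S q'.2 (psiStar hkn S (plMk k n G)) := by
    rw [h]
    exact coefAt_mul hF.lowGE hG.lowGE
  refine ⟨?_, ?_, ?_⟩
  · rw [h]
    exact hF.lowGE.mul hG.lowGE
  · rw [h1]
    exact mul_ne_zero hF.coefAt_ne_zero hG.coefAt_ne_zero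
  · rw [h1, map_mul, map_mul, hF.grEmb_eq, hG.grEmb_eq, AddMonoidAlgebra.single_mul_single]

theorem hasSymbol_X (hlen : S.length = k * (n - k))
    (hN : IsMinorChart hkn (rootColumns hkn S)) (J : Idx k n) :
    HasSymbol hkn S (X J) (1, vS hkn S (pbar J)) :=
  ⟨lowGE_lowestExpo _, coefAt_lowestExpo_ne_zero (psiStar_pbar_ne_zero hlen hN J),
    grEmb_symbolHom_X J⟩

theorem hasSymbol_monomial (hlen : S.length = k * (n - k))
    (hN : IsMinorChart hkn (rootColumns hkn S)) (u : Idx k n →₀ ℕ) :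
    HasSymbol hkn S (monomial u 1) (u.degree, plValue hkn S u) := by
  have hadd : ∀ u v : Idx k n →₀ ℕ, HasSymbol hkn S (monomial u 1) (u.degree, plValue hkn S u) →
      HasSymbol hkn S (monomial v 1) (v.degree, plValue hkn S v) →
      HasSymbol hkn S (monomial (u + v) 1) ((u + v).degree, plValue hkn S (u + v)) := by
    intro u v hu hv
    have := hu.mul hv
    rwa [monomial_mul, one_mul, Prod.mk_add_mk, ← map_add, ← plValue_add] at this
  have hzero : HasSymbol hkn S (monomial (0 : Idx k n →₀ ℕ) 1)
      ((0 : Idx k n →₀ ℕ).degree, plValue hkn S (0 : Idx k n →₀ ℕ)) := by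
    have h : ((0 : Idx k n →₀ ℕ).degree, plValue hkn S (0 : Idx k n →₀ ℕ)) = 0 :=
      Prod.ext (map_zero _) (map_zero _)
    rw [h]
    exact HasSymbol.one
  induction u using Finsupp.induction_linear with
  | zero => exact hzero
  | add u v hu hv => exact hadd u v hu hv
  | single J m =>
    induction m with
    | zero =>
      rw [Finsupp.single_zero]
      exact hzero
    | succ m ih =>
      rw [Finsupp.single_add]
      refine hadd _ _ ih ?_
      rw [plValue_single, one_smul, Finsupp.degree_single]
      exact hasSymbol_X hlen hN J

theorem symbolHom_monomial_ne_zero (hlen : S.length = k * (n - k))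
    (hN : IsMinorChart hkn (rootColumns hkn S)) (u : Idx k n →₀ ℕ) :
    symbolHom hkn S (monomial u 1) ≠ 0 := by
  intro h
  have h2 := hasSymbol_monomial hlen hN u
  have h3 := h2.grEmb_eq
  rw [h, map_zero] at h3
  exact h2.coefAt_ne_zero (AddMonoidAlgebra.single_eq_zero.mp h3.symm)

theorem monomial_eq_smul {σ : Type} (u : σ →₀ ℕ) (c : ℂ) :
    (monomial u c : MvPolynomial σ ℂ) = c • monomial u 1 := by
  rw [smul_monomial, smul_eq_mul, mul_one]

/-- The coefficient in bidegree `(s, a)` of the image of a polynomial only depends on its terms of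
weight `a`. -/
theorem coeff_grEmb_symbolHom_component (hlen : S.length = k * (n - k))
    (hN : IsMinorChart hkn (rootColumns hkn S)) (s : ℕ) (a : Expo S)
    (F : MvPolynomial (Idx k n) ℂ) :
    (grEmb hkn S (symbolHom hkn S
      (weightedHomogeneousComponent (keyWeight hkn S) (psiKey S a) F))).coeff (s, a) =
      (grEmb hkn S (symbolHom hkn S F)).coeff (s, a) := by
  classical
  conv_rhs => rw [F.as_sum]
  conv_lhs => rw [F.as_sum]
  simp only [map_sum, AddMonoidAlgebra.coeff_sum, Finsupp.finsetSum_apply]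
  refine Finset.sum_congr rfl fun u _ => ?_
  by_cases h : Finsupp.weight (keyWeight hkn S) u = psiKey S a
  · rw [weightedHomogeneousComponent_of_mem
      (isWeightedHomogeneous_monomial _ u _ h), if_pos rfl]
  · rw [weightedHomogeneousComponent_of_mem
      (isWeightedHomogeneous_monomial _ u _ rfl), if_neg (Ne.symm h), map_zero, map_zero,
      monomial_eq_smul, map_smul, map_smul, (hasSymbol_monomial hlen hN u).grEmb_eq,
      AddMonoidAlgebra.coeff_smul_apply, AddMonoidAlgebra.coeff_single, Finsupp.single_eq_of_ne, smul_zero]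
    · rfl
    · intro h2
      rw [weight_keyWeight] at h
      exact h (congrArg (psiKey S) (Prod.ext_iff.mp h2).2.symm)

theorem coeff_grEmb_symbolHom_eq_zero (hlen : S.length = k * (n - k))
    (hN : IsMinorChart hkn (rootColumns hkn S)) {F : MvPolynomial (Idx k n) ℂ} {r s : ℕ}
    (hF : F.IsHomogeneous r) (hs : s ≠ r) (a : Expo S) :
    (grEmb hkn S (symbolHom hkn S F)).coeff (s, a) = 0 := by
  classical
  rw [F.as_sum]
  simp only [map_sum, AddMonoidAlgebra.coeff_sum, Finsupp.finsetSum_apply]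
  refine Finset.sum_eq_zero fun u hu => ?_
  rw [monomial_eq_smul, map_smul, map_smul, (hasSymbol_monomial hlen hN u).grEmb_eq,
    AddMonoidAlgebra.coeff_smul_apply, AddMonoidAlgebra.coeff_single, Finsupp.single_eq_of_ne,
    smul_zero]
  intro h2
  have hdeg : u.degree = r := by
    by_contra h
    exact mem_support_iff.mp hu (hF.coeff_eq_zero h)
  exact hs ((Prod.ext_iff.mp h2).1.trans hdeg)

/-- For a form without terms of weight below `a`, the part of value `a` of its image in
`gr_S(A_{k,n})` is the part of value `a` of the element it represents. -/
theorem coeff_grEmb_symbolHom (hlen : S.length = k * (n - k))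
    (hN : IsMinorChart hkn (rootColumns hkn S)) {F : MvPolynomial (Idx k n) ℂ} {r : ℕ}
    {a : Expo S} (hF : F.IsHomogeneous r) (hw : WeightGE (keyWeight hkn S) (psiKey S a) F) :
    LowGE a (psiStar hkn S (plMk k n F)) ∧
    (grEmb hkn S (symbolHom hkn S F)).coeff (r, a) = coefAt S a (psiStar hkn S (plMk k n F)) := by
  classical
  rw [F.as_sum]
  simp only [map_sum, AddMonoidAlgebra.coeff_sum, Finsupp.finsetSum_apply]
  have hle : ∀ u ∈ F.support, psiKey S a ≤ psiKey S (plValue hkn S u) := by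
    intro u hu
    rw [← weight_keyWeight]
    exact hw u hu
  constructor
  · refine LowGE.sum _ fun u hu => ?_
    rw [monomial_eq_smul, map_smul, map_smul]
    exact ((hasSymbol_monomial hlen hN u).lowGE.mono (hle u hu)).smul _
  · refine Finset.sum_congr rfl fun u hu => ?_
    have hu' := hasSymbol_monomial hlen hN u
    rw [monomial_eq_smul, map_smul, map_smul, map_smul, map_smul, map_smul, hu'.grEmb_eq,
      AddMonoidAlgebra.coeff_smul_apply, AddMonoidAlgebra.coeff_single, Finsupp.single_apply]
    have hdeg : u.degree = r := by
      by_contra h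
      exact mem_support_iff.mp hu (hF.coeff_eq_zero h)
    by_cases hva : plValue hkn S u = a
    · rw [if_pos (by rw [hdeg, hva]), hva]
    · rw [if_neg fun h => hva (Prod.ext_iff.mp h).2, coefAt_eq_zero_of_lt hu'.lowGE]
      exact lt_of_le_of_ne (hle u hu) fun h => hva (psiKey_injective S h).symm

/-- The initial forms of the Plücker relations are relations between the symbols of the Plücker
coordinates. -/
theorem wInit_le_ker_symbolHom (hk : 1 ≤ k) (hlen : S.length = k * (n - k))
    (hN : IsMinorChart hkn (rootColumns hkn S)) :
    wInit (keyWeight hkn S) (pluckerIdeal k n) ≤ RingHom.ker (symbolHom (k := k) hkn S) := by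
  have hI := isGradedIdeal_pluckerIdeal (n := n) hk
  have hhom : ∀ x ∈ wInit (keyWeight hkn S) (pluckerIdeal k n), ∀ r, x.IsHomogeneous r →
      symbolHom hkn S x = 0 := by
    intro x hx r hr
    apply grEmb_injective
    rw [map_zero]
    ext ⟨s, a⟩
    change _ = (0 : ℂ)
    by_cases hs : s = r
    · subst hs
      obtain ⟨f, hf, hfw, hfx⟩ := exists_lift_of_mem_wInit hI hx hr (psiKey S a)
      rw [← coeff_grEmb_symbolHom_component hlen hN, ← hfx,
        coeff_grEmb_symbolHom_component hlen hN, (coeff_grEmb_symbolHom hlen hN hf.2 hfw).2,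
        (plMk_eq_zero_iff f).mpr hf.1, map_zero, map_zero]
    · exact coeff_grEmb_symbolHom_eq_zero hlen hN hr hs a
  intro x hx
  rw [RingHom.mem_ker, ← sum_homogeneousComponent x, map_sum]
  exact Finset.sum_eq_zero fun r _ => hhom _ (isGradedIdeal_wInit _ hI x hx r) r
    (homogeneousComponent_isHomogeneous r x)

theorem monomial_notMem_wInit (hk : 1 ≤ k) (hlen : S.length = k * (n - k))
    (hN : IsMinorChart hkn (rootColumns hkn S)) (u : Idx k n →₀ ℕ) :
    monomial u (1 : ℂ) ∉ wInit (keyWeight hkn S) (pluckerIdeal k n) := fun h =>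
  symbolHom_monomial_ne_zero hlen hN u (wInit_le_ker_symbolHom hk hlen hN h)

theorem exists_tropCone_pluckerIdeal (hk : 1 ≤ k) (hlen : S.length = k * (n - k))
    (hN : IsMinorChart hkn (rootColumns hkn S)) :
    ∃ C : Set (Idx k n → ℝ), IsTropCone (pluckerIdeal k n) C ∧ C ⊆ tropGr k n ∧
      ConeInit (pluckerIdeal k n) C (wInit (keyWeight hkn S) (pluckerIdeal k n)) := by
  have hI := isGradedIdeal_pluckerIdeal (n := n) hk
  obtain ⟨m, hm⟩ := exists_nonpos_wInit_eq (keyWeight hkn S) hI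
  have h := monomial_notMem_wInit hk hlen hN
  rw [← hm, ← wInit_intCast] at h ⊢
  exact exists_tropCone hI h

end PluckerInit

/-! ### Prime initial ideals and Hilbert functions -/

section Hilbert

variable {k n : ℕ} {hkn : k ≤ n} {S : List (PosRoot n)}

theorem finrank_map_homogeneousSubmodule_add {σ Q : Type} [Finite σ] [AddCommGroup Q] [Module ℂ Q]
    (φ : MvPolynomial σ ℂ →ₗ[ℂ] Q) (r : ℕ) :
    Module.finrank ℂ ((homogeneousSubmodule σ ℂ r).map φ) +
      Module.finrank ℂ ↥(homogeneousSubmodule σ ℂ r ⊓ LinearMap.ker φ) =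
      Module.finrank ℂ (homogeneousSubmodule σ ℂ r) := by
  have h := LinearMap.finrank_range_add_finrank_ker (φ.domRestrict (homogeneousSubmodule σ ℂ r))
  rw [LinearMap.range_domRestrict, LinearMap.ker_domRestrict,
    (Submodule.equivSubtypeMap _ _).finrank_eq, Submodule.map_comap_subtype] at h
  exact h

/-- The Hilbert function of `A_{k,n}` is bounded by the number of monomials in a box. -/
theorem exists_finrank_map_psiStar_le (hkn : k ≤ n) (S : List (PosRoot n)) :
    ∃ D : ℕ, ∀ r, Module.finrank ℂ ((homogeneousSubmodule (Idx k n) ℂ r).map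
      ((psiStar hkn S).comp (plMk k n)).toLinearMap) ≤ (r * D + 1) ^ S.length := by
  classical
  refine ⟨∑ J : Idx k n, (psiStar hkn S (pbar J)).totalDegree, fun r => ?_⟩
  set D := ∑ J : Idx k n, (psiStar hkn S (pbar J)).totalDegree with hD
  have hle : (homogeneousSubmodule (Idx k n) ℂ r).map
      ((psiStar hkn S).comp (plMk k n)).toLinearMap ≤ restrictDegree (Fin S.length) ℂ (r * D) := by
    rintro _ ⟨F, hF, rfl⟩
    change psiStar hkn S (plMk k n F) ∈ _
    rw [F.as_sum, map_sum, map_sum]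
    refine Submodule.sum_mem _ fun u hu => ?_
    have hdeg : u.degree = r := by
      by_contra h
      exact mem_support_iff.mp hu (IsHomogeneous.coeff_eq_zero hF h)
    rw [monomial_eq_smul, map_smul, map_smul]
    refine Submodule.smul_mem _ _ ?_
    rw [mem_restrictDegree]
    intro s hs t
    have h1 : psiStar hkn S (plMk k n (monomial u 1)) =
        u.prod fun J e => psiStar hkn S (pbar J) ^ e := by
      rw [monomial_eq, C_1, one_mul, Finsupp.prod, map_prod, map_prod]
      simp only [map_pow]
      rfl
    have h2 := degreeOf_le_totalDegree (psiStar hkn S (plMk k n (monomial u 1))) t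
    refine (degreeOf_le_iff.mp le_rfl s hs).trans (h2.trans ?_)
    rw [h1]
    refine (totalDegree_finsetProd _ _).trans ?_
    rw [← hdeg, Finsupp.degree_apply, Finset.sum_mul]
    refine Finset.sum_le_sum fun J _ => (totalDegree_pow _ _).trans ?_
    refine Nat.mul_le_mul_left _ ?_
    exact Finset.single_le_sum (f := fun J => (psiStar hkn S (pbar J)).totalDegree)
      (fun _ _ => Nat.zero_le _) (Finset.mem_univ J)
  have e : {s : Fin S.length →₀ ℕ | ∀ i, s i ≤ r * D} ≃ (Fin S.length → Fin (r * D + 1)) :=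
    { toFun := fun s t => ⟨s.1 t, Nat.lt_succ_of_le (s.2 t)⟩
      invFun := fun a => ⟨Finsupp.equivFunOnFinite.symm fun t => (a t : ℕ),
        fun t => Nat.le_of_lt_succ (a t).2⟩
      left_inv := fun s => Subtype.ext (Finsupp.ext fun t => rfl)
      right_inv := fun a => funext fun t => Fin.ext rfl }
  have : Finite {s : Fin S.length →₀ ℕ | ∀ i, s i ≤ r * D} := Finite.of_equiv _ e.symm
  let b := basisRestrictSupport ℂ {s : Fin S.length →₀ ℕ | ∀ i, s i ≤ r * D}
  have hfin : Module.Finite ℂ (restrictDegree (Fin S.length) ℂ (r * D)) := Module.Finite.of_basis b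
  refine (Submodule.finrank_mono hle).trans (le_of_eq ?_)
  have h3 := Module.finrank_eq_nat_card_basis b
  rw [Nat.card_congr e, Nat.card_eq_fintype_card, Fintype.card_fun, Fintype.card_fin,
    Fintype.card_fin] at h3
  exact h3

/-- `A_{k,n}` and the quotient by the initial ideal have the same Hilbert function. -/
theorem finrank_map_mk_wInit (hk : 1 ≤ k) (hlen : S.length = k * (n - k))
    (hN : IsMinorChart hkn (rootColumns hkn S)) (r : ℕ) :
    Module.finrank ℂ ((homogeneousSubmodule (Idx k n) ℂ r).map
      (Ideal.Quotient.mkₐ ℂ (wInit (keyWeight hkn S) (pluckerIdeal k n))).toLinearMap) =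
    Module.finrank ℂ ((homogeneousSubmodule (Idx k n) ℂ r).map
      ((psiStar hkn S).comp (plMk k n)).toLinearMap) := by
  have hI := isGradedIdeal_pluckerIdeal (n := n) hk
  have h1 := finrank_map_homogeneousSubmodule_add
    (Ideal.Quotient.mkₐ ℂ (wInit (keyWeight hkn S) (pluckerIdeal k n))).toLinearMap r
  have h2 := finrank_map_homogeneousSubmodule_add
    ((psiStar hkn S).comp (plMk k n)).toLinearMap r
  have e1 : homogeneousSubmodule (Idx k n) ℂ r ⊓ LinearMap.ker
      (Ideal.Quotient.mkₐ ℂ (wInit (keyWeight hkn S) (pluckerIdeal k n))).toLinearMap =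
      degPart (wInit (keyWeight hkn S) (pluckerIdeal k n)) r := by
    ext F
    rw [mem_degPart, and_comm, Submodule.mem_inf]
    refine and_congr_right' ?_
    exact Ideal.Quotient.eq_zero_iff_mem
  have e2 : homogeneousSubmodule (Idx k n) ℂ r ⊓ LinearMap.ker
      ((psiStar hkn S).comp (plMk k n)).toLinearMap = degPart (pluckerIdeal k n) r := by
    ext F
    rw [mem_degPart, and_comm, Submodule.mem_inf]
    refine and_congr_right fun hF => ?_
    rw [← plMk_eq_zero_iff]
    exact psiStar_eq_zero_iff hlen hN ⟨F, hF, rfl⟩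
  rw [e1, finrank_degPart_wInit _ hI] at h1
  rw [e2] at h2
  omega

/-- The exponents of monomials of a common degree whose values differ by arbitrary vectors in a
box. -/
theorem exists_expo_box (hlen : S.length = k * (n - k))
    (hN : IsMinorChart hkn (rootColumns hkn S)) (m : ℕ) :
    ∃ (u : (Fin S.length → Fin (m + 1)) → (Idx k n →₀ ℕ)) (b : Expo S),
      ∀ a, (u a).degree = S.length * m ∧ plValue hkn S (u a) = b + fun t => ((a t : ℕ) : ℤ) := by
  classical
  choose J J' h using exists_vS_eq_add_single hlen hN
  refine ⟨fun a => ∑ t, (Finsupp.single (J t) (a t : ℕ) + Finsupp.single (J' t) (m - (a t : ℕ))),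
    ∑ t, m • vS hkn S (pbar (J' t)), fun a => ⟨?_, ?_⟩⟩
  · rw [map_sum, Finset.sum_congr rfl (g := fun _ => m)]
    · simp
    · intro t _
      rw [map_add, Finsupp.degree_single, Finsupp.degree_single]
      exact Nat.add_sub_of_le (Nat.le_of_lt_succ (a t).2)
  · have h1 : ∀ t, plValue hkn S (Finsupp.single (J t) (a t : ℕ) +
        Finsupp.single (J' t) (m - (a t : ℕ))) =
        m • vS hkn S (pbar (J' t)) + (a t : ℕ) • (Pi.single t 1 : Expo S) := by
      intro t
      rw [plValue_add, plValue_single, plValue_single, h t, smul_add, add_assoc, ← add_smul,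
        Nat.add_sub_of_le (Nat.le_of_lt_succ (a t).2), add_comm]
    have h2 : plValue hkn S (∑ t, (Finsupp.single (J t) (a t : ℕ) +
        Finsupp.single (J' t) (m - (a t : ℕ)))) = ∑ t, plValue hkn S
        (Finsupp.single (J t) (a t : ℕ) + Finsupp.single (J' t) (m - (a t : ℕ))) :=
      map_sum (Finsupp.weight fun J => vS hkn S (pbar J)) _ _
    rw [h2, Finset.sum_congr rfl fun t _ => h1 t, Finset.sum_add_distrib]
    congr 1
    funext s
    rw [Finset.sum_apply, Finset.sum_eq_single s]
    · simp
    · intro t _ ht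
      simp [Pi.single_eq_of_ne' ht]
    · exact fun h => absurd (Finset.mem_univ s) h

/-- If a prime ideal contained in the kernel of `symbolHom` misses a form of the kernel, the powers
of this form and monomials with distinct symbols give a large independent family modulo the
ideal. -/
theorem le_finrank_map_mk (hlen : S.length = k * (n - k))
    (hN : IsMinorChart hkn (rootColumns hkn S)) {𝔭 : Ideal (MvPolynomial (Idx k n) ℂ)}
    (hprime : 𝔭.IsPrime) (hle : 𝔭 ≤ RingHom.ker (symbolHom (k := k) hkn S)) {e : ℕ}
    {f : MvPolynomial (Idx k n) ℂ} (he : f.IsHomogeneous e) (hf : symbolHom hkn S f = 0)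
    (hfp : f ∉ 𝔭) (m : ℕ) :
    (m + 1) * (m + 1) ^ S.length ≤
      Module.finrank ℂ ((homogeneousSubmodule (Idx k n) ℂ ((e + S.length) * m)).map
        (Ideal.Quotient.mkₐ ℂ 𝔭).toLinearMap) := by
  classical
  obtain ⟨u, b, hu⟩ := exists_expo_box hlen hN m
  let J₀ : Idx k n := Fin.castLEOrderEmb hkn
  let M : Fin (m + 1) × (Fin S.length → Fin (m + 1)) → (Idx k n →₀ ℕ) := fun x =>
    u x.2 + Finsupp.single J₀ (e * (m - x.1))
  let w : Fin (m + 1) × (Fin S.length → Fin (m + 1)) → MvPolynomial (Idx k n) ℂ := fun x =>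
    f ^ (x.1 : ℕ) * monomial (M x) 1
  have hw : ∀ x, (w x).IsHomogeneous ((e + S.length) * m) := by
    intro x
    have h1 := (he.pow (x.1 : ℕ)).mul (isHomogeneous_monomial (d := M x) (1 : ℂ) rfl)
    have h2 : e * x.1 + (M x).degree = (e + S.length) * m := by
      rw [map_add, (hu x.2).1, Finsupp.degree_single]
      have h3 : e * (x.1 : ℕ) + e * (m - x.1) = e * m := by
        rw [← mul_add, Nat.add_sub_of_le (Nat.le_of_lt_succ x.1.2)]
      rw [add_mul]
      omega
    rwa [h2] at h1
  have hval : ∀ i a a', plValue hkn S (M (i, a)) = plValue hkn S (M (i, a')) → a = a' := by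
    intro i a a' h
    simp only [M] at h
    rw [plValue_add, plValue_add, add_left_inj, (hu a).2, (hu a').2, add_right_inj] at h
    funext t
    exact Fin.ext (Int.ofNat_inj.mp (congrFun h t))
  have hind : LinearIndependent ℂ fun x => Ideal.Quotient.mkₐ ℂ 𝔭 (w x) := by
    rw [Fintype.linearIndependent_iff]
    intro g hg
    have hmem : ∑ x, g x • w x ∈ 𝔭 := by
      rw [← Ideal.Quotient.eq_zero_iff_mem, ← hg]
      exact (map_sum (Ideal.Quotient.mkₐ ℂ 𝔭) _ _).trans
        (Finset.sum_congr rfl fun x _ => map_smul _ _ _)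
    suffices h : ∀ (N : ℕ) (i : Fin (m + 1)), (i : ℕ) = N → ∀ a, g (i, a) = 0 from
      fun x => h _ x.1 rfl x.2
    intro N
    induction N using Nat.strong_induction_on with
    | _ N ih =>
      intro i hi a
      -- Divide by `f ^ i` and apply `symbolHom`, which kills all higher powers of `f`.
      have h1 : ∑ x, g x • w x =
          f ^ (i : ℕ) * ∑ x, g x • (f ^ ((x.1 : ℕ) - i) * monomial (M x) 1) := by
        rw [Finset.mul_sum]
        refine Finset.sum_congr rfl fun x _ => ?_
        rcases lt_or_ge (x.1 : ℕ) i with hx | hx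
        · rw [ih x.1 (by omega) x.1 rfl x.2, zero_smul, zero_smul, mul_zero]
        · rw [mul_smul_comm, ← mul_assoc, ← pow_add, Nat.add_sub_of_le hx]
      rw [h1] at hmem
      have h2 := hle ((hprime.mem_or_mem hmem).resolve_left fun h =>
        hfp (hprime.mem_of_pow_mem _ h))
      rw [RingHom.mem_ker, map_sum] at h2
      have h3 := congrArg (fun z => (grEmb hkn S z).coeff
        ((M (i, a)).degree, plValue hkn S (M (i, a)))) h2
      simp only [map_sum, AddMonoidAlgebra.coeff_sum, Finsupp.finsetSum_apply, map_zero] at h3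
      rw [Finset.sum_eq_single (i, a)] at h3
      · have hs := hasSymbol_monomial hlen hN (M (i, a))
        rw [Nat.sub_self, pow_zero, one_mul, map_smul, map_smul, hs.grEmb_eq,
          AddMonoidAlgebra.coeff_smul_apply, AddMonoidAlgebra.coeff_single,
          Finsupp.single_eq_same, smul_eq_mul] at h3
        exact (mul_eq_zero.mp h3).resolve_right hs.coefAt_ne_zero
      · intro x _ hx
        rcases lt_trichotomy (x.1 : ℕ) i with hlt | heq | hgt
        · rw [ih x.1 (by omega) x.1 rfl x.2, zero_smul, map_zero, map_zero]
          rfl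
        · obtain ⟨i', a'⟩ := x
          have hii : i' = i := Fin.ext heq
          subst hii
          rw [Nat.sub_self, pow_zero, one_mul, map_smul, map_smul,
            (hasSymbol_monomial hlen hN (M (i', a'))).grEmb_eq,
            AddMonoidAlgebra.coeff_smul_apply, AddMonoidAlgebra.coeff_single,
            Finsupp.single_eq_of_ne, smul_zero]
          intro h
          exact hx (Prod.ext rfl (hval _ _ _ (Prod.ext_iff.mp h).2.symm))
        · rw [map_smul, map_mul, map_pow, hf, zero_pow (by omega), zero_mul, smul_zero, map_zero]
          rfl
      · exact fun h => absurd (Finset.mem_univ _) h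
  have hfin : Module.Finite ℂ ((homogeneousSubmodule (Idx k n) ℂ ((e + S.length) * m)).map
      (Ideal.Quotient.mkₐ ℂ 𝔭).toLinearMap) := inferInstance
  have hind' : LinearIndependent ℂ fun x =>
      (⟨Ideal.Quotient.mkₐ ℂ 𝔭 (w x), w x, hw x, rfl⟩ :
        (homogeneousSubmodule (Idx k n) ℂ ((e + S.length) * m)).map
          (Ideal.Quotient.mkₐ ℂ 𝔭).toLinearMap) :=
    LinearIndependent.of_comp (Submodule.subtype _) hind
  have hcard := hind'.fintype_card_le_finrank
  simpa using hcard

theorem isGraded_ker_symbolHom (hlen : S.length = k * (n - k))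
    (hN : IsMinorChart hkn (rootColumns hkn S)) :
    IsGradedIdeal (RingHom.ker (symbolHom (k := k) hkn S)) := by
  intro x hx r
  rw [RingHom.mem_ker] at *
  apply grEmb_injective
  rw [map_zero]
  ext ⟨s, a⟩
  change _ = (0 : ℂ)
  by_cases hs : s = r
  · have h1 : (grEmb hkn S (symbolHom hkn S x)).coeff (s, a) = 0 := by
      rw [hx, map_zero]
      rfl
    rw [← sum_homogeneousComponent x, map_sum, map_sum, AddMonoidAlgebra.coeff_sum,
      Finsupp.finsetSum_apply] at h1
    by_cases hr : r ∈ Finset.range (x.totalDegree + 1)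
    · rw [Finset.sum_eq_single r] at h1
      · exact h1
      · intro r' _ hr'
        exact coeff_grEmb_symbolHom_eq_zero hlen hN (homogeneousComponent_isHomogeneous r' x)
          (by rw [hs]; exact hr'.symm) a
      · exact fun h => absurd hr h
    · rw [homogeneousComponent_eq_zero, map_zero, map_zero]
      · rfl
      · rw [Finset.mem_range] at hr
        omega
  · exact coeff_grEmb_symbolHom_eq_zero hlen hN (homogeneousComponent_isHomogeneous r x) hs a

/-- A prime initial ideal contains all relations between the symbols of the Plücker coordinates:
otherwise the quotient would have a Hilbert function of too large growth. -/
theorem wInit_eq_ker_symbolHom (hk : 1 ≤ k) (hlen : S.length = k * (n - k))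
    (hN : IsMinorChart hkn (rootColumns hkn S))
    (hprime : (wInit (keyWeight hkn S) (pluckerIdeal k n)).IsPrime) :
    wInit (keyWeight hkn S) (pluckerIdeal k n) = RingHom.ker (symbolHom (k := k) hkn S) := by
  have hle := wInit_le_ker_symbolHom hk hlen hN
  refine le_antisymm hle fun x hx => ?_
  by_contra hxp
  obtain ⟨e, he⟩ : ∃ e, homogeneousComponent e x ∉ wInit (keyWeight hkn S) (pluckerIdeal k n) := by
    by_contra h
    push Not at h
    rw [← sum_homogeneousComponent x] at hxp
    exact hxp (sum_mem fun r _ => h r)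
  -- in degree `(e + d) m` the lower bound grows like `m ^ (d + 1)`, the upper bound like `m ^ d`
  obtain ⟨D, hD⟩ := exists_finrank_map_psiStar_le (k := k) hkn S
  have hbound : ∀ m : ℕ, m + 1 ≤ ((e + S.length) * D + 1) ^ S.length := by
    intro m
    have h1 := le_finrank_map_mk hlen hN hprime hle (homogeneousComponent_isHomogeneous e x)
      (isGraded_ker_symbolHom hlen hN x hx e) he m
    rw [finrank_map_mk_wInit hk hlen hN] at h1
    have h2 : (e + S.length) * m * D + 1 ≤ ((e + S.length) * D + 1) * (m + 1) := by
      nlinarith [Nat.zero_le ((e + S.length) * D)]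
    have h3 := (h1.trans (hD _)).trans (Nat.pow_le_pow_left h2 _)
    rw [mul_pow] at h3
    exact Nat.le_of_mul_le_mul_right h3 (by positivity)
  exact absurd (hbound (((e + S.length) * D + 1) ^ S.length)) (by omega)

end Hilbert

/-! ### Generation of the value semigroup by the Plücker coordinates -/

section Subduction

variable {k n : ℕ} {hkn : k ≤ n} {S : List (PosRoot n)}

theorem exists_weight_eq_of_component_ne_zero {σ Γ : Type} [AddCommMonoid Γ] {w : σ → Γ} {γ : Γ}
    {F : MvPolynomial σ ℂ} (h : weightedHomogeneousComponent w γ F ≠ 0) :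
    ∃ u ∈ F.support, Finsupp.weight w u = γ := by
  classical
  obtain ⟨u, hu⟩ := MvPolynomial.ne_zero_iff.mp h
  rw [coeff_weightedHomogeneousComponent] at hu
  split_ifs at hu with hw
  · exact ⟨u, mem_support_iff.mpr hu, hw⟩
  · exact absurd rfl hu

/-- If all relations between the symbols of the Plücker coordinates are initial forms, every value
is the value of a monomial: a representative all of whose lowest terms cancel can be replaced by
one with terms of larger weight. -/
theorem exists_plValue_eq_vS (hk : 1 ≤ k) (hlen : S.length = k * (n - k))
    (hN : IsMinorChart hkn (rootColumns hkn S))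
    (hker : RingHom.ker (symbolHom (k := k) hkn S) ≤
      wInit (keyWeight hkn S) (pluckerIdeal k n)) {r : ℕ} {f : PlAlg k n} (hf : f ∈ plDeg k n r)
    (hf0 : f ≠ 0) : ∃ u : Idx k n →₀ ℕ, u.degree = r ∧ plValue hkn S u = vS hkn S f := by
  classical
  have hI := isGradedIdeal_pluckerIdeal (n := n) hk
  -- the lowest weights of the representatives of `f` by forms of degree `r`: a finite set
  let G : Set (ℤ ×ₗ (Lex (Fin S.length → ℤ))ᵒᵈ) :=
    {γ | ∃ F : MvPolynomial (Idx k n) ℂ, F.IsHomogeneous r ∧ plMk k n F = f ∧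
      WeightGE (keyWeight hkn S) γ F ∧
      weightedHomogeneousComponent (keyWeight hkn S) γ F ≠ 0}
  have hG : G.Finite := by
    refine ((Finsupp.finite_of_degree_eq (σ := Idx k n) r).image
      (Finsupp.weight (keyWeight hkn S))).subset ?_
    rintro γ ⟨F, hF, _, _, hne⟩
    obtain ⟨u, hu, hw⟩ := exists_weight_eq_of_component_ne_zero hne
    refine ⟨u, ?_, hw⟩
    change u.degree = r
    by_contra h
    exact mem_support_iff.mp hu (hF.coeff_eq_zero h)
  have hmem : ∀ F : MvPolynomial (Idx k n) ℂ, F.IsHomogeneous r → plMk k n F = f →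
      ∃ γ ∈ G, WeightGE (keyWeight hkn S) γ F ∧
        weightedHomogeneousComponent (keyWeight hkn S) γ F ≠ 0 := by
    intro F hF hFf
    have hF0 : F ≠ 0 := by
      rintro rfl
      exact hf0 (hFf.symm.trans (map_zero _))
    obtain ⟨γ, h1, h2, _⟩ := exists_wForm_eq_component (keyWeight hkn S) hF0
    exact ⟨γ, ⟨F, hF, hFf, h1, h2⟩, h1, h2⟩
  have hGne : G.Nonempty := by
    obtain ⟨F, hF, hFf⟩ := hf
    obtain ⟨γ, hγ, _⟩ := hmem F hF hFf
    exact ⟨γ, hγ⟩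
  obtain ⟨γ, ⟨F, hF, hFf, hFw, hFne⟩, hmax⟩ := hG.exists_maximal hGne
  obtain ⟨u, hu, huγ⟩ := exists_weight_eq_of_component_ne_zero hFne
  have hur : u.degree = r := by
    by_contra h
    exact mem_support_iff.mp hu (hF.coeff_eq_zero h)
  rw [weight_keyWeight] at huγ
  subst huγ
  obtain ⟨h1, h2⟩ := coeff_grEmb_symbolHom hlen hN hF hFw
  rw [hFf] at h1 h2
  by_cases hc : coefAt S (plValue hkn S u) (psiStar hkn S f) = 0
  · exfalso
    -- the lowest part `x` of `F` is a relation between symbols, so it is the lowest part of some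
    -- `g` in the Plücker ideal, and `F - g` contradicts the maximality of the weight
    set x := weightedHomogeneousComponent (keyWeight hkn S) (psiKey S (plValue hkn S u)) F with hx
    have hxr : x.IsHomogeneous r := by
      intro v hv
      rw [hx, coeff_weightedHomogeneousComponent] at hv
      refine hF (d := v) fun h => ?_
      rw [h, ite_self] at hv
      exact hv rfl
    have hxx : weightedHomogeneousComponent (keyWeight hkn S) (psiKey S (plValue hkn S u)) x = x :=
      (weightedHomogeneousComponent_of_mem
        (weightedHomogeneousComponent_mem _ _ _)).trans (if_pos rfl)
    have hxker : symbolHom hkn S x = 0 := by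
      apply grEmb_injective
      rw [map_zero]
      ext ⟨s, b⟩
      change _ = (0 : ℂ)
      by_cases hs : s = r
      · subst hs
        by_cases hb : b = plValue hkn S u
        · rw [hb, hx, coeff_grEmb_symbolHom_component hlen hN, h2, hc]
        · rw [← coeff_grEmb_symbolHom_component hlen hN, hx, weightedHomogeneousComponent_of_mem
            (weightedHomogeneousComponent_mem _ _ _), if_neg, map_zero, map_zero]
          · rfl
          · exact fun h => hb (psiKey_injective S h)
      · exact coeff_grEmb_symbolHom_eq_zero hlen hN hxr hs b
    obtain ⟨g, hg, hgw, hgx⟩ := exists_lift_of_mem_wInit hI (hker hxker) hxr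
      (psiKey S (plValue hkn S u))
    have hFg : plMk k n (F - g) = f := by
      rw [map_sub, hFf, (plMk_eq_zero_iff g).mpr hg.1, sub_zero]
    obtain ⟨γ', hγ', hw', hne'⟩ := hmem (F - g) (hF.sub hg.2) hFg
    obtain ⟨v, hv, rfl⟩ := exists_weight_eq_of_component_ne_zero hne'
    have hle : psiKey S (plValue hkn S u) ≤ Finsupp.weight (keyWeight hkn S) v := by
      rw [sub_eq_add_neg, ← neg_one_smul ℂ g] at hv
      exact (hFw.add (hgw.smul _)) v hv
    have heq := le_antisymm hle (hmax hγ' hle)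
    rw [← heq, map_sub, hgx, ← hx, hxx, sub_self] at hne'
    exact hne' rfl
  · exact ⟨u, hur, (lowestExpo_eq h1 hc).symm⟩

theorem exists_monomial_of_mem_valueSemigroup (hk : 1 ≤ k) (hlen : S.length = k * (n - k))
    (hN : IsMinorChart hkn (rootColumns hkn S))
    (hker : RingHom.ker (symbolHom (k := k) hkn S) ≤
      wInit (keyWeight hkn S) (pluckerIdeal k n)) (q : ℕ × Expo S)
    (hq : q ∈ valueSemigroup (k := k) hkn S) :
    ∃ u : Idx k n →₀ ℕ, (u.degree, plValue hkn S u) = q := by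
  obtain ⟨f, hf, hf0, hfq⟩ := (mem_valueSemigroup_iff hlen hN q).mp hq
  obtain ⟨u, h1, h2⟩ := exists_plValue_eq_vS hk hlen hN hker hf hf0
  exact ⟨u, Prod.ext h1 (h2.trans hfq)⟩

theorem fg_valueSemigroup (hk : 1 ≤ k) (hlen : S.length = k * (n - k))
    (hN : IsMinorChart hkn (rootColumns hkn S))
    (hker : RingHom.ker (symbolHom (k := k) hkn S) ≤
      wInit (keyWeight hkn S) (pluckerIdeal k n)) : (valueSemigroup (k := k) hkn S).FG := by
  rw [AddSubmonoid.fg_iff]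
  refine ⟨Set.range fun J : Idx k n => ((1, vS hkn S (pbar J)) : ℕ × Expo S), ?_,
    Set.finite_range _⟩
  apply le_antisymm
  · rw [AddSubmonoid.closure_le]
    rintro _ ⟨J, rfl⟩
    exact AddSubmonoid.subset_closure ⟨pbar J, pbar_mem J, pbar_ne_zero J, rfl⟩
  · intro q hq
    obtain ⟨u, rfl⟩ := exists_monomial_of_mem_valueSemigroup hk hlen hN hker q hq
    have h : (u.degree, plValue hkn S u) =
        ∑ J ∈ u.support, u J • ((1, vS hkn S (pbar J)) : ℕ × Expo S) := by
      refine Prod.ext ?_ ?_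
      · rw [Prod.fst_sum, Finsupp.degree_apply]
        simp
      · rw [Prod.snd_sum]
        rfl
    rw [h]
    exact sum_mem fun J _ =>
      AddSubmonoid.nsmul_mem _ (AddSubmonoid.subset_closure (Set.mem_range_self J)) _

theorem symbolHom_surjective (hk : 1 ≤ k) (hlen : S.length = k * (n - k))
    (hN : IsMinorChart hkn (rootColumns hkn S))
    (hker : RingHom.ker (symbolHom (k := k) hkn S) ≤
      wInit (keyWeight hkn S) (pluckerIdeal k n)) :
    Function.Surjective (symbolHom (k := k) hkn S) := by
  intro z
  have hz : grEmb hkn S z ∈ (grEmb (k := k) hkn S).range := ⟨z, rfl⟩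
  rw [range_grEmb hlen hN] at hz
  obtain ⟨y, hy⟩ := hz
  suffices h : ∃ F, grEmb hkn S (symbolHom hkn S F) =
      AddMonoidAlgebra.mapDomain (valueSemigroup (k := k) hkn S).subtype y by
    obtain ⟨F, hF⟩ := h
    exact ⟨F, grEmb_injective (hF.trans hy)⟩
  clear hy
  induction y using AddMonoidAlgebra.induction_linear with
  | zero => exact ⟨0, by rw [map_zero, map_zero, AddMonoidAlgebra.mapDomain_zero]⟩
  | add x y hx hy =>
    obtain ⟨F, hF⟩ := hx
    obtain ⟨G, hG⟩ := hy
    exact ⟨F + G, by rw [map_add, map_add, hF, hG, AddMonoidAlgebra.mapDomain_add]⟩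
  | single q c =>
    obtain ⟨u, hu⟩ := exists_monomial_of_mem_valueSemigroup hk hlen hN hker q.1 q.2
    have hs := hasSymbol_monomial hlen hN u
    refine ⟨(c * (coefAt S (plValue hkn S u) (psiStar hkn S (plMk k n (monomial u 1))))⁻¹) •
      monomial u 1, ?_⟩
    rw [map_smul, map_smul, hs.grEmb_eq, AddMonoidAlgebra.smul_single, smul_eq_mul, mul_assoc,
      inv_mul_cancel₀ hs.coefAt_ne_zero, mul_one, AddMonoidAlgebra.mapDomain_single, hu]
    rfl

theorem exists_algEquiv_quotient (hk : 1 ≤ k) (hlen : S.length = k * (n - k))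
    (hN : IsMinorChart hkn (rootColumns hkn S))
    (hJ : wInit (keyWeight hkn S) (pluckerIdeal k n) =
      RingHom.ker (symbolHom (k := k) hkn S)) :
    ∃ φ : (MvPolynomial (Idx k n) ℂ ⧸ wInit (keyWeight hkn S) (pluckerIdeal k n)) ≃ₐ[ℂ]
      grS (k := k) hkn S, ∀ J : Idx k n,
        φ (Ideal.Quotient.mk _ (X J)) = symbol hkn S 1 (pbar J) (pbar_mem J) := by
  refine ⟨(Ideal.quotientEquivAlgOfEq ℂ hJ).trans
    (Ideal.quotientKerAlgEquivOfSurjective (symbolHom_surjective hk hlen hN hJ.ge)), fun J => ?_⟩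
  change symbolHom hkn S (X J) = _
  rw [symbolHom, aeval_X]

theorem symbolHom_mem_grDeg {r : ℕ} {F : MvPolynomial (Idx k n) ℂ} (hF : F.IsHomogeneous r)
    (hlen : S.length = k * (n - k)) (hN : IsMinorChart hkn (rootColumns hkn S)) :
    symbolHom hkn S F ∈ grDeg hkn S r := by
  rw [F.as_sum, map_sum]
  refine Submodule.sum_mem _ fun u hu => ?_
  have hdeg : u.degree = r := by
    by_contra h
    exact mem_support_iff.mp hu (hF.coeff_eq_zero h)
  rw [monomial_eq_smul, map_smul]
  refine Submodule.smul_mem _ _ (Submodule.mem_iSup_of_mem (plValue hkn S u) ?_)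
  have hs := hasSymbol_monomial hlen hN u
  rw [hdeg] at hs
  refine ⟨⟨plMk k n (monomial u 1), ⟨⟨_, ?_, rfl⟩, hs.lowGE⟩⟩, ?_⟩
  · exact isHomogeneous_monomial _ hdeg
  · apply grEmb_injective
    exact (grEmb_toGr _ _).trans hs.grEmb_eq.symm

end Subduction

/-! ### Gradings of quotients of polynomial rings -/

section QuotientGrading

variable {σ R : Type} [CommRing R]

/-- The degree `r` part of the quotient of a polynomial ring. -/
def quotDeg (K : Ideal (MvPolynomial σ R)) (r : ℕ) : Submodule R (MvPolynomial σ R ⧸ K) :=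
  (homogeneousSubmodule σ R r).map (Ideal.Quotient.mkₐ R K).toLinearMap

/-- A linear map that vanishes on the kernel of a surjection factors through it. -/
theorem exists_linearMap_comp_eq {M N P : Type} [AddCommGroup M] [Module R M] [AddCommGroup N]
    [Module R N] [AddCommMonoid P] [Module R P] {f : M →ₗ[R] N} (hf : Function.Surjective f)
    {g : M →ₗ[R] P} (h : ∀ x, f x = 0 → g x = 0) : ∃ g' : N →ₗ[R] P, ∀ x, g' (f x) = g x := by
  have hfg : ∀ x y, f x = f y → g x = g y := by
    intro x y hxy
    rw [← sub_add_cancel x y, map_add, h _ (by rw [map_sub, hxy, sub_self]), zero_add]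
  have hg : ∀ x, g (Function.surjInv hf (f x)) = g x := fun x =>
    hfg _ _ (Function.surjInv_eq hf (f x))
  refine ⟨⟨⟨fun y => g (Function.surjInv hf y), fun y z => ?_⟩, fun c y => ?_⟩, hg⟩
  · obtain ⟨y, rfl⟩ := hf y
    obtain ⟨z, rfl⟩ := hf z
    rw [← map_add, hg, hg, hg, map_add]
  · obtain ⟨y, rfl⟩ := hf y
    change g (Function.surjInv hf (c • f y)) = c • g (Function.surjInv hf (f y))
    rw [← map_smul, hg, hg, map_smul]

/-- The quotient of a polynomial ring by an ideal that is closed under homogeneous components is a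
graded algebra. -/
theorem nonempty_gradedAlgebra_quotDeg {K : Ideal (MvPolynomial σ R)}
    (hK : ∀ x ∈ K, ∀ r, homogeneousComponent r x ∈ K) : Nonempty (GradedAlgebra (quotDeg K)) := by
  let H := homogeneousSubmodule σ R
  let _ : GradedAlgebra H := gradedAlgebra
  let mk : MvPolynomial σ R →ₗ[R] MvPolynomial σ R ⧸ K := (Ideal.Quotient.mkₐ R K).toLinearMap
  let f : ∀ r, H r →ₗ[R] quotDeg K r := fun r =>
    (mk.comp (H r).subtype).codRestrict (quotDeg K r) fun x => ⟨x.1, x.2, rfl⟩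
  let δ : MvPolynomial σ R →ₗ[R] DirectSum ℕ fun r => quotDeg K r :=
    (DirectSum.lmap f).comp (DirectSum.decomposeLinearEquiv H).toLinearMap
  have hδ : ∀ x ∈ K, δ x = 0 := by
    intro x hx
    ext r
    have h1 : ((DirectSum.decompose H x) r : MvPolynomial σ R) = homogeneousComponent r x :=
      decomposition.decompose'_apply x r
    change mk ((DirectSum.decompose H x) r : MvPolynomial σ R) = 0
    rw [h1]
    exact Ideal.Quotient.eq_zero_iff_mem.mpr (hK x hx r)
  have hδ' : ∀ r (x : MvPolynomial σ R) (hx : x ∈ H r),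
      δ x = DirectSum.lof R ℕ (fun r => quotDeg K r) r ⟨mk x, x, hx, rfl⟩ := by
    intro r x hx
    have h1 : DirectSum.decompose H x = DirectSum.lof R ℕ (fun r => H r) r ⟨x, hx⟩ :=
      DirectSum.decompose_of_mem H hx
    change DirectSum.lmap f (DirectSum.decompose H x) = _
    rw [h1, DirectSum.lmap_lof]
    rfl
  have hmk : Function.Surjective mk := Ideal.Quotient.mk_surjective
  obtain ⟨dec, hdec⟩ := exists_linearMap_comp_eq (g := δ) hmk fun x hx =>
    hδ x (Ideal.Quotient.eq_zero_iff_mem.mp hx)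
  have h1 : DirectSum.coeLinearMap (quotDeg K) ∘ₗ dec = LinearMap.id := by
    refine LinearMap.ext fun y => ?_
    obtain ⟨x, rfl⟩ := hmk y
    rw [LinearMap.comp_apply, hdec, LinearMap.id_apply]
    induction x using DirectSum.Decomposition.inductionOn H with
    | zero => rw [map_zero, map_zero, map_zero]
    | homogeneous x => rw [hδ' _ _ x.2, DirectSum.coeLinearMap_lof]
    | add x y hx hy => rw [map_add, map_add, map_add, hx, hy]
  have h2 : dec ∘ₗ DirectSum.coeLinearMap (quotDeg K) = LinearMap.id := by
    refine DirectSum.linearMap_ext R fun r => LinearMap.ext fun y => ?_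
    obtain ⟨_, x, hx, rfl⟩ := y
    rw [LinearMap.comp_apply, LinearMap.comp_apply, DirectSum.coeLinearMap_lof]
    exact (hdec x).trans (hδ' r x hx)
  let _ : DirectSum.Decomposition (quotDeg K) := DirectSum.Decomposition.ofLinearMap _ dec h1 h2
  have _ : SetLike.GradedMonoid (quotDeg K) :=
    { one_mem := ⟨1, isHomogeneous_one σ R, map_one (Ideal.Quotient.mkₐ R K)⟩
      mul_mem := by
        rintro i j _ _ ⟨x, hx, rfl⟩ ⟨y, hy, rfl⟩
        exact ⟨x * y, IsHomogeneous.mul hx hy, map_mul (Ideal.Quotient.mkₐ R K) x y⟩ }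
  exact ⟨{ }⟩

end QuotientGrading

/-! ### The flat family of an integral weight -/

section Family

/-- The homomorphism `p_i ↦ p̄_i t^{m_i}`. The quotient by its kernel is the family degenerating an
algebra generated by the `p̄_i` to the algebra of an initial ideal. -/
def familyHom {σ A : Type} [CommRing A] [Algebra ℂ A] (π : MvPolynomial σ ℂ →ₐ[ℂ] A) (m : σ → ℕ) :
    MvPolynomial σ (Polynomial ℂ) →+* Polynomial A :=
  eval₂Hom (Polynomial.mapRingHom (algebraMap ℂ A)) fun i =>
    Polynomial.C (π (X i)) * Polynomial.X ^ m i

variable {σ A : Type} [CommRing A] [Algebra ℂ A] {π : MvPolynomial σ ℂ →ₐ[ℂ] A} {m : σ → ℕ}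

theorem familyHom_monomial (u : σ →₀ ℕ) (p : Polynomial ℂ) :
    familyHom π m (monomial u p) =
      p.map (algebraMap ℂ A) * Polynomial.C (π (monomial u 1)) *
        Polynomial.X ^ (Finsupp.weight m u) := by
  rw [familyHom, eval₂Hom_monomial, Finsupp.prod]
  simp only [mul_pow, Finset.prod_mul_distrib, ← pow_mul]
  rw [Finset.prod_pow_eq_pow_sum, monomial_eq, C_1, one_mul, Finsupp.prod, map_prod, map_prod,
    Finsupp.weight_apply, Finsupp.sum, mul_assoc]
  simp only [map_pow, smul_eq_mul]
  rw [Finset.sum_congr rfl fun i _ => mul_comm (u i) (m i)]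
  rfl

variable (m) in
/-- The coefficient of `t^N` after the substitution of `p_i t^{m_i}` for `p_i`. -/
def slice (N : ℕ) (x : MvPolynomial σ (Polynomial ℂ)) : MvPolynomial σ ℂ :=
  ∑ u ∈ x.support, monomial u
    (if Finsupp.weight m u ≤ N then (coeff u x).coeff (N - Finsupp.weight m u) else 0)

theorem coeff_slice (N : ℕ) (x : MvPolynomial σ (Polynomial ℂ)) (u : σ →₀ ℕ) :
    coeff u (slice m N x) =
      if Finsupp.weight m u ≤ N then (coeff u x).coeff (N - Finsupp.weight m u) else 0 := by
  classical
  rw [slice, coeff_sum]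
  simp only [coeff_monomial, Finset.sum_ite_eq']
  split_ifs with h1 h2 h2
  · rfl
  · rfl
  · rw [notMem_support_iff.mp h1, Polynomial.coeff_zero]
  · rfl

/-- The coefficients of the image under `familyHom` are the images of the slices. -/
theorem coeff_familyHom (N : ℕ) (x : MvPolynomial σ (Polynomial ℂ)) :
    (familyHom π m x).coeff N = π (slice m N x) := by
  conv_lhs => rw [x.as_sum]
  rw [map_sum, Polynomial.finsetSum_coeff, slice, map_sum]
  refine Finset.sum_congr rfl fun u _ => ?_
  rw [familyHom_monomial, Polynomial.coeff_mul_X_pow']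
  split_ifs
  · rw [Polynomial.coeff_mul_C, Polynomial.coeff_map,
      monomial_eq_smul u ((coeff u x).coeff (N - Finsupp.weight m u)), map_smul, Algebra.smul_def]
  · rw [monomial_zero, map_zero]

theorem mem_ker_familyHom_iff (x : MvPolynomial σ (Polynomial ℂ)) :
    x ∈ RingHom.ker (familyHom π m) ↔ ∀ N, slice m N x ∈ RingHom.ker π := by
  rw [RingHom.mem_ker, Polynomial.ext_iff]
  simp only [coeff_familyHom, Polynomial.coeff_zero]
  rfl

theorem homogeneousComponent_mem_ker_familyHom (hI : IsGradedIdeal (RingHom.ker π))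
    (x : MvPolynomial σ (Polynomial ℂ)) (hx : x ∈ RingHom.ker (familyHom π m)) (r : ℕ) :
    homogeneousComponent r x ∈ RingHom.ker (familyHom π m) := by
  rw [mem_ker_familyHom_iff] at *
  intro N
  have h : slice m N (homogeneousComponent r x) = homogeneousComponent r (slice m N x) := by
    ext u
    rw [coeff_slice, coeff_homogeneousComponent, coeff_homogeneousComponent, coeff_slice]
    split_ifs <;> simp
  rw [h]
  exact hI _ (hx N) r

/-- Homogenization of a polynomial with respect to the weights `m`, with `t` as the additional
variable. -/
def weightHomogenize (m : σ → ℕ) (N : ℕ) (F : MvPolynomial σ ℂ) : MvPolynomial σ (Polynomial ℂ) :=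
  ∑ u ∈ F.support, monomial u
    (Polynomial.C (coeff u F) * Polynomial.X ^ (N - Finsupp.weight m u))

theorem coeff_weightHomogenize (N : ℕ) (F : MvPolynomial σ ℂ) (u : σ →₀ ℕ) :
    coeff u (weightHomogenize m N F) =
      Polynomial.C (coeff u F) * Polynomial.X ^ (N - Finsupp.weight m u) := by
  classical
  rw [weightHomogenize, coeff_sum]
  simp only [coeff_monomial, Finset.sum_ite_eq']
  split_ifs with h
  · rfl
  · rw [notMem_support_iff.mp h, map_zero, zero_mul]

theorem familyHom_weightHomogenize {N : ℕ} {F : MvPolynomial σ ℂ}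
    (hN : ∀ u ∈ F.support, Finsupp.weight m u ≤ N) :
    familyHom π m (weightHomogenize m N F) = Polynomial.C (π F) * Polynomial.X ^ N := by
  rw [weightHomogenize, map_sum]
  conv_rhs => rw [F.as_sum]
  rw [map_sum, map_sum, Finset.sum_mul]
  refine Finset.sum_congr rfl fun u hu => ?_
  rw [familyHom_monomial, monomial_eq_smul u (coeff u F), map_smul, Algebra.smul_def,
    Polynomial.map_mul, Polynomial.map_C, Polynomial.map_pow, Polynomial.map_X, map_mul]
  have h1 : (Polynomial.X : Polynomial A) ^ N =
      Polynomial.X ^ (N - Finsupp.weight m u) * Polynomial.X ^ (Finsupp.weight m u) := by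
    rw [← pow_add, Nat.sub_add_cancel (hN u hu)]
  rw [h1]
  ring

theorem exists_weight_le (m : σ → ℕ) (F : MvPolynomial σ ℂ) :
    ∃ N, ∀ u ∈ F.support, Finsupp.weight m u ≤ N :=
  ⟨F.support.sup (Finsupp.weight m), fun _ hu => Finset.le_sup (f := Finsupp.weight m) hu⟩

theorem weight_neg_natCast (u : σ →₀ ℕ) :
    Finsupp.weight (fun i => -(m i : ℤ)) u = -((Finsupp.weight m u : ℕ) : ℤ) := by
  rw [Finsupp.weight_apply, Finsupp.weight_apply, Finsupp.sum, Finsupp.sum, Nat.cast_sum,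
    ← Finset.sum_neg_distrib]
  refine Finset.sum_congr rfl fun i _ => ?_
  rw [smul_neg, nsmul_eq_mul, smul_eq_mul, Nat.cast_mul]

/-- Specialization of the parameter. -/
def evalParam (σ : Type) (c : ℂ) : MvPolynomial σ (Polynomial ℂ) →+* MvPolynomial σ ℂ :=
  MvPolynomial.map (Polynomial.evalRingHom c)

theorem coeff_evalParam (c : ℂ) (x : MvPolynomial σ (Polynomial ℂ)) (u : σ →₀ ℕ) :
    coeff u (evalParam σ c x) = (coeff u x).eval c := by
  rw [evalParam, coeff_map]
  rfl

theorem evalParam_surjective (c : ℂ) : Function.Surjective (evalParam σ c) :=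
  MvPolynomial.map_surjective _ fun a => ⟨Polynomial.C a, Polynomial.eval_C⟩

theorem evalParam_eq_zero_iff (c : ℂ) (x : MvPolynomial σ (Polynomial ℂ)) :
    evalParam σ c x = 0 ↔ MvPolynomial.C (Polynomial.X - Polynomial.C c) ∣ x := by
  rw [C_dvd_iff_dvd_coeff, MvPolynomial.ext_iff]
  refine forall_congr' fun u => ?_
  rw [coeff_evalParam, coeff_zero, Polynomial.dvd_iff_isRoot]
  rfl

/-- The fibre over `c` of the quotient family by an ideal `K` is the quotient by the specialization
of `K`. -/
theorem isFibre_quotDeg {B : Type} [CommRing B] [Algebra ℂ B]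
    {K : Ideal (MvPolynomial σ (Polynomial ℂ))} {ℬ : ℕ → Submodule ℂ B} {c : ℂ}
    (β : MvPolynomial σ ℂ →ₐ[ℂ] B) (hβ : Function.Surjective β)
    (hdeg : ∀ r, ∀ F : MvPolynomial σ ℂ, F.IsHomogeneous r → β F ∈ ℬ r)
    (h1 : ∀ x ∈ K, β (evalParam σ c x) = 0)
    (h2 : ∀ F, β F = 0 → ∃ x ∈ K, evalParam σ c x = F) : IsFibre (quotDeg K) ℬ c := by
  refine ⟨Ideal.Quotient.lift K (β.toRingHom.comp (evalParam σ c)) h1, ?_, ?_, ?_, ?_⟩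
  · intro b
    obtain ⟨F, rfl⟩ := hβ b
    obtain ⟨x, rfl⟩ := evalParam_surjective c F
    exact ⟨Ideal.Quotient.mk K x, rfl⟩
  · ext y
    obtain ⟨x, rfl⟩ := Ideal.Quotient.mk_surjective y
    rw [Ideal.mem_span_singleton]
    constructor
    · intro hx
      obtain ⟨z, hz, hzx⟩ := h2 _ hx
      have h3 : evalParam σ c (x - z) = 0 := by rw [map_sub, hzx, sub_self]
      obtain ⟨w, hw⟩ := (evalParam_eq_zero_iff c _).mp h3
      refine ⟨Ideal.Quotient.mk K w, ?_⟩
      have h4 : Ideal.Quotient.mk K x = Ideal.Quotient.mk K (x - z) := by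
        rw [map_sub, Ideal.Quotient.eq_zero_iff_mem.mpr hz, sub_zero]
      rw [h4, hw, map_mul]
      rfl
    · rintro ⟨w, hw⟩
      rw [RingHom.mem_ker, hw, map_mul]
      have h3 : evalParam σ c (MvPolynomial.C (Polynomial.X - Polynomial.C c)) = 0 :=
        (evalParam_eq_zero_iff c _).mpr dvd_rfl
      have h4 : Ideal.Quotient.lift K (β.toRingHom.comp (evalParam σ c)) h1
          (algebraMap (Polynomial ℂ) _ (Polynomial.X - Polynomial.C c)) =
          β (evalParam σ c (MvPolynomial.C (Polynomial.X - Polynomial.C c))) := rfl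
      rw [h4, h3, map_zero, zero_mul]
  · intro p
    have h3 : evalParam σ c (MvPolynomial.C p) = MvPolynomial.C (p.eval c) := map_C _ _
    have h4 : Ideal.Quotient.lift K (β.toRingHom.comp (evalParam σ c)) h1
        (algebraMap (Polynomial ℂ) _ p) = β (evalParam σ c (MvPolynomial.C p)) := rfl
    rw [h4, h3, ← algebraMap_eq, AlgHom.commutes]
  · rintro r _ ⟨x, hx, rfl⟩
    exact hdeg r _ (IsHomogeneous.map hx _)

end Family

/-! ### Fibres and flatness of the family -/

section FamilyFibres

variable {σ A : Type} [CommRing A] [Algebra ℂ A] {π : MvPolynomial σ ℂ →ₐ[ℂ] A} {m : σ → ℕ}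

/-- The action of a scalar with weights `m` on polynomials. -/
def scaleHom (m : σ → ℕ) (c : ℂ) : MvPolynomial σ ℂ →ₐ[ℂ] MvPolynomial σ ℂ :=
  aeval fun i => c ^ m i • X i

theorem scaleHom_monomial (c : ℂ) (u : σ →₀ ℕ) (a : ℂ) :
    scaleHom m c (monomial u a) = monomial u (c ^ Finsupp.weight m u * a) := by
  rw [scaleHom, aeval_monomial, Finsupp.prod]
  simp only [smul_pow, ← pow_mul]
  rw [Finset.prod_smul, Finset.prod_pow_eq_pow_sum, monomial_eq, C_mul, algebraMap_eq,
    smul_eq_C_mul, Finsupp.weight_apply, Finsupp.sum, Finsupp.prod,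
    Finset.sum_congr rfl fun i _ => mul_comm (m i) (u i)]
  simp only [smul_eq_mul]
  ring

theorem coeff_scaleHom (c : ℂ) (F : MvPolynomial σ ℂ) (u : σ →₀ ℕ) :
    coeff u (scaleHom m c F) = c ^ Finsupp.weight m u * coeff u F := by
  classical
  conv_lhs => rw [F.as_sum]
  rw [map_sum, coeff_sum]
  simp only [scaleHom_monomial, coeff_monomial, Finset.sum_ite_eq']
  split_ifs with h
  · rfl
  · rw [notMem_support_iff.mp h, mul_zero]

theorem scaleHom_surjective {c : ℂ} (hc : c ≠ 0) : Function.Surjective (scaleHom m c) := by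
  intro F
  refine ⟨scaleHom m c⁻¹ F, ?_⟩
  ext u
  rw [coeff_scaleHom, coeff_scaleHom, ← mul_assoc, ← mul_pow, mul_inv_cancel₀ hc, one_pow, one_mul]

theorem isHomogeneous_scaleHom (c : ℂ) {r : ℕ} {F : MvPolynomial σ ℂ} (hF : F.IsHomogeneous r) :
    (scaleHom m c F).IsHomogeneous r := by
  intro u hu
  rw [coeff_scaleHom] at hu
  exact hF (right_ne_zero_of_mul hu)

/-- Specialization at `t = c` of the substitution `p_i ↦ p̄_i t^{m_i}`. -/
theorem eval_familyHom (c : ℂ) (x : MvPolynomial σ (Polynomial ℂ)) :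
    (familyHom π m x).eval (algebraMap ℂ A c) = π (scaleHom m c (evalParam σ c x)) := by
  have h : (Polynomial.evalRingHom (algebraMap ℂ A c)).comp (familyHom π m) =
      (π.comp (scaleHom m c)).toRingHom.comp (evalParam σ c) := by
    refine MvPolynomial.ringHom_ext (fun p => ?_) fun i => ?_
    · have h3 : evalParam σ c (MvPolynomial.C p) = MvPolynomial.C (p.eval c) := map_C _ _
      rw [RingHom.comp_apply, RingHom.comp_apply, h3, familyHom, eval₂Hom_C]
      change (p.map (algebraMap ℂ A)).eval (algebraMap ℂ A c) = π (scaleHom m c (C (p.eval c)))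
      rw [Polynomial.eval_map_algebraMap, Polynomial.aeval_algebraMap_apply, ← algebraMap_eq,
        AlgHom.commutes, AlgHom.commutes]
      rfl
    · have h3 : evalParam σ c (X i) = X i := map_X _ _
      rw [RingHom.comp_apply, RingHom.comp_apply, h3, familyHom, eval₂Hom_X']
      change (Polynomial.C (π (X i)) * Polynomial.X ^ m i).eval (algebraMap ℂ A c) =
        π (scaleHom m c (X i))
      rw [scaleHom, aeval_X, map_smul, Polynomial.eval_mul, Polynomial.eval_C, Polynomial.eval_pow,
        Polynomial.eval_X, Algebra.smul_def, map_pow, mul_comm]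
  exact congrArg (fun φ => φ x) h

/-- For `c ≠ 0` the substitution `p_i ↦ c^{m_i} p̄_i` identifies the fibre over `c` with the
original algebra. -/
theorem isFibre_familyHom {𝒜 : ℕ → Submodule ℂ A} (hπ : Function.Surjective π)
    (hdeg : ∀ r, ∀ F : MvPolynomial σ ℂ, F.IsHomogeneous r → π F ∈ 𝒜 r) {c : ℂ} (hc : c ≠ 0) :
    IsFibre (quotDeg (RingHom.ker (familyHom π m))) 𝒜 c := by
  refine isFibre_quotDeg (π.comp (scaleHom m c)) (hπ.comp (scaleHom_surjective hc))
    (fun r F hF => hdeg r _ (isHomogeneous_scaleHom c hF)) (fun x hx => ?_) fun F hF => ?_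
  · have h := eval_familyHom (π := π) (m := m) c x
    rw [RingHom.mem_ker.mp hx, Polynomial.eval_zero] at h
    exact h.symm
  · obtain ⟨N, hN⟩ := exists_weight_le m (scaleHom m c F)
    have h0 : familyHom π m (weightHomogenize m N (scaleHom m c F)) = 0 := by
      have hF' : π (scaleHom m c F) = 0 := hF
      rw [familyHom_weightHomogenize hN, hF', map_zero, zero_mul]
    -- at `t = c` the homogenization of `F(c^m p)` becomes `c ^ N F`
    refine ⟨C (Polynomial.C (c ^ N)⁻¹) * weightHomogenize m N (scaleHom m c F), ?_, ?_⟩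
    · exact Ideal.mul_mem_left _ _ (RingHom.mem_ker.mpr h0)
    · ext u
      rw [coeff_evalParam, coeff_C_mul, coeff_weightHomogenize, Polynomial.eval_mul,
        Polynomial.eval_C, Polynomial.eval_mul, Polynomial.eval_C, Polynomial.eval_pow,
        Polynomial.eval_X]
      by_cases hu : coeff u (scaleHom m c F) = 0
      · rw [hu, zero_mul, mul_zero]
        rw [coeff_scaleHom] at hu
        exact ((mul_eq_zero.mp hu).resolve_left (pow_ne_zero _ hc)).symm
      · have h1 : c ^ N = c ^ (N - Finsupp.weight m u) * c ^ Finsupp.weight m u := by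
          rw [← pow_add, Nat.sub_add_cancel (hN u (mem_support_iff.mpr hu))]
        rw [coeff_scaleHom, h1]
        field_simp

/-- The special fibre of the family is the quotient by the initial ideal: the terms of a relation in
the family that survive at `t = 0` are those of maximal weight in its slices. -/
theorem isFibre_familyHom_zero {B : Type} [CommRing B] [Algebra ℂ B] {ℬ : ℕ → Submodule ℂ B}
    (β : MvPolynomial σ ℂ →ₐ[ℂ] B) (hβ : Function.Surjective β)
    (hdeg : ∀ r, ∀ F : MvPolynomial σ ℂ, F.IsHomogeneous r → β F ∈ ℬ r)
    (hker : wInit (fun i => -(m i : ℤ)) (RingHom.ker π) = RingHom.ker β) :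
    IsFibre (quotDeg (RingHom.ker (familyHom π m))) ℬ 0 := by
  classical
  refine isFibre_quotDeg β hβ hdeg (fun x hx => ?_) fun F hF => ?_
  · rw [← RingHom.mem_ker, ← hker,
      ← sum_weightedHomogeneousComponent (fun i => -(m i : ℤ)) (evalParam σ 0 x)]
    refine finsum_induction (· ∈ wInit (fun i => -(m i : ℤ)) (RingHom.ker π)) (zero_mem _)
      (fun _ _ => add_mem) fun γ => ?_
    by_cases h0 : weightedHomogeneousComponent (fun i => -(m i : ℤ)) γ (evalParam σ 0 x) = 0
    · rw [h0]
      exact zero_mem _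
    obtain ⟨v, _, rfl⟩ := exists_weight_eq_of_component_ne_zero h0
    set N := Finsupp.weight m v with hNv
    have hcomp : weightedHomogeneousComponent (fun i => -(m i : ℤ))
        (Finsupp.weight (fun i => -(m i : ℤ)) v) (evalParam σ 0 x) =
        weightedHomogeneousComponent (fun i => -(m i : ℤ))
        (Finsupp.weight (fun i => -(m i : ℤ)) v) (slice m N x) := by
      ext u
      rw [coeff_weightedHomogeneousComponent, coeff_weightedHomogeneousComponent]
      simp only [weight_neg_natCast, neg_inj, Nat.cast_inj]
      split_ifs with hu
      · rw [coeff_evalParam, coeff_slice, hu, if_pos le_rfl, Nat.sub_self,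
          Polynomial.coeff_zero_eq_eval_zero]
      · rfl
    rw [hcomp] at h0 ⊢
    rw [← wForm_eq_component _ h0]
    · exact wForm_mem_wInit _ ((mem_ker_familyHom_iff x).mp hx N)
    · intro u hu
      rw [mem_support_iff, coeff_slice] at hu
      rw [weight_neg_natCast, weight_neg_natCast, neg_le_neg_iff, Nat.cast_le]
      by_contra h
      rw [if_neg h] at hu
      exact hu rfl
  · have hF' : F ∈ wInit (fun i => -(m i : ℤ)) (RingHom.ker π) := by
      rw [hker]
      exact hF
    rw [← Ideal.mem_map_iff_of_surjective (evalParam σ 0) (evalParam_surjective 0)]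
    refine (Ideal.span_le.mpr ?_ : wInit _ _ ≤ _) hF'
    rintro _ ⟨f, hf, rfl⟩
    rcases eq_or_ne f 0 with rfl | hf0
    · rw [initForm_zero]
      exact zero_mem _
    obtain ⟨γ, hγ, hne, hform⟩ := exists_wForm_eq_component (fun i => -(m i : ℤ)) hf0
    obtain ⟨v, _, rfl⟩ := exists_weight_eq_of_component_ne_zero hne
    have hN : ∀ u ∈ f.support, Finsupp.weight m u ≤ Finsupp.weight m v := by
      intro u hu
      have := hγ u hu
      rwa [weight_neg_natCast, weight_neg_natCast, neg_le_neg_iff, Nat.cast_le] at this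
    have hmem : weightHomogenize m (Finsupp.weight m v) f ∈ RingHom.ker (familyHom π m) := by
      rw [RingHom.mem_ker, familyHom_weightHomogenize hN, RingHom.mem_ker.mp hf, map_zero, zero_mul]
    have heq : evalParam σ 0 (weightHomogenize m (Finsupp.weight m v) f) =
        wForm (fun i => -(m i : ℤ)) f := by
      rw [hform]
      ext u
      rw [coeff_evalParam, coeff_weightHomogenize, Polynomial.eval_mul, Polynomial.eval_C,
        Polynomial.eval_pow, Polynomial.eval_X, coeff_weightedHomogeneousComponent]
      simp only [weight_neg_natCast, neg_inj, Nat.cast_inj]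
      split_ifs with hu
      · rw [hu, Nat.sub_self, pow_zero, mul_one]
      · by_cases hu0 : coeff u f = 0
        · rw [hu0, zero_mul]
        · have := lt_of_le_of_ne (hN u (mem_support_iff.mpr hu0)) hu
          rw [zero_pow (by omega), mul_zero]
    have h1 := Ideal.mem_map_of_mem (evalParam σ 0) hmem
    rw [heq] at h1
    exact h1

/-- The family embeds into `A[t]`, so it has no torsion over the principal ideal domain `ℂ[t]`. -/
theorem flat_quotient_ker_familyHom [IsDomain A] :
    Module.Flat (Polynomial ℂ) (MvPolynomial σ (Polynomial ℂ) ⧸ RingHom.ker (familyHom π m)) := by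
  have : Module.IsTorsionFree (Polynomial ℂ)
      (MvPolynomial σ (Polynomial ℂ) ⧸ RingHom.ker (familyHom π m)) := by
    refine ⟨fun p hp => ?_⟩
    rw [isSMulRegular_iff_right_eq_zero_of_smul]
    intro y hy
    obtain ⟨x, rfl⟩ := Ideal.Quotient.mk_surjective y
    rw [Ideal.Quotient.eq_zero_iff_mem]
    have h1 : C p * x ∈ RingHom.ker (familyHom π m) := by
      rw [← Ideal.Quotient.eq_zero_iff_mem, ← hy, map_mul, Algebra.smul_def]
      rfl
    rw [RingHom.mem_ker, map_mul, familyHom, eval₂Hom_C] at h1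
    refine RingHom.mem_ker.mpr ((mul_eq_zero.mp h1).resolve_left fun h2 => hp.ne_zero ?_)
    exact (Polynomial.map_injective _ (algebraMap ℂ A).injective)
      (h2.trans (Polynomial.map_zero _).symm)
  infer_instance

/-- A domain generated by finitely many elements of degree one degenerates flatly to the algebra of
an initial ideal of its relations. -/
theorem isFlatDegeneration_of_wInit [IsDomain A] [Finite σ] {B : Type} [CommRing B] [Algebra ℂ B]
    {𝒜 : ℕ → Submodule ℂ A} {ℬ : ℕ → Submodule ℂ B} (hI : IsGradedIdeal (RingHom.ker π))
    (hπ : Function.Surjective π)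
    (hπdeg : ∀ r, ∀ F : MvPolynomial σ ℂ, F.IsHomogeneous r → π F ∈ 𝒜 r)
    (β : MvPolynomial σ ℂ →ₐ[ℂ] B) (hβ : Function.Surjective β)
    (hβdeg : ∀ r, ∀ F : MvPolynomial σ ℂ, F.IsHomogeneous r → β F ∈ ℬ r)
    (hker : wInit (fun i => -(m i : ℤ)) (RingHom.ker π) = RingHom.ker β) :
    IsFlatDegeneration 𝒜 ℬ := by
  obtain ⟨hgr⟩ := nonempty_gradedAlgebra_quotDeg
    (homogeneousComponent_mem_ker_familyHom (m := m) hI)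
  exact ⟨_, _, _, _, hgr, flat_quotient_ker_familyHom,
    Algebra.FiniteType.of_surjective (Ideal.Quotient.mkₐ (Polynomial ℂ) _)
      Ideal.Quotient.mk_surjective,
    fun c hc => isFibre_familyHom hπ hπdeg hc, isFibre_familyHom_zero β hβ hβdeg hker⟩

end FamilyFibres

/-! ### The toric degeneration -/

section ToricDegeneration

variable {k n : ℕ} {hkn : k ≤ n} {S : List (PosRoot n)}

/-- The weights of the family are integral weights `-m` with the same initial ideal as the weights
`𝔳_S(p̄_J)`; initial forms for nonpositive weights are the terms of maximal `m`-weight. -/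
theorem definesToricDegeneration_of_wInit_eq (hk : 1 ≤ k) (hlen : S.length = k * (n - k))
    (hN : IsMinorChart hkn (rootColumns hkn S))
    (hJ : wInit (keyWeight hkn S) (pluckerIdeal k n) =
      RingHom.ker (symbolHom (k := k) hkn S)) : DefinesToricDegeneration (k := k) hkn S := by
  refine ⟨fg_valueSemigroup hk hlen hN hJ.ge, exists_algEquiv_grS hlen hN, ?_⟩
  have hI := isGradedIdeal_pluckerIdeal (n := n) hk
  obtain ⟨m, hm⟩ := exists_nonpos_wInit_eq (keyWeight hkn S) hI
  have hker : RingHom.ker (plMk k n) = pluckerIdeal k n := Ideal.mk_ker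
  rw [← hm, ← hker] at hJ
  rw [← hker] at hI
  exact isFlatDegeneration_of_wInit hI plMk_surjective (fun r F hF => ⟨F, hF, rfl⟩)
    (symbolHom hkn S) (symbolHom_surjective hk hlen hN (by rw [← hJ, hker, hm]))
    (fun r F hF => symbolHom_mem_grDeg hF hlen hN) hJ

end ToricDegeneration

end FFLGr

end

theorem mainTheorem2 {k n : ℕ} (hk : 1 ≤ k) (hkn : k < n) (S : List (FFLGr.PosRoot n))
    (hS : FFLGr.IsIterated k n S) :
    (FFLGr.IsGradedValuation S (FFLGr.vS (k := k) hkn.le S) ∧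
      FFLGr.valRank S (FFLGr.vS (k := k) hkn.le S) = k * (n - k)) ∧
    (∃ C : Set (FFLGr.Idx k n → ℝ),
      FFLGr.IsTropCone (FFLGr.pluckerIdeal k n) C ∧ C ⊆ FFLGr.tropGr k n ∧
      FFLGr.ConeInit (FFLGr.pluckerIdeal k n) C
        (FFLGr.initIdealMat S (FFLGr.weightMatrix hkn.le S) (FFLGr.pluckerIdeal k n))) ∧
    ((FFLGr.initIdealMat S (FFLGr.weightMatrix hkn.le S) (FFLGr.pluckerIdeal k n)).IsPrime →
      FFLGr.DefinesToricDegeneration (k := k) hkn.le S ∧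
      ∃ φ : (MvPolynomial (FFLGr.Idx k n) ℂ ⧸
          FFLGr.initIdealMat S (FFLGr.weightMatrix hkn.le S) (FFLGr.pluckerIdeal k n)) ≃ₐ[ℂ]
          FFLGr.grS (k := k) hkn.le S,
        ∀ J : FFLGr.Idx k n,
          φ (Ideal.Quotient.mk _ (MvPolynomial.X J)) =
            FFLGr.symbol hkn.le S 1 (FFLGr.pbar J) (FFLGr.pbar_mem J)) := by
  obtain ⟨_, hlen, hchart⟩ := FFLGr.IsIterated.isMinorChart hS
  have hN := hchart hkn.le
  rw [FFLGr.initIdealMat_weightMatrix]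
  refine ⟨⟨FFLGr.isGradedValuation_vS hlen hN, FFLGr.valRank_vS hlen hN⟩,
    FFLGr.exists_tropCone_pluckerIdeal hk hlen hN, fun hprime => ?_⟩
  have hJ := FFLGr.wInit_eq_ker_symbolHom hk hlen hN hprime
  exact ⟨FFLGr.definesToricDegeneration_of_wInit_eq hk hlen hN hJ,
    FFLGr.exists_algEquiv_quotient hk hlen hN hJ⟩
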